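/- **Setting.** An instance of graph vertex pricing (GVP) is a finite multigraph $G=(V,E)$ without loops (vertices are products, edges are consumers; parallel edges are allowed and degrees are counted with multiplicity) with a budget $B_e\in\mathbb{Q}_{\ge 0}$ for every edge $e$. The revenue of a price function $p:V\to\mathbb{R}_{\ge 0}$ is $$\mathrm{rev}(p)=\sum_{e=uv\in E}\begin{cases}p(u)+p(v)&\text{if }p(u)+p(v)\le B_e,\\0&\text{otherwise,}\end{cases}$$ and the goal is to maximize it. A $\rho$-approximation algorithm outputs, on every instance of the class in question, a price function $p$ with $\mathrm{rev}(q)\le\rho\cdot\mathrm{rev}(p)$ for all $q:V\to\mathbb{R}_{\ge 0}$. Algorithms are deterministic, output rational prices (as fractions), and run in time polynomial in the length of the input (list of vertices, list of edges, budgets as fractions in binary; for $k$-partite graphs also $k$ and the color class of every vertex). Running time is the number of steps of a random access machine whose unit-cost operations are constants, reading and writing memory cells, addition, truncated subtraction, halving and zero tests; polynomial time on it is polynomial time in the usual sense. **Theorem.** 1. There is a polynomial-time algorithm that outputs an optimal price function (one that maximizes the revenue over all $p:V\to\mathbb{R}_{\ge0}$) for every GVP instance on a graph of maximum degree at most $2$.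 2. There is a polynomial-time $2$-approximation algorithm for GVP on graphs of maximum degree at most $4$. 3. There is a single polynomial-time algorithm which, given $k\ge 1$, a GVP instance on a $k$-partite graph and its partition into $k$ color classes (no edge joins two vertices of the same class), achieves the approximation factor $4\left(1-\frac1k\right)$ if $k$ is even and $\frac{4k}{k+1}$ if $k$ is odd. -/

import Mathlib

open scoped NNReal

/-! ## A random access machine with a step count

The machine has countably many arrays of natural numbers, of which a program uses finitely many.
Elementary operations are constants, reading and writing an array cell (the index may itself be
computed), addition, truncated subtraction, halving, and a test for zero. Each of them costs one
step; multiplication is not an elementary operation, so that in `t` steps the bit length of the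
largest number in memory grows by `O(t)` only. Polynomial time on this machine is therefore the
usual notion of polynomial time. -/

namespace RAM

/-- The memory: `s a i` is the content of cell `i` of array `a`. -/
abbrev Store : Type := ℕ → ℕ → ℕ

/-- Expressions; `read a i` is the cell of array `a` whose index is the value of `i`. -/
inductive Expr : Type
  | const (c : ℕ)
  | read (a : ℕ) (i : Expr)
  | add (x y : Expr)
  | sub (x y : Expr)
  | half (x : Expr)

/-- The value of an expression; subtraction is truncated at `0` and halving rounds down. -/
def Expr.eval (s : Store) : Expr → ℕ
  | .const c => c
  | .read a i => s a (i.eval s)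
  | .add x y => x.eval s + y.eval s
  | .sub x y => x.eval s - y.eval s
  | .half x => x.eval s / 2

/-- The number of elementary operations in the evaluation of an expression. -/
def Expr.cost : Expr → ℕ
  | .const _ => 1
  | .read _ i => i.cost + 1
  | .add x y => x.cost + y.cost + 1
  | .sub x y => x.cost + y.cost + 1
  | .half x => x.cost + 1

/-- Programs. `write a i x` stores the value of `x` in cell `i` of array `a`;
`ite b c d` runs `c` if the value of `b` is nonzero and `d` otherwise;
`loop b c` repeats `c` as long as the value of `b` is nonzero. -/
inductive Prog : Type
  | skip
  | write (a : ℕ) (i x : Expr)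
  | seq (c d : Prog)
  | ite (b : Expr) (c d : Prog)
  | loop (b : Expr) (c : Prog)

/-- The memory after `v` has been stored in cell `i` of array `a`. -/
def Store.set (s : Store) (a i v : ℕ) : Store :=
  fun a' i' => if a' = a ∧ i' = i then v else s a' i'

/-- `Run c s s' t`: started in memory `s`, the program `c` halts after exactly `t` steps
and leaves memory `s'`. -/
inductive Run : Prog → Store → Store → ℕ → Prop
  | skip (s : Store) : Run .skip s s 1
  | write (s : Store) (a : ℕ) (i x : Expr) :
      Run (.write a i x) s (s.set a (i.eval s) (x.eval s)) (i.cost + x.cost + 1)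
  | seq {c d : Prog} {s s' s'' : Store} {t t' : ℕ} :
      Run c s s' t → Run d s' s'' t' → Run (.seq c d) s s'' (t + t')
  | ite_true {b : Expr} {c d : Prog} {s s' : Store} {t : ℕ} :
      b.eval s ≠ 0 → Run c s s' t → Run (.ite b c d) s s' (b.cost + 1 + t)
  | ite_false {b : Expr} {c d : Prog} {s s' : Store} {t : ℕ} :
      b.eval s = 0 → Run d s s' t → Run (.ite b c d) s s' (b.cost + 1 + t)
  | loop_done {b : Expr} {c : Prog} {s : Store} :
      b.eval s = 0 → Run (.loop b c) s s (b.cost + 1)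
  | loop_step {b : Expr} {c : Prog} {s s' s'' : Store} {t t' : ℕ} :
      b.eval s ≠ 0 → Run c s s' t → Run (.loop b c) s' s'' t' →
      Run (.loop b c) s s'' (b.cost + 1 + t + t')

/-- The initial memory on input `w`: list number `a` of `w` is written in array `a`, and all
other cells are `0`. -/
def load (w : List (List ℕ)) : Store :=
  fun a i => (w.getD a []).getD i 0

/-- The length of an input in binary, with one separator for every number. -/
def inputSize (w : List (List ℕ)) : ℕ :=
  (w.map fun l => (l.map fun x => x.size + 1).sum).sum

/-- The memory `s` shows the output `w`: every list number `a` of `w` stands at the beginning of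
array `a`. -/
def Holds (s : Store) (w : List (List ℕ)) : Prop :=
  ∀ (a : ℕ) (ha : a < w.length) (i : ℕ) (hi : i < w[a].length), s a i = w[a][i]

/-- The search problem "given an input `x` with `D x`, find some `y` with `R x y`" can be solved
by a deterministic algorithm whose number of steps is at most a polynomial in the length of the
input. Inputs are presented by `encIn`, solutions by `encOut`. -/
def PolyTimeSolvable {α : Type*} {β : α → Type*} (D : α → Prop)
    (encIn : α → List (List ℕ)) (encOut : (x : α) → β x → List (List ℕ))
    (R : (x : α) → β x → Prop) : Prop :=
  ∃ (c : Prog) (q : Polynomial ℕ), ∀ x : α, D x →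
    ∃ (s : Store) (t : ℕ) (y : β x),
      Run c (load (encIn x)) s t ∧ t ≤ q.eval (inputSize (encIn x)) ∧
        Holds s (encOut x y) ∧ R x y

end RAM

/-! ## Graph vertex pricing -/

namespace GVP

/-- An instance of graph vertex pricing: a multigraph on the vertices (products) `0, …, n - 1`
whose edges (consumers) `0, …, m - 1` carry nonnegative rational budgets. Every consumer wants two
different products; several consumers may want the same two. -/
structure PricingInstance where
  n : ℕ
  m : ℕ
  src : Fin m → Fin n
  tgt : Fin m → Fin n
  src_ne_tgt : ∀ e, src e ≠ tgt e
  budget : Fin m → ℚ≥0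

namespace PricingInstance

/-- The revenue of a price function: consumer `e` pays the sum of the two prices if it is within
the budget, and nothing otherwise. -/
noncomputable def revenue (I : PricingInstance) (p : Fin I.n → ℝ≥0) : ℝ :=
  ∑ e : Fin I.m,
    if (p (I.src e) : ℝ) + (p (I.tgt e) : ℝ) ≤ (I.budget e : ℝ) then
      (p (I.src e) : ℝ) + (p (I.tgt e) : ℝ)
    else 0

/-- The price function `p` maximizes the revenue among all nonnegative real price functions. -/
def IsOptimal (I : PricingInstance) (p : Fin I.n → ℝ≥0) : Prop :=
  ∀ q : Fin I.n → ℝ≥0, I.revenue q ≤ I.revenue p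

/-- The revenue of `p` is within the factor `ρ` of that of every price function. -/
def IsApprox (I : PricingInstance) (ρ : ℝ) (p : Fin I.n → ℝ≥0) : Prop :=
  ∀ q : Fin I.n → ℝ≥0, I.revenue q ≤ ρ * I.revenue p

/-- The number of edges at `v`, counted with multiplicity. -/
def degree (I : PricingInstance) (v : Fin I.n) : ℕ :=
  (Finset.univ.filter fun e : Fin I.m => I.src e = v ∨ I.tgt e = v).card

/-- The input: the numbers of vertices and of edges, the list of vertices, and, for the edges in
their order, the first end, the second end, and numerator and denominator of the budget. -/
def encode (I : PricingInstance) : List (List ℕ) :=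
  [[I.n, I.m],
   List.ofFn fun v : Fin I.n => (v : ℕ),
   List.ofFn fun e : Fin I.m => (I.src e : ℕ),
   List.ofFn fun e : Fin I.m => (I.tgt e : ℕ),
   List.ofFn fun e : Fin I.m => (I.budget e).num,
   List.ofFn fun e : Fin I.m => (I.budget e).den]

/-- Rational prices, as fractions that need not be in lowest terms. -/
abbrev Fractions (I : PricingInstance) : Type := Fin I.n → ℕ × ℕ+

/-- The price function given by a family of fractions. -/
noncomputable def Fractions.price {I : PricingInstance} (y : I.Fractions) : Fin I.n → ℝ≥0 :=
  fun v => ((y v).1 : ℝ≥0) / ((y v).2 : ℝ≥0)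

/-- The output: the list of the numerators and the list of the denominators of the prices. -/
def encodePrices (I : PricingInstance) (y : I.Fractions) : List (List ℕ) :=
  [List.ofFn fun v : Fin I.n => (y v).1,
   List.ofFn fun v : Fin I.n => ((y v).2 : ℕ)]

end PricingInstance

/-- An instance on a `k`-partite graph, given together with its partition into `k` color classes:
no edge joins two vertices of the same class. -/
structure PartiteInstance extends PricingInstance where
  k : ℕ
  color : Fin n → Fin k
  proper : ∀ e, color (src e) ≠ color (tgt e)

/-- The input for a `k`-partite graph: the instance, the number `k`, and the color classes of
the vertices. -/
def PartiteInstance.encode (J : PartiteInstance) : List (List ℕ) :=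
  J.toPricingInstance.encode ++
    [[J.k], List.ofFn fun v : Fin J.n => (J.color v : ℕ)]

/-- The approximation factor for `k`-partite graphs: `4 (1 - 1 / k)` for even `k` and
`4 k / (k + 1)` for odd `k`. -/
noncomputable def partiteFactor (k : ℕ) : ℝ :=
  if Even k then 4 * (1 - 1 / (k : ℝ)) else 4 * (k : ℝ) / ((k : ℝ) + 1)

end GVP

/-! Degree two. The components are paths and cycles. Every edge is doubled and the two copies of a
path are glued at its end vertices, so that only cycles remain; they are the cycles of a permutation
`φ` of the copies of half-edges, one cycle for each direction of travel. Fix arbitrary prices `Q`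
and keep the constraints `P v + P (φ v) ≤ w v` of the consumers who buy at `Q`, together with `P ≥
0`. On this polyhedron the revenue from these consumers is linear and bounded, so it can be raised
to that of a point whose tight constraints have full rank (`exists_tight`). There, each component of
the tight edges contains a price zero or an odd cycle, since otherwise raising and lowering its
prices alternately would preserve all tight constraints. Hence every price is, up to sign, an
alternating sum of consecutive budgets or half of one (`price_of_rigid`, `exists_candidate_prices`).
Quadratically many candidates remain, and dynamic programming around each cycle finds the best
choice (`PermOn.val_sum_le`). `keyRevenue_le` carries optimality from the doubled graph back to the
graph.

Degree four. The half-edges at each vertex are paired and the edges oriented such that partners have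
different directions. The same is done once more with half-edges grouped by vertex and direction.
The parity of the two directions is a colour of the edge, and each colour has at most two edges at
each vertex (`rank_splitKey`), as in Petersen's theorem on 2-factors. No revenue exceeds the sum of
the optima of the two colours, so the better of two optimal price functions is a 2-approximation.

Colour classes. Let `W` be the sum, over all vertices, of the best revenue obtainable at the vertex
when its neighbours are free; `W` bounds every revenue (`keyRevenue_le_gain`). Let `q` be `k` or `k
- 1`, whichever is odd. The complete graph on `q + 1` colours splits into `q` perfect matchings, and
the pairs of some matching contain edges of weight at least `W / q`. Splitting every pair and
arranging the pairs greedily cuts those edges and half of the others, which amounts to `(q + 1) W /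
(2 q)` (`sum_le_cut`). One side of the cut gets its best prices, the other is free; the better
choice of the side earns at least `(q + 1) W / (4 q)`, which is the claimed factor.

Running time. The algorithms are written in a language whose loops are all capped by one number `N`.
Compiled expressions halt within a number of steps polynomial in `N` (`halts_compile`), and `N` is a
polynomial in the numbers of vertices and edges and a bit length of the budgets. What remains is to
check that no loop used needs more than `N` rounds. Budgets are scaled to even integers, so that all
candidate prices are integers with the common scaling factor as denominator. -/

namespace RAM

/-! ## An expression language with bounded loops and its compilation -/

/-- Iteration with an index: `iterate f a n = f (n-1) (… (f 0 a))`. -/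
def iterate (f : ℕ → ℕ → ℕ) (a : ℕ) : ℕ → ℕ
  | 0 => a
  | n + 1 => f n (iterate f a n)

/-- Expressions with bounded loops. Variables are de Bruijn indices. In `loop cnt init body` the body
has two more variables, the number of the round and the current value; the number of rounds is
capped by cell `(8, 0)`. `app f x` passes the argument `x` to `f`, and `fn f` is a function whose
variables are the arguments passed. -/
inductive Ex : Type
  | const (c : ℕ)
  | var (i : ℕ)
  | read (a : ℕ) (e : Ex)
  | add (x y : Ex)
  | sub (x y : Ex)
  | half (x : Ex)
  | ite (b x y : Ex)
  | loop (cnt init body : Ex)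
  | app (f x : Ex)
  | fn (f : Ex)

/-- The value of an expression in a memory, for a list of values of the variables and a list of
arguments. -/
def Ex.eval (s : Store) : Ex → List ℕ → List ℕ → ℕ
  | .const c, _, _ => c
  | .var i, ρ, _ => ρ.getD i 0
  | .read a e, ρ, _ => s a (e.eval s ρ [])
  | .add x y, ρ, _ => x.eval s ρ [] + y.eval s ρ []
  | .sub x y, ρ, _ => x.eval s ρ [] - y.eval s ρ []
  | .half x, ρ, _ => x.eval s ρ [] / 2
  | .ite b x y, ρ, _ => if b.eval s ρ [] ≠ 0 then x.eval s ρ [] else y.eval s ρ []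
  | .loop c i b, ρ, _ =>
      iterate (fun j acc => b.eval s (j :: acc :: ρ) []) (i.eval s ρ []) (min (c.eval s ρ []) (s 8 0))
  | .app f x, ρ, st => f.eval s ρ (x.eval s ρ [] :: st)
  | .fn f, _, st => f.eval s st []

/-- The place of array `a` in the memory of the machine; array `8` holds the registers. -/
def arr (a : ℕ) : ℕ := if a < 8 then a else a + 1

/-- The memory without the registers. -/
def abs (s : Store) : Store := fun a => s (arr a)

/-- Register number `d`. -/
def rd (d : ℕ) : Expr := .read 8 (.const d)

/-- Assignment to register number `d`. -/
def wr (d : ℕ) (x : Expr) : Prog := .write 8 (.const d) x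

/-- The program that puts the value of an expression into register `d` and leaves the smaller
registers unchanged; `Γ` and `Δ` are the registers of the variables and of the arguments. -/
def compile : Ex → List ℕ → List ℕ → ℕ → Prog
  | .const c, _, _, d => wr d (.const c)
  | .var i, Γ, _, d => wr d (if h : i < Γ.length then rd Γ[i] else .const 0)
  | .read a e, Γ, _, d => .seq (compile e Γ [] d) (wr d (.read (arr a) (rd d)))
  | .add x y, Γ, _, d => .seq (compile x Γ [] d)
      (.seq (compile y Γ [] (d + 1)) (wr d (.add (rd d) (rd (d + 1)))))
  | .sub x y, Γ, _, d => .seq (compile x Γ [] d)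
      (.seq (compile y Γ [] (d + 1)) (wr d (.sub (rd d) (rd (d + 1)))))
  | .half x, Γ, _, d => .seq (compile x Γ [] d) (wr d (.half (rd d)))
  | .ite b x y, Γ, _, d => .seq (compile b Γ [] d)
      (.ite (rd d) (compile x Γ [] d) (compile y Γ [] d))
  | .loop c i b, Γ, _, d => .seq (compile i Γ [] d) (.seq (compile c Γ [] (d + 1))
      (.seq (wr (d + 2) (.const 0))
        -- With `N` in cell `(9, 0)`, truncated subtraction gives `c - (c - N) = min c N`; the test
        -- compares this with the round counter.
        (.loop (.sub (.sub (rd (d + 1)) (.sub (rd (d + 1)) (.read 9 (.const 0)))) (rd (d + 2)))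
          (.seq (compile b ((d + 2) :: d :: Γ) [] (d + 3))
            (.seq (wr d (rd (d + 3))) (wr (d + 2) (.add (rd (d + 2)) (.const 1))))))))
  | .app f x, Γ, Δ, d => .seq (compile x Γ [] d)
      (.seq (compile f Γ (d :: Δ) (d + 1)) (wr d (rd (d + 1))))
  | .fn f, _, Δ, d => compile f Δ [] d

/-- The memories agree except in the registers from number `d` on. -/
def Agree (d : ℕ) (s s' : Store) : Prop := ∀ a i, a ≠ 8 ∨ i < d → s' a i = s a i

theorem Agree.refl (d : ℕ) (s : Store) : Agree d s s := fun _ _ _ => rfl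

theorem Agree.trans {d d' : ℕ} {s s' s'' : Store} (h : Agree d s s') (h' : Agree d' s' s'')
    (hd : d ≤ d') : Agree d s s'' := fun a i hi => by
  rw [h' a i (hi.imp id fun h => lt_of_lt_of_le h hd), h a i hi]

theorem Agree.set {d k : ℕ} (s : Store) (v : ℕ) (hk : d ≤ k) : Agree d s (s.set 8 k v) := by
  intro a i hi
  simp only [Store.set]
  rw [if_neg]
  omega

theorem Agree.abs {d : ℕ} {s s' : Store} (h : Agree d s s') : abs s' = abs s := by
  funext a i
  apply h
  left
  unfold arr
  split <;> omega

theorem Agree.map {d : ℕ} {s s' : Store} (h : Agree d s s') {Γ : List ℕ} (hΓ : ∀ r ∈ Γ, r < d) :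
    Γ.map (s' 8) = Γ.map (s 8) := by
  apply List.map_congr_left
  intro r hr
  exact h 8 r (Or.inr (hΓ r hr))

/-- `Halts c s t P`: from memory `s` the program halts within `t` steps in a memory with `P`. -/
def Halts (c : Prog) (s : Store) (t : ℕ) (P : Store → Prop) : Prop :=
  ∃ s' t', Run c s s' t' ∧ t' ≤ t ∧ P s'

theorem Halts.mono {c : Prog} {s : Store} {t t' : ℕ} {P Q : Store → Prop} (h : Halts c s t P)
    (ht : t ≤ t') (hPQ : ∀ s', P s' → Q s') : Halts c s t' Q := by
  obtain ⟨s', u, h1, h2, h3⟩ := h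
  exact ⟨s', u, h1, h2.trans ht, hPQ _ h3⟩

theorem Halts.seq {c d : Prog} {s : Store} {t t' : ℕ} {P Q : Store → Prop} (h : Halts c s t P)
    (h' : ∀ s', P s' → Halts d s' t' Q) : Halts (.seq c d) s (t + t') Q := by
  obtain ⟨s', u, h1, h2, h3⟩ := h
  obtain ⟨s'', u', h1', h2', h3'⟩ := h' s' h3
  exact ⟨s'', u + u', Run.seq h1 h1', by omega, h3'⟩

theorem Halts.write {a : ℕ} {i x : Expr} {s : Store} {P : Store → Prop}
    (h : P (s.set a (i.eval s) (x.eval s))) : Halts (.write a i x) s (i.cost + x.cost + 1) P :=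
  ⟨_, _, Run.write s a i x, le_rfl, h⟩

theorem Halts.ite {b : Expr} {c d : Prog} {s : Store} {t t' : ℕ} {P : Store → Prop}
    (h : b.eval s ≠ 0 → Halts c s t P) (h' : b.eval s = 0 → Halts d s t' P) :
    Halts (.ite b c d) s (b.cost + 1 + t + t') P := by
  by_cases hb : b.eval s = 0
  · obtain ⟨s', u, h1, h2, h3⟩ := h' hb
    exact ⟨s', _, Run.ite_false hb h1, by omega, h3⟩
  · obtain ⟨s', u, h1, h2, h3⟩ := h hb
    exact ⟨s', _, Run.ite_true hb h1, by omega, h3⟩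

/-- A loop with invariant `P j` in round `j` and exactly `n` rounds. -/
theorem Halts.loop {b : Expr} {c : Prog} {t : ℕ} (P : ℕ → Store → Prop) (n : ℕ)
    (hb : ∀ j s, j < n → P j s → b.eval s ≠ 0) (hn : ∀ s, P n s → b.eval s = 0)
    (hc : ∀ j s, j < n → P j s → Halts c s t (P (j + 1))) (s : Store) (hs : P 0 s) :
    Halts (.loop b c) s ((n + 1) * (b.cost + 1 + t)) (P n) := by
  suffices h : ∀ k j s, j + k = n → P j s → Halts (.loop b c) s ((k + 1) * (b.cost + 1 + t)) (P n) by
    exact h n 0 s (by omega) hs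
  intro k
  induction k with
  | zero =>
    intro j s hj hP
    obtain rfl : j = n := by omega
    exact ⟨s, _, Run.loop_done (hn s hP), by simp, hP⟩
  | succ k ih =>
    intro j s hj hP
    obtain ⟨s', u, h1, h2, h3⟩ := hc j s (by omega) hP
    obtain ⟨s'', u', h1', h2', h3'⟩ := ih (j + 1) s' (by omega) h3
    refine ⟨s'', _, Run.loop_step (hb j s (by omega) hP) h1 h1', ?_, h3'⟩
    have : (k + 1 + 1) * (b.cost + 1 + t) = (b.cost + 1 + t) + (k + 1) * (b.cost + 1 + t) := by ring
    omega

theorem eval_rd (s : Store) (d : ℕ) : (rd d).eval s = s 8 d := rfl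

theorem set_same (s : Store) (a i v : ℕ) : s.set a i v a i = v := by simp [Store.set]

theorem set_of_ne {s : Store} {a i v a' i' : ℕ} (h : ¬ (a' = a ∧ i' = i)) :
    s.set a i v a' i' = s a' i' := by simp only [Store.set, if_neg h]

/-- Register assignment whose result value is `v`. -/
theorem Halts.wr {d v : ℕ} {x : Expr} {s s₀ : Store} (hx : x.eval s = v) (h : Agree d s₀ s) :
    Halts (wr d x) s (x.cost + 2) (fun s' => s' 8 d = v ∧ Agree d s₀ s') := by
  refine (Halts.write (P := fun s' => s' 8 d = v ∧ Agree d s₀ s') ?_).mono ?_ fun _ h => h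
  · exact ⟨by rw [hx]; exact set_same _ _ _ _, h.trans (Agree.set s _ le_rfl) le_rfl⟩
  · simp [Expr.cost]; omega

/-- The compiled program evaluates the expression, in time polynomial in cell `(8, 0)`. -/
theorem halts_compile (e : Ex) : ∃ q : Polynomial ℕ, ∀ (Γ Δ : List ℕ) (d : ℕ) (s : Store),
    (∀ r ∈ Γ, r < d) → (∀ r ∈ Δ, r < d) →
    Halts (compile e Γ Δ d) s (q.eval (s 9 0)) (fun s' =>
      s' 8 d = e.eval (abs s) (Γ.map (s 8)) (Δ.map (s 8)) ∧ Agree d s s') := by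
  -- The cap lies outside the registers and never changes, so the polynomials add up along sequences
  -- and gain a factor `X + 1` for each loop. `Agree` protects the intermediate results in smaller
  -- registers.
  induction e with
  | const c =>
    refine ⟨3, fun Γ Δ d s _ _ => ?_⟩
    refine (Halts.wr (v := c) rfl (Agree.refl d s)).mono ?_ fun s' h => h
    simp [Expr.cost]
  | var i =>
    refine ⟨4, fun Γ Δ d s _ _ => ?_⟩
    refine (Halts.wr (v := (Γ.map (s 8)).getD i 0) ?_ (Agree.refl d s)).mono ?_ fun s' h => h
    · by_cases h : i < Γ.length <;> simp [h, eval_rd, Expr.eval]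
    · by_cases h : i < Γ.length <;> simp [h, Expr.cost, rd]
  | read a e ih =>
    obtain ⟨q, hq⟩ := ih
    refine ⟨q + 5, fun Γ Δ d s hΓ _ => ?_⟩
    refine ((hq Γ [] d s hΓ (by simp)).seq (t' := 5) fun s' h' => ?_).mono (by simp) fun _ h => h
    refine (Halts.wr ?_ h'.2).mono (by simp [Expr.cost, rd]) fun _ h => h
    simp only [Expr.eval, eval_rd, h'.1, Ex.eval, List.map_nil]
    rw [← h'.2.abs]; rfl
  | add x y ihx ihy =>
    obtain ⟨q, hq⟩ := ihx
    obtain ⟨r, hr⟩ := ihy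
    refine ⟨q + (r + 7), fun Γ Δ d s hΓ _ => ?_⟩
    refine ((hq Γ [] d s hΓ (by simp)).seq (t' := (r + 7).eval (s 9 0)) fun s1 h1 => ?_).mono
      (by simp) fun _ h => h
    refine ((hr Γ [] (d + 1) s1 (fun r hr => (hΓ r hr).trans (by omega)) (by simp)).seq (t' := 7)
      fun s2 h2 => ?_).mono (by rw [h1.2 9 0 (by simp)]; simp) fun _ h => h
    refine (Halts.wr ?_ (h1.2.trans h2.2 (by omega))).mono (by simp [Expr.cost, rd]) fun _ h => h
    simp only [Expr.eval, eval_rd, h2.1, Ex.eval, List.map_nil, h1.2.abs, h1.2.map hΓ,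
      h2.2 8 d (by omega), h1.1]
  | sub x y ihx ihy =>
    obtain ⟨q, hq⟩ := ihx
    obtain ⟨r, hr⟩ := ihy
    refine ⟨q + (r + 7), fun Γ Δ d s hΓ _ => ?_⟩
    refine ((hq Γ [] d s hΓ (by simp)).seq (t' := (r + 7).eval (s 9 0)) fun s1 h1 => ?_).mono
      (by simp) fun _ h => h
    refine ((hr Γ [] (d + 1) s1 (fun r hr => (hΓ r hr).trans (by omega)) (by simp)).seq (t' := 7)
      fun s2 h2 => ?_).mono (by rw [h1.2 9 0 (by simp)]; simp) fun _ h => h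
    refine (Halts.wr ?_ (h1.2.trans h2.2 (by omega))).mono (by simp [Expr.cost, rd]) fun _ h => h
    simp only [Expr.eval, eval_rd, h2.1, Ex.eval, List.map_nil, h1.2.abs, h1.2.map hΓ,
      h2.2 8 d (by omega), h1.1]
  | half x ih =>
    obtain ⟨q, hq⟩ := ih
    refine ⟨q + 5, fun Γ Δ d s hΓ _ => ?_⟩
    refine ((hq Γ [] d s hΓ (by simp)).seq (t' := 5) fun s' h' => ?_).mono (by simp) fun _ h => h
    refine (Halts.wr ?_ h'.2).mono (by simp [Expr.cost, rd]) fun _ h => h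
    simp only [Expr.eval, eval_rd, h'.1, Ex.eval, List.map_nil]
  | ite b x y ihb ihx ihy =>
    obtain ⟨p, hp⟩ := ihb
    obtain ⟨q, hq⟩ := ihx
    obtain ⟨r, hr⟩ := ihy
    refine ⟨p + (3 + q + r), fun Γ Δ d s hΓ _ => ?_⟩
    refine ((hp Γ [] d s hΓ (by simp)).seq (t' := (3 + q + r).eval (s 9 0)) fun s1 h1 => ?_).mono
      (by simp) fun _ h => h
    have hb : (rd d).eval s1 = b.eval (abs s) (Γ.map (s 8)) [] := h1.1
    refine (Halts.ite (t := q.eval (s 9 0)) (t' := r.eval (s 9 0)) (fun h => ?_)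
      (fun h => ?_)).mono (by simp [Expr.cost, rd]) fun _ h => h
    · refine (hq Γ [] d s1 hΓ (by simp)).mono (by rw [h1.2 9 0 (by simp)]) fun s2 h2 => ?_
      refine ⟨?_, h1.2.trans h2.2 le_rfl⟩
      rw [h2.1, h1.2.abs, h1.2.map hΓ]
      rw [hb] at h
      simp [Ex.eval, h]
    · refine (hr Γ [] d s1 hΓ (by simp)).mono (by rw [h1.2 9 0 (by simp)]) fun s2 h2 => ?_
      refine ⟨?_, h1.2.trans h2.2 le_rfl⟩
      rw [h2.1, h1.2.abs, h1.2.map hΓ]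
      rw [hb] at h
      simp [Ex.eval, h]
  | loop c i b ihc ihi ihb =>
    obtain ⟨p, hp⟩ := ihc
    obtain ⟨q, hq⟩ := ihi
    obtain ⟨r, hr⟩ := ihb
    -- `12` pays for one loop test, `10` for the two assignments after the body, and `3` for
    -- clearing the counter.
    refine ⟨q + (p + (3 + (Polynomial.X + 1) * (12 + (r + 10)))), fun Γ Δ d s hΓ _ => ?_⟩
    refine ((hq Γ [] d s hΓ (by simp)).seq
      (t' := (p + (3 + (Polynomial.X + 1) * (12 + (r + 10)))).eval (s 9 0)) fun s1 h1 => ?_).mono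
      (by simp) fun _ h => h
    have e1 : s1 9 0 = s 9 0 := h1.2 9 0 (by simp)
    refine ((hp Γ [] (d + 1) s1 (fun r hr => (hΓ r hr).trans (by omega)) (by simp)).seq
      (t' := (3 + (Polynomial.X + 1) * (12 + (r + 10))).eval (s 9 0)) fun s2 h2 => ?_).mono
      (by rw [e1]; simp) fun _ h => h
    refine ((Halts.wr (d := d + 2) (v := 0) rfl (Agree.refl (d + 2) s2)).seq
      (t' := ((Polynomial.X + 1) * (12 + (r + 10))).eval (s 9 0)) fun s3 h3 => ?_).mono
      (by simp [Expr.cost]) fun _ h => h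
    have hc3 : s3 8 (d + 1) = c.eval (abs s) (Γ.map (s 8)) [] := by
      rw [h3.2 8 (d + 1) (by omega), h2.1, h1.2.abs, h1.2.map hΓ]; rfl
    have hi3 : s3 8 d = i.eval (abs s) (Γ.map (s 8)) [] := by
      rw [h3.2 8 d (by omega), h2.2 8 d (by omega), h1.1]; rfl
    have h03 : Agree d s s3 := (h1.2.trans h2.2 (by omega)).trans h3.2 (by omega)
    set n := min (c.eval (abs s) (Γ.map (s 8)) []) (abs s 8 0) with hn
    have hN : abs s 8 0 = s 9 0 := rfl
    set f := fun j acc => b.eval (abs s) (j :: acc :: Γ.map (s 8)) []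
    let P : ℕ → Store → Prop := fun j u => Agree d s u ∧
      u 8 (d + 1) = c.eval (abs s) (Γ.map (s 8)) [] ∧ u 8 (d + 2) = j ∧
      u 8 d = iterate f (i.eval (abs s) (Γ.map (s 8)) []) j
    have key := Halts.loop (b := .sub (.sub (rd (d + 1)) (.sub (rd (d + 1)) (.read 9 (.const 0))))
      (rd (d + 2))) (c := .seq (compile b ((d + 2) :: d :: Γ) [] (d + 3))
            (.seq (wr d (rd (d + 3))) (wr (d + 2) (.add (rd (d + 2)) (.const 1)))))
      (t := (r + 10).eval (s 9 0)) P n ?_ ?_ ?_ s3 ⟨h03, hc3, h3.1, by rw [hi3]; rfl⟩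
    · refine key.mono ?_ fun u hu => ⟨?_, hu.1⟩
      · simp only [Expr.cost, rd]
        simp only [Polynomial.eval_add, Polynomial.eval_mul, Polynomial.eval_X,
          Polynomial.eval_one, Polynomial.eval_ofNat]
        gcongr
        · rw [← hN]; exact min_le_right _ _
        · norm_num
      · rw [hu.2.2.2]; rfl
    · rintro j u hj ⟨hu1, hu2, hu3, hu4⟩
      simp only [Expr.eval, eval_rd, hu2, hu3, hu1 9 0 (by simp), ← hN]
      omega
    · rintro u ⟨hu1, hu2, hu3, hu4⟩
      simp only [Expr.eval, eval_rd, hu2, hu3, hu1 9 0 (by simp), ← hN]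
      omega
    · rintro j u hj ⟨hu1, hu2, hu3, hu4⟩
      have hmap : ((d + 2) :: d :: Γ).map (u 8)
          = j :: iterate f (i.eval (abs s) (Γ.map (s 8)) []) j :: Γ.map (s 8) := by
        rw [List.map_cons, List.map_cons, hu3, hu4, hu1.map hΓ]
      refine ((hr ((d + 2) :: d :: Γ) [] (d + 3) u ?_ (by simp)).seq (t' := 10)
        fun v hv => ?_).mono (by rw [hu1 9 0 (by simp)]; simp) fun _ h => h
      · intro x hx
        simp only [List.mem_cons] at hx
        rcases hx with rfl | rfl | hx
        · omega
        · omega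
        · have := hΓ x hx; omega
      have hv1 : v 8 (d + 3) = iterate f (i.eval (abs s) (Γ.map (s 8)) []) (j + 1) := by
        rw [hv.1, hmap, hu1.abs]; rfl
      refine (Halts.seq (t := 4) (t' := 6) (P := fun w => w = v.set 8 d (v 8 (d + 3)))
        ?_ fun w hw => ?_)
      · exact (Halts.write (P := fun w => w = v.set 8 d (v 8 (d + 3))) rfl).mono
          (by simp [Expr.cost, rd]) fun _ h => h
      · refine (Halts.write ?_).mono (by simp [Expr.cost, rd]) fun _ h => h
        subst hw
        have hv2 : v 8 (d + 2) = j := by rw [hv.2 8 (d + 2) (by omega), hu3]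
        refine ⟨((hu1.trans hv.2 (by omega)).trans (Agree.set v _ le_rfl) le_rfl).trans
          (Agree.set _ _ (by simp only [Expr.eval]; omega)) (d' := d) le_rfl, ?_, ?_, ?_⟩
        · rw [set_of_ne (by simp [Expr.eval]), set_of_ne (by omega), hv.2 8 (d + 1) (by omega), hu2]
        · simp only [Expr.eval]
          rw [set_same, eval_rd, set_of_ne (by omega), hv2]
        · rw [set_of_ne (by simp [Expr.eval]), set_same, hv1]
  | app f x ihf ihx =>
    obtain ⟨q, hq⟩ := ihx
    obtain ⟨r, hr⟩ := ihf
    refine ⟨q + (r + 4), fun Γ Δ d s hΓ hΔ => ?_⟩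
    refine ((hq Γ [] d s hΓ (by simp)).seq (t' := (r + 4).eval (s 9 0)) fun s1 h1 => ?_).mono
      (by simp) fun _ h => h
    refine ((hr Γ (d :: Δ) (d + 1) s1 (fun r hr => (hΓ r hr).trans (by omega)) ?_).seq (t' := 4)
      fun s2 h2 => ?_).mono (by rw [h1.2 9 0 (by simp)]; simp) fun _ h => h
    · intro x hx
      rcases List.mem_cons.1 hx with rfl | hx
      · omega
      · have := hΔ x hx; omega
    refine (Halts.wr ?_ (h1.2.trans h2.2 (by omega))).mono (by simp [Expr.cost, rd]) fun _ h => h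
    rw [eval_rd, h2.1, h1.2.abs, h1.2.map hΓ, List.map_cons, h1.2.map hΔ, h1.1]
    rfl
  | fn f ih =>
    obtain ⟨q, hq⟩ := ih
    refine ⟨q, fun Γ Δ d s _ hΔ => ?_⟩
    exact hq Δ [] d s hΔ (by simp)

end RAM

namespace RAM

/-! ## Programs that fill arrays one after the other -/

theorem eval_mono_nat (q : Polynomial ℕ) {a b : ℕ} (h : a ≤ b) : q.eval a ≤ q.eval b := by
  rw [Polynomial.eval_eq_sum_range, Polynomial.eval_eq_sum_range]
  gcongr

theorem iterate_add (g : ℕ → ℕ) (a n : ℕ) :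
    iterate (fun j acc => acc + g j) a n = a + ∑ j ∈ Finset.range n, g j := by
  induction n with
  | zero => simp [iterate]
  | succ n ih => rw [iterate, ih, Finset.sum_range_succ, add_assoc]

theorem arr_injective : Function.Injective arr := by
  intro a b h
  simp only [arr] at h
  split at h <;> split at h <;> omega

theorem arr_ne (a : ℕ) : arr a ≠ 8 := by
  unfold arr; split <;> omega

theorem abs_set (s : Store) (a i v : ℕ) : abs (s.set (arr a) i v) = (abs s).set a i v := by
  funext a' i'
  simp only [abs, Store.set, arr_injective.eq_iff]

theorem abs_set_reg (s : Store) (i v : ℕ) : abs (s.set 8 i v) = abs s := by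
  funext a' i'
  simp only [abs, Store.set, arr_ne, false_and, if_false]

/-- Store the value of an expression in cell `0` of array `a`. -/
def assign (a : ℕ) (e : Ex) : Prog :=
  .seq (compile e [] [] 0) (.write (arr a) (.const 0) (rd 0))

theorem halts_assign (a : ℕ) (e : Ex) : ∃ q : Polynomial ℕ, ∀ s : Store,
    Halts (assign a e) s (q.eval (abs s 8 0))
      (fun s' => abs s' = (abs s).set a 0 (e.eval (abs s) [] [])) := by
  obtain ⟨q, hq⟩ := halts_compile e
  refine ⟨q + 4, fun s => ?_⟩
  refine ((hq [] [] 0 s (by simp) (by simp)).seq (t' := 4) fun s' h => ?_).mono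
    (by rw [Polynomial.eval_add, Polynomial.eval_ofNat]; rfl) fun _ h => h
  refine (Halts.write ?_).mono (by simp [Expr.cost, rd]) fun _ h => h
  rw [abs_set, h.2.abs, eval_rd, h.1]
  rfl

/-- For `t = 0, 1, …` below cell `(8, 0)`, store the value of `e` at `t` in cell `t` of array `a`. -/
def fill (a : ℕ) (e : Ex) : Prog :=
  .seq (wr 0 (.const 0)) (.loop (.sub (.read 9 (.const 0)) (rd 0))
    (.seq (compile e [0] [] 1) (.seq (.write (arr a) (rd 0) (rd 1))
      (wr 0 (.add (rd 0) (.const 1))))))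

/-- The memory after `t` rounds of `fill`. -/
def fillSteps (a : ℕ) (e : Ex) (M : Store) : ℕ → Store
  | 0 => M
  | t + 1 => (fillSteps a e M t).set a t (e.eval (fillSteps a e M t) [t] [])

/-- The memory after `fill`. -/
def filled (a : ℕ) (e : Ex) (M : Store) : Store := fillSteps a e M (M 8 0)

theorem fillSteps_of_ne {a : ℕ} {e : Ex} {M : Store} {a' : ℕ} (h : a' ≠ a) (t : ℕ) :
    fillSteps a e M t a' = M a' := by
  induction t with
  | zero => rfl
  | succ t ih =>
    funext i
    rw [fillSteps, set_of_ne (fun h' => h h'.1), ih]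

/-- Array `8` is excluded because its cell `0` controls the number of rounds and has to stay fixed
meanwhile. -/
theorem halts_fill {a : ℕ} (ha : a ≠ 8) (e : Ex) : ∃ q : Polynomial ℕ, ∀ s : Store,
    Halts (fill a e) s (q.eval (abs s 8 0)) (fun s' => abs s' = filled a e (abs s)) := by
  obtain ⟨q, hq⟩ := halts_compile e
  refine ⟨3 + (Polynomial.X + 1) * (7 + (q + 12)), fun s => ?_⟩
  refine ((Halts.wr (d := 0) (v := 0) rfl (Agree.refl 0 s)).seq
    (t' := ((Polynomial.X + 1) * (7 + (q + 12))).eval (abs s 8 0)) fun s1 h1 => ?_).mono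
      (by simp [Expr.cost]) fun _ h => h
  have hN : ∀ u : Store, u 9 0 = abs u 8 0 := fun _ => rfl
  have hM : ∀ t, fillSteps a e (abs s) t 8 0 = abs s 8 0 := fun t => by
    rw [fillSteps_of_ne ha.symm]
  have key := Halts.loop (b := .sub (.read 9 (.const 0)) (rd 0))
    (c := .seq (compile e [0] [] 1) (.seq (.write (arr a) (rd 0) (rd 1))
      (wr 0 (.add (rd 0) (.const 1))))) (t := (q + 12).eval (abs s 8 0))
    (fun j u => u 8 0 = j ∧ abs u = fillSteps a e (abs s) j) (abs s 8 0)
    ?_ ?_ ?_ s1 ⟨h1.1, h1.2.abs⟩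
  · refine key.mono ?_ fun u hu => hu.2
    simp [Expr.cost, rd]
  · rintro j u hj ⟨h, h'⟩
    simp only [Expr.eval, eval_rd, hN, h, h', hM]
    omega
  · rintro u ⟨h, h'⟩
    simp only [Expr.eval, eval_rd, hN, h, h', hM]
    omega
  · rintro j u hj ⟨h, h'⟩
    refine ((hq [0] [] 1 u (by simp) (by simp)).seq (t' := 12) fun v hv => ?_).mono
      (by rw [hN u, h', hM]; simp) fun _ h => h
    refine (Halts.seq (t := 6) (t' := 6) (P := fun w => w = v.set (arr a) j (v 8 1))
        ?_ fun w hw => ?_)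
    · refine (Halts.write (P := fun w => w = v.set (arr a) j (v 8 1)) ?_).mono
        (by simp [Expr.cost, rd]) fun _ h => h
      rw [eval_rd, eval_rd, hv.2 8 0 (by omega), h]
    · refine (Halts.write ?_).mono (by simp [Expr.cost, rd]) fun _ h => h
      subst hw
      have h8 : (8 : ℕ) ≠ arr a := (arr_ne a).symm
      constructor
      · simp only [Expr.eval]
        rw [set_same, eval_rd, set_of_ne (fun h => h8 h.1), hv.2 8 0 (by omega), h]
      · rw [abs_set_reg, abs_set, hv.2.abs, hv.1, h', fillSteps]
        simp only [List.map_cons, List.map_nil, h]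

theorem filled_of_ne {a : ℕ} {e : Ex} {M : Store} {a' : ℕ} (h : a' ≠ a) :
    filled a e M a' = M a' := fillSteps_of_ne h _

/-- The contents of an array filled by course-of-values recursion. -/
theorem filled_apply {a : ℕ} {e : Ex} {M : Store} (g : ℕ → ℕ)
    (h : ∀ t, t < M 8 0 → ∀ M' : Store, (∀ a', a' ≠ a → M' a' = M a') → (∀ j, j < t → M' a j = g j) →
      e.eval M' [t] [] = g t) {i : ℕ} (hi : i < M 8 0) : filled a e M a i = g i := by
  have : ∀ t, t ≤ M 8 0 → ∀ j, j < t → fillSteps a e M t a j = g j := by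
    intro t
    induction t with
    | zero => intro _ j hj; omega
    | succ t ih =>
      intro ht j hj
      rw [fillSteps]
      by_cases hjt : j = t
      · subst hjt
        rw [set_same]
        exact h j (by omega) _ (fun a' ha' => fillSteps_of_ne ha' _) (ih (by omega))
      · rw [set_of_ne (by omega)]
        exact ih (by omega) j (by omega)
  exact this _ le_rfl i hi

/-- Fill several arrays one after the other. -/
def stages : List (ℕ × Ex) → Prog
  | [] => .skip
  | p :: l => .seq (fill p.1 p.2) (stages l)

/-- The memory after `stages`. -/
def staged : List (ℕ × Ex) → Store → Store
  | [], M => M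
  | p :: l, M => staged l (filled p.1 p.2 M)

theorem halts_stages (l : List (ℕ × Ex)) (hl : ∀ p ∈ l, p.1 ≠ 8) : ∃ q : Polynomial ℕ, ∀ s : Store,
    Halts (stages l) s (q.eval (abs s 8 0)) (fun s' => abs s' = staged l (abs s)) := by
  induction l with
  | nil => exact ⟨1, fun s => ⟨s, 1, Run.skip s, by simp, rfl⟩⟩
  | cons p l ih =>
    obtain ⟨q, hq⟩ := halts_fill (hl p (by simp)) p.2
    obtain ⟨r, hr⟩ := ih fun p hp => hl p (by simp [hp])
    refine ⟨q + r, fun s => ?_⟩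
    refine ((hq s).seq (t' := r.eval (abs s 8 0)) fun s' hs' => ?_).mono (by simp) fun _ h => h
    refine (hr s').mono ?_ fun s'' h => ?_
    · rw [hs', filled_of_ne (hl p (by simp)).symm]
    · rw [h, hs']; rfl

/-! ## The bound for the loops -/

/-- Halve cell `(9, 0)` until it is zero and count the rounds in cell `(8, 0)`. -/
def bitLoop : Prog :=
  .loop (.read (arr 9) (.const 0)) (.seq
    (.write (arr 9) (.const 0) (.half (.read (arr 9) (.const 0))))
    (.write (arr 8) (.const 0) (.add (.read (arr 8) (.const 0)) (.const 1))))

theorem size_half {x : ℕ} (hx : x ≠ 0) : x.size = (x / 2).size + 1 := by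
  have := Nat.size_bit (b := x.bodd) (n := x.div2) (by rwa [Nat.bit_bodd_div2])
  rwa [Nat.bit_bodd_div2, Nat.div2_val] at this

/-- This loop runs before the cap is known. Each round takes one bit off cell `(9, 0)`, so the
number of rounds is a bit length. -/
theorem halts_bitLoop (s : Store) : Halts bitLoop s ((abs s 9 0).size * 20 + 20) (fun s' =>
    (∀ a, a ≠ 8 → a ≠ 9 → abs s' a = abs s a) ∧ abs s' 8 0 = abs s 8 0 + (abs s 9 0).size) := by
  generalize hk : (abs s 9 0).size = k
  induction k generalizing s with
  | zero =>
    have h0 : abs s 9 0 = 0 := Nat.size_eq_zero.1 hk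
    exact ⟨s, _, Run.loop_done h0, by simp [Expr.cost], fun _ _ _ => rfl, rfl⟩
  | succ k ih =>
    have h0 : abs s 9 0 ≠ 0 := by intro h; simp [h] at hk
    let s1 := s.set (arr 9) 0 (abs s 9 0 / 2)
    let s2 := s1.set (arr 8) 0 (abs s1 8 0 + 1)
    have e2 : abs s2 = ((abs s).set 9 0 (abs s 9 0 / 2)).set 8 0 (abs s 8 0 + 1) := by
      simp only [s2, s1, abs_set]
      rw [set_of_ne (by omega)]
    have e9 : abs s2 9 0 = abs s 9 0 / 2 := by
      rw [e2, set_of_ne (by omega), set_same]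
    obtain ⟨s', t, h1, h2, h3, h4⟩ := ih s2 (by
      rw [e9]; have := size_half h0; omega)
    have r1 : Run (.write (arr 9) (.const 0) (.half (.read (arr 9) (.const 0)))) s s1 _ :=
      Run.write s _ _ _
    have r2 : Run (.write (arr 8) (.const 0) (.add (.read (arr 8) (.const 0)) (.const 1))) s1 s2 _ :=
      Run.write s1 _ _ _
    refine ⟨s', _, Run.loop_step h0 (Run.seq r1 r2) h1, ?_, ?_, ?_⟩
    · simp only [Expr.cost]; omega
    · intro a h8 h9
      rw [h3 a h8 h9, e2]
      funext i
      rw [set_of_ne (by omega), set_of_ne (by omega)]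
    · rw [h4, e2, set_same]; omega

/-- The sum of arrays `4` and `5`. -/
def sumEx : Ex := .loop (.read 0 (.const 1)) (.const 0)
  (.add (.var 1) (.add (.read 4 (.var 0)) (.read 5 (.var 0))))

/-- Four times the sum of the cells `(0, 0)` and `(0, 1)`, plus `8`. -/
def startEx : Ex :=
  let x := Ex.add (.read 0 (.const 0)) (.read 0 (.const 1))
  .add (.add (.add x x) (.add x x)) (.const 8)

/-- The square of cell `(8, 0)`. -/
def sqEx : Ex := .loop (.read 8 (.const 0)) (.const 0) (.add (.var 1) (.read 8 (.const 0)))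

/-- The program that computes the bound for the loops in cell `(8, 0)`. -/
def prelude : Prog :=
  -- The cap is first the number of edges, which is enough to form the sum over the edges. The three
  -- squarings produce the eighth power.
  .seq (assign 8 (.read 0 (.const 1))) (.seq (assign 9 sumEx) (.seq (assign 8 startEx)
    (.seq bitLoop (.seq (assign 8 sqEx) (.seq (assign 8 sqEx) (assign 8 sqEx))))))

theorem eval_sqEx (M : Store) : sqEx.eval M [] [] = M 8 0 ^ 2 := by
  simp [sqEx, Ex.eval, iterate_add, sq]

/-- The numbers of bits that `prelude` counts, and more. -/
def baseBound (M : Store) : ℕ := 4 * (M 0 0 + M 0 1) + 8 +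
  (∑ i ∈ Finset.range (M 0 1), (M 4 i + M 5 i)).size

theorem eval_sumEx {M : Store} (h : M 8 0 = M 0 1) :
    sumEx.eval M [] [] = ∑ i ∈ Finset.range (M 0 1), (M 4 i + M 5 i) := by
  simp [sumEx, Ex.eval, iterate_add, h]

theorem eval_startEx (M : Store) : startEx.eval M [] [] = 4 * (M 0 0 + M 0 1) + 8 := by
  simp only [startEx, Ex.eval]; ring

theorem halts_prelude : ∃ q : Polynomial ℕ, ∀ (s : Store) (B : ℕ), abs s 8 0 ≤ B → abs s 0 0 ≤ B →
    abs s 0 1 ≤ B → (∑ i ∈ Finset.range (abs s 0 1), (abs s 4 i + abs s 5 i)).size ≤ B →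
    Halts prelude s (q.eval B) (fun s' => (∀ a, a < 8 → abs s' a = abs s a) ∧
      abs s' 8 0 = baseBound (abs s) ^ 8) := by
  obtain ⟨q1, h1⟩ := halts_assign 8 (.read 0 (.const 1))
  obtain ⟨q2, h2⟩ := halts_assign 9 sumEx
  obtain ⟨q3, h3⟩ := halts_assign 8 startEx
  obtain ⟨q4, h4⟩ := halts_assign 8 sqEx
  -- If both counts and the bit length are at most `B`, then `baseBound` is at most `4 * (B + B) + 8
  -- + B`.
  let Y : Polynomial ℕ := 9 * Polynomial.X + 8
  let T7 := q4.comp (Y ^ 4)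
  let T6 := q4.comp (Y ^ 2) + T7
  let T5 := q4.comp Y + T6
  let T4 := (Polynomial.X * 20 + 20) + T5
  let T3 := q3 + T4
  let T2 := q2 + T3
  refine ⟨q1 + T2, fun s B hB h0 hm hS => ?_⟩
  have hb : baseBound (abs s) ≤ 9 * B + 8 := by unfold baseBound; omega
  set S := ∑ i ∈ Finset.range (abs s 0 1), (abs s 4 i + abs s 5 i) with hSdef
  refine ((h1 s).seq (t' := T2.eval B) fun s1 e1 => ?_).mono
    ((Nat.add_le_add_right (eval_mono_nat q1 hB) _).trans_eq Polynomial.eval_add.symm) fun _ h => h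
  have a1 : ∀ a, a ≠ 8 → abs s1 a = abs s a := fun a ha => by
    rw [e1]; funext i; rw [set_of_ne (by omega)]
  have b1 : abs s1 8 0 = abs s 0 1 := by rw [e1, set_same]; rfl
  refine ((h2 s1).seq (t' := T3.eval B) fun s2 e2 => ?_).mono
    ((Nat.add_le_add_right (b1 ▸ eval_mono_nat q2 hm) _).trans_eq Polynomial.eval_add.symm) fun _ h => h
  have a2 : ∀ a, a ≠ 8 → a ≠ 9 → abs s2 a = abs s a := fun a ha ha' => by
    rw [← a1 a ha, e2]; funext i; rw [set_of_ne (by omega)]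
  have b2 : abs s2 8 0 = abs s 0 1 := by rw [e2, set_of_ne (by omega), b1]
  have c2 : abs s2 9 0 = S := by
    rw [e2, set_same, eval_sumEx (by rw [b1, a1 0 (by omega)]), a1 0 (by omega), a1 4 (by omega),
      a1 5 (by omega)]
  refine ((h3 s2).seq (t' := T4.eval B) fun s3 e3 => ?_).mono
    ((Nat.add_le_add_right (b2 ▸ eval_mono_nat q3 hm) _).trans_eq Polynomial.eval_add.symm) fun _ h => h
  have a3 : ∀ a, a ≠ 8 → a ≠ 9 → abs s3 a = abs s a := fun a ha ha' => by
    rw [← a2 a ha ha', e3]; funext i; rw [set_of_ne (by omega)]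
  have b3 : abs s3 8 0 = 4 * (abs s 0 0 + abs s 0 1) + 8 := by
    rw [e3, set_same, eval_startEx, a2 0 (by omega) (by omega)]
  have c3 : abs s3 9 0 = S := by rw [e3, set_of_ne (by omega), c2]
  refine ((halts_bitLoop s3).seq (t' := T5.eval B) fun s4 e4 => ?_).mono ?_ fun _ h => h
  swap
  · simp only [T4, Polynomial.eval_add, c3, Polynomial.eval_mul, Polynomial.eval_X,
      Polynomial.eval_ofNat]
    gcongr
  have b4 : abs s4 8 0 = baseBound (abs s) := by rw [e4.2, b3, c3]; rfl
  have sq : ∀ (u : Store) (k : ℕ), abs u 8 0 = baseBound (abs s) ^ k →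
      Halts (assign 8 sqEx) u ((q4.comp (Y ^ k)).eval B) (fun v => (∀ a, a ≠ 8 → abs v a = abs u a) ∧
        abs v 8 0 = baseBound (abs s) ^ (2 * k)) := by
    intro u k hu
    refine (h4 u).mono ?_ fun v hv => ⟨fun a ha => ?_, ?_⟩
    · rw [Polynomial.eval_comp, hu]
      apply eval_mono_nat
      simp only [Y, Polynomial.eval_pow, Polynomial.eval_add, Polynomial.eval_mul, Polynomial.eval_X,
        Polynomial.eval_ofNat]
      gcongr
    · rw [hv]; funext i; rw [set_of_ne (by omega)]
    · rw [hv, set_same, eval_sqEx, hu, ← pow_mul, mul_comm]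
  refine ((sq s4 1 (by rw [b4, pow_one])).seq (t' := T6.eval B) fun s5 e5 => ?_).mono
    (by simp [T5, T6]) fun _ h => h
  refine ((sq s5 2 e5.2).seq (t' := T7.eval B) fun s6 e6 => ?_).mono
    (by simp [T6, T7]) fun _ h => h
  refine (sq s6 4 e6.2).mono le_rfl fun s7 e7 => ⟨fun a ha => ?_, e7.2⟩
  rw [e7.1 a (by omega), e6.1 a (by omega), e5.1 a (by omega), e4.1 a (by omega) (by omega),
    a3 a (by omega) (by omega)]

theorem Nat.size_add_le (x y : ℕ) : (x + y).size ≤ x.size + y.size + 1 := by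
  rw [Nat.size_le]
  have hx := Nat.lt_size_self x
  have hy := Nat.lt_size_self y
  have h1 : 2 ^ x.size ≤ 2 ^ (x.size + y.size) := Nat.pow_le_pow_right (by omega) (by omega)
  have h2 : 2 ^ y.size ≤ 2 ^ (x.size + y.size) := Nat.pow_le_pow_right (by omega) (by omega)
  rw [pow_succ]
  omega

/-- The memory is that of the input `w`, and cell `(8, 0)` holds the bound for the loops. -/
def Prepared (w : List (List ℕ)) (M : Store) : Prop :=
  (∀ a, a < 8 → M a = load w a) ∧ M 8 0 = baseBound (load w) ^ 8

/-- A search problem is solved in polynomial time by `prelude` and `stages`. -/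
theorem polyTimeSolvable_of_stages {α : Type*} {β : α → Type*} {D : α → Prop}
    {encIn : α → List (List ℕ)} {encOut : (x : α) → β x → List (List ℕ)}
    {R : (x : α) → β x → Prop} (l : List (ℕ × Ex)) (hl : ∀ p ∈ l, p.1 ≠ 8)
    (hlen : ∀ x, (encIn x).length ≤ 8)
    (hn : ∀ x, load (encIn x) 0 0 ≤ inputSize (encIn x))
    (hm : ∀ x, load (encIn x) 0 1 ≤ inputSize (encIn x))
    (hS : ∀ x, (∑ i ∈ Finset.range (load (encIn x) 0 1),
      (load (encIn x) 4 i + load (encIn x) 5 i)).size ≤ inputSize (encIn x))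
    (hlen' : ∀ x y, (encOut x y).length ≤ 8)
    (h : ∀ x, D x → ∀ M, Prepared (encIn x) M → ∃ y, Holds (staged l M) (encOut x y) ∧ R x y) :
    PolyTimeSolvable D encIn encOut R := by
  obtain ⟨q, hq⟩ := halts_prelude
  obtain ⟨r, hr⟩ := halts_stages l hl
  refine ⟨.seq prelude (stages l), q + r.comp ((9 * Polynomial.X + 8) ^ 8), fun x hx => ?_⟩
  -- At most eight lists leave all arrays from number `8` on empty, so inserting the array of
  -- registers does not displace any input.
  have h0 : abs (load (encIn x)) = load (encIn x) := by
    funext a i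
    by_cases ha : a < 8
    · simp [abs, arr, ha]
    · have h1 : (encIn x).length ≤ a := (hlen x).trans (by omega)
      simp [abs, arr, ha, load, h1, h1.trans (Nat.le_succ a)]
  have h8 : load (encIn x) 8 0 = 0 := by
    simp [load, hlen x]
  have key : Halts (.seq prelude (stages l)) (load (encIn x))
      ((q + r.comp ((9 * Polynomial.X + 8) ^ 8)).eval (inputSize (encIn x)))
      (fun s' => ∃ M, Prepared (encIn x) M ∧ abs s' = staged l M) := by
    refine ((hq (load (encIn x)) (inputSize (encIn x)) (by rw [h0, h8]; omega) (by rw [h0]; apply hn)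
      (by rw [h0]; apply hm) (by rw [h0]; apply hS)).seq
      (t' := (r.comp ((9 * Polynomial.X + 8) ^ 8)).eval (inputSize (encIn x)))
      fun s1 h1 => ?_).mono (by simp) fun _ h => h
    rw [h0] at h1
    refine (hr s1).mono ?_ fun s2 h2 => ⟨abs s1, h1, h2⟩
    rw [Polynomial.eval_comp, h1.2]
    apply eval_mono_nat
    simp only [Polynomial.eval_pow, Polynomial.eval_add, Polynomial.eval_mul, Polynomial.eval_X,
        Polynomial.eval_ofNat]
    gcongr
    have := hn x; have := hm x; have := hS x
    unfold baseBound; omega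
  obtain ⟨s', t, h1, h2, M, hM, h3⟩ := key
  obtain ⟨y, hy, hR⟩ := h x hx M hM
  refine ⟨s', t, y, h1, h2, fun a ha i hi => ?_, hR⟩
  rw [← hy a ha i hi, ← h3]
  have : a < 8 := lt_of_lt_of_le ha (hlen' x y)
  simp [abs, arr, this]

end RAM

namespace RAM

/-! ## Arithmetic and search in the expression language -/

attribute [simp] Ex.eval

/-- The index of a maximum of `g` on `0, …, n - 1`. -/
def argmax (g : ℕ → ℕ) (n : ℕ) : ℕ := iterate (fun i acc => if g acc < g i then i else acc) 0 n

theorem argmax_spec (g : ℕ → ℕ) {n : ℕ} (hn : 0 < n) :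
    argmax g n < n ∧ ∀ i < n, g i ≤ g (argmax g n) := by
  suffices h : ∀ n, argmax g n < n + 1 ∧ (0 < n → argmax g n < n) ∧ ∀ i < n, g i ≤ g (argmax g n) from
    (h n).2.imp_left fun h => h hn
  intro n
  induction n with
  | zero => simp [argmax, iterate]
  | succ n ih =>
    obtain ⟨h1, -, h2⟩ := ih
    have : argmax g (n + 1) = if g (argmax g n) < g n then n else argmax g n := rfl
    rw [this]
    split_ifs with h
    · refine ⟨by omega, by omega, fun i hi => ?_⟩
      rcases Nat.lt_succ_iff_lt_or_eq.1 hi with hi | rfl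
      · exact (h2 i hi).trans h.le
      · exact le_rfl
    · refine ⟨by omega, by omega, fun i hi => ?_⟩
      rcases Nat.lt_succ_iff_lt_or_eq.1 hi with hi | rfl
      · exact h2 i hi
      · omega

/-- Some number below `n` with property `p`, or `d` if there is none. -/
def find (p : ℕ → Prop) [DecidablePred p] (d n : ℕ) : ℕ :=
  iterate (fun i acc => if p i then i else acc) d n

theorem find_of_exists {p : ℕ → Prop} [DecidablePred p] {d n : ℕ} (h : ∃ i < n, p i) :
    find p d n < n ∧ p (find p d n) := by
  induction n with
  | zero => simp at h
  | succ n ih =>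
    have e : find p d (n + 1) = if p n then n else find p d n := rfl
    rw [e]
    split_ifs with hp
    · exact ⟨by omega, hp⟩
    · obtain ⟨i, hi, hpi⟩ := h
      have : i ≠ n := by rintro rfl; exact hp hpi
      have := ih ⟨i, by omega, hpi⟩
      exact ⟨by omega, this.2⟩

theorem find_of_forall {p : ℕ → Prop} [DecidablePred p] {d n : ℕ} (h : ∀ i < n, ¬ p i) :
    find p d n = d := by
  induction n with
  | zero => rfl
  | succ n ih =>
    have e : find p d (n + 1) = if p n then n else find p d n := rfl
    rw [e, if_neg (h n (by omega)), ih fun i hi => h i (by omega)]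

/-- A property of all values of an iteration. -/
theorem iterate_induction {f : ℕ → ℕ → ℕ} {a n : ℕ} (P : ℕ → ℕ → Prop) (h0 : P 0 a)
    (hs : ∀ i acc, i < n → P i acc → P (i + 1) (f i acc)) : P n (iterate f a n) := by
  suffices h : ∀ k ≤ n, P k (iterate f a k) from h n le_rfl
  intro k
  induction k with
  | zero => exact fun _ => h0
  | succ k ih => exact fun hk => hs k _ (by omega) (ih (by omega))

theorem iterate_congr {f g : ℕ → ℕ → ℕ} {a n : ℕ} (h : ∀ i acc, i < n → f i acc = g i acc) :
    iterate f a n = iterate g a n := by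
  induction n with
  | zero => rfl
  | succ n ih => rw [iterate, iterate, ih fun i acc hi => h i acc (by omega), h n _ (by omega)]

theorem iterate_const (f : ℕ → ℕ) (a n : ℕ) : iterate (fun _ acc => f acc) a n = f^[n] a := by
  induction n with
  | zero => rfl
  | succ n ih => rw [iterate, ih, Function.iterate_succ_apply']

namespace Ex

/-- The bound for the loops. -/
def bound : Ex := .read 8 (.const 0)

def lt (x y : Ex) : Ex := .sub y x
def eq (x y : Ex) : Ex := .ite (.sub x y) (.const 0) (.ite (.sub y x) (.const 0) (.const 1))
def and (x y : Ex) : Ex := .ite x y (.const 0)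
def not (x : Ex) : Ex := .ite x (.const 0) (.const 1)
def call1 (f x : Ex) : Ex := .app (.fn f) x
def call2 (f x y : Ex) : Ex := .app (.app (.fn f) x) y
def call3 (f x y z : Ex) : Ex := .app (.app (.app (.fn f) x) y) z
def call4 (f x y z w : Ex) : Ex := .app (.app (.app (.app (.fn f) x) y) z) w

section
variable {s : Store} {ρ st : List ℕ}

@[simp] theorem eval_bound : bound.eval s ρ st = s 8 0 := by simp [bound]

@[simp] theorem eval_lt (x y : Ex) : (lt x y).eval s ρ st = 0 ↔ ¬ x.eval s ρ [] < y.eval s ρ [] := by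
  simp [lt, Nat.sub_eq_zero_iff_le]

@[simp] theorem eval_eq (x y : Ex) : (eq x y).eval s ρ st = 0 ↔ ¬ x.eval s ρ [] = y.eval s ρ [] := by
  simp only [eq, eval]
  rcases lt_trichotomy (x.eval s ρ []) (y.eval s ρ []) with h | h | h
  · simp [Nat.sub_eq_zero_of_le h.le, Nat.sub_ne_zero_of_lt h, h.ne]
  · simp [h]
  · simp [Nat.sub_ne_zero_of_lt h, h.ne']

@[simp] theorem eval_and (x y : Ex) :
    (and x y).eval s ρ st = 0 ↔ ¬ (x.eval s ρ [] ≠ 0 ∧ y.eval s ρ [] ≠ 0) := by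
  simp only [and, eval]
  split_ifs <;> simp_all

@[simp] theorem eval_not (x : Ex) : (not x).eval s ρ st = 0 ↔ x.eval s ρ [] ≠ 0 := by
  simp only [not, eval]
  split_ifs <;> simp_all

@[simp] theorem eval_call1 (f x : Ex) :
    (call1 f x).eval s ρ [] = f.eval s [x.eval s ρ []] [] := rfl
@[simp] theorem eval_call2 (f x y : Ex) :
    (call2 f x y).eval s ρ [] = f.eval s [x.eval s ρ [], y.eval s ρ []] [] := rfl
@[simp] theorem eval_call3 (f x y z : Ex) : (call3 f x y z).eval s ρ []
    = f.eval s [x.eval s ρ [], y.eval s ρ [], z.eval s ρ []] [] := rfl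
@[simp] theorem eval_call4 (f x y z w : Ex) : (call4 f x y z w).eval s ρ []
    = f.eval s [x.eval s ρ [], y.eval s ρ [], z.eval s ρ [], w.eval s ρ []] [] := rfl

/-- A loop with the number of rounds and the body computed by functions. -/
theorem eval_loop {c i b : Ex} {n a : ℕ} {f : ℕ → ℕ → ℕ} (hc : c.eval s ρ [] = n) (hn : n ≤ s 8 0)
    (hi : i.eval s ρ [] = a) (hb : ∀ j acc, j < n → b.eval s (j :: acc :: ρ) [] = f j acc) :
    (loop c i b).eval s ρ st = iterate f a n := by
  simp only [eval, hc, hi, min_eq_left hn]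
  exact iterate_congr hb

/-- The sum of `g` over `i < c`; in `g`, the variables are `i`, a dummy, and those of the
context. -/
def sum (c g : Ex) : Ex := .loop c (.const 0) (.add (.var 1) g)

theorem eval_sum {c g : Ex} {n : ℕ} {f : ℕ → ℕ} (hc : c.eval s ρ [] = n) (hn : n ≤ s 8 0)
    (hg : ∀ j acc, j < n → g.eval s (j :: acc :: ρ) [] = f j) :
    (sum c g).eval s ρ st = ∑ j ∈ Finset.range n, f j := by
  rw [sum, eval_loop hc hn (a := 0) rfl (f := fun j acc => acc + f j), iterate_add, zero_add]
  intro j acc hj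
  simp [hg j acc hj]

/-- The index of a maximum of `g` over `i < c`. -/
def argmaxE (c : Ex) (g : Ex → Ex) : Ex :=
  .loop c (.const 0) (.ite (lt (g (.var 1)) (g (.var 0))) (.var 0) (.var 1))

/-- The running value is always an index below `n`, so `g` has to be correct only there; this
matters when `g` reads a table. -/
theorem eval_argmaxE {c : Ex} {g : Ex → Ex} {n : ℕ} {f : ℕ → ℕ} (hc : c.eval s ρ [] = n)
    (hn : n ≤ s 8 0)
    (h0 : ∀ j acc, j < n → acc < n → (g (.var 0)).eval s (j :: acc :: ρ) [] = f j)
    (h1 : ∀ j acc, j < n → acc < n → (g (.var 1)).eval s (j :: acc :: ρ) [] = f acc) :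
    (argmaxE c g).eval s ρ st = argmax f n := by
  simp only [argmaxE, eval, hc, min_eq_left hn, argmax]
  have : ∀ k ≤ n, iterate (fun j acc => if (lt (g (.var 1)) (g (.var 0))).eval s (j :: acc :: ρ) [] ≠ 0
      then (j :: acc :: ρ).getD 0 0 else (j :: acc :: ρ).getD 1 0) 0 k
      = iterate (fun i acc => if f acc < f i then i else acc) 0 k := by
    intro k
    induction k with
    | zero => intro _; rfl
    | succ k ih =>
      intro hk
      rw [iterate, ih (by omega), iterate]
      have hlt : iterate (fun i acc => if f acc < f i then i else acc) 0 k < n := by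
        rcases Nat.eq_zero_or_pos k with rfl | h
        · exact lt_of_lt_of_le Nat.one_pos (by omega)
        · exact lt_of_lt_of_le (argmax_spec f h).1 (by omega)
      simp [h0 k _ (by omega) hlt, h1 k _ (by omega) hlt]
  exact this n le_rfl

/-- Some `i < c` with `p`, or `d`. -/
def findE (c d p : Ex) : Ex := .loop c d (.ite p (.var 0) (.var 1))

theorem eval_findE {c d p : Ex} {n a : ℕ} {q : ℕ → Prop} [DecidablePred q] (hc : c.eval s ρ [] = n)
    (hn : n ≤ s 8 0) (hd : d.eval s ρ [] = a)
    (hp : ∀ j acc, j < n → (p.eval s (j :: acc :: ρ) [] = 0 ↔ ¬ q j)) :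
    (findE c d p).eval s ρ st = find q a n := by
  rw [findE, find]
  apply eval_loop hc hn hd
  intro j acc hj
  simp [hp j acc hj]

/-- The product; the second factor must not exceed the bound for the loops. -/
def mul (x y : Ex) : Ex := call2 (sum (.var 1) (.var 2)) x y

theorem eval_mul {x y : Ex} (h : y.eval s ρ [] ≤ s 8 0) :
    (mul x y).eval s ρ [] = x.eval s ρ [] * y.eval s ρ [] := by
  rw [mul, eval_call2, eval_sum (n := y.eval s ρ []) (f := fun _ => x.eval s ρ []) (by simp) h]
  · simp [mul_comm]
  · simp

/-- The quotient; the dividend must not exceed the bound for the loops. -/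
def div (x y : Ex) : Ex := call2 (.loop (.var 0) (.const 0)
  (.ite (lt (.var 2) (mul (.var 3) (.add (.var 1) (.const 1)))) (.var 1) (.add (.var 1) (.const 1)))) x y

theorem eval_div {x y : Ex} (h : x.eval s ρ [] < s 8 0) (hy : 0 < y.eval s ρ []) :
    (div x y).eval s ρ [] = x.eval s ρ [] / y.eval s ρ [] := by
  rw [div, eval_call2]
  set a := x.eval s ρ []
  set b := y.eval s ρ []
  -- The value grows by one per round until its successor times `b` exceeds `a`; `a` rounds are
  -- enough to reach the quotient.
  have key : ∀ k ≤ a, iterate (fun j acc => (Ex.ite (lt (.var 2) (mul (.var 3) (.add (.var 1) (.const 1))))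
      (.var 1) (.add (.var 1) (.const 1))).eval s [j, acc, a, b] []) 0 k = min k (a / b) := by
    intro k
    induction k with
    | zero => intro _; simp [iterate]
    | succ k ih =>
      intro hk
      rw [iterate, ih (by omega)]
      have h1 : min k (a / b) + 1 ≤ s 8 0 := by omega
      simp only [eval, eval_lt, ne_eq]
      rw [eval_mul (by simpa using h1)]
      simp only [eval, List.getD_cons_succ, List.getD_cons_zero]
      have : ∀ c, (¬ a < b * c) ↔ c ≤ a / b := fun c => by
        rw [Nat.le_div_iff_mul_le hy, not_lt, mul_comm]
      simp only [this]
      split_ifs with h <;> omega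
  have : a / b ≤ a := Nat.div_le_self a b
  have h2 := key a le_rfl
  simp only [eval, List.getD_cons_zero] at h2 ⊢
  rw [min_eq_left h.le]
  simpa [min_eq_right this] using h2

/-- The remainder; the dividend must not exceed the bound for the loops. -/
def mod (x y : Ex) : Ex := call2 (.sub (.var 0) (mul (.var 1) (div (.var 0) (.var 1)))) x y

theorem eval_mod {x y : Ex} (h : x.eval s ρ [] < s 8 0) (hy : 0 < y.eval s ρ []) :
    (mod x y).eval s ρ [] = x.eval s ρ [] % y.eval s ρ [] := by
  have hd := Nat.div_le_self (x.eval s ρ []) (y.eval s ρ [])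
  rw [mod, eval_call2, eval, eval_mul] <;>
  rw [eval_div (by simpa using h) (by simpa using hy)]
  · simp only [eval, List.getD_cons_succ, List.getD_cons_zero]
    rw [Nat.mod_def]
  · simp only [eval, List.getD_cons_succ, List.getD_cons_zero]
    omega

def mod2 (x : Ex) : Ex := call1 (.sub (.var 0) (.add (.half (.var 0)) (.half (.var 0)))) x

@[simp] theorem eval_mod2 (x : Ex) : (mod2 x).eval s ρ [] = x.eval s ρ [] % 2 := by
  simp [mod2]; omega

/-- `x` divided by `2 ^ k`. -/
def shr (x k : Ex) : Ex := call2 (.loop (.var 1) (.var 0) (.half (.var 1))) x k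

theorem eval_shr {x k : Ex} (h : k.eval s ρ [] ≤ s 8 0) :
    (shr x k).eval s ρ [] = x.eval s ρ [] / 2 ^ k.eval s ρ [] := by
  rw [shr, eval_call2, eval_loop (n := k.eval s ρ []) (a := x.eval s ρ []) (f := fun _ acc => acc / 2)
    (by simp) h (by simp) (by simp)]
  generalize k.eval s ρ [] = n
  induction n with
  | zero => simp [iterate]
  | succ n ih => rw [iterate, ih, Nat.div_div_eq_div_mul, pow_succ]

/-- The product of two numbers, the second of which is less than `2` to the power of the bound for
the loops. -/
def bigmul (x y : Ex) : Ex := call2 (.loop bound (.const 0) (.add (.add (.var 1) (.var 1))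
  (.ite (mod2 (shr (.var 3) (.sub (.sub bound (.const 1)) (.var 0)))) (.var 2) (.const 0)))) x y

/-- Numerators and denominators may exceed the cap, so repeated addition as in `mul` is not
available. Horner's scheme runs through the binary digits of the second factor; after `j` rounds the
value is the first factor times the number formed by the leading `j` of `s 8 0` digits. -/
theorem eval_bigmul {x y : Ex} (h : y.eval s ρ [] < 2 ^ s 8 0) :
    (bigmul x y).eval s ρ [] = x.eval s ρ [] * y.eval s ρ [] := by
  rw [bigmul, eval_call2]
  set a := x.eval s ρ []
  set b := y.eval s ρ []
  rw [eval_loop (n := s 8 0) (a := 0)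
    (f := fun j acc => acc + acc + if b / 2 ^ (s 8 0 - 1 - j) % 2 ≠ 0 then a else 0) (by simp) le_rfl rfl]
  · have := iterate_induction
      (f := fun j acc => acc + acc + if b / 2 ^ (s 8 0 - 1 - j) % 2 ≠ 0 then a else 0) (a := 0) (n := s 8 0)
      (fun j acc => acc = a * (b / 2 ^ (s 8 0 - j))) (by simp [Nat.div_eq_of_lt h]) ?_
    · simpa using this
    · rintro i acc hi rfl
      have e : s 8 0 - i = (s 8 0 - 1 - i) + 1 := by omega
      have e' : s 8 0 - (i + 1) = s 8 0 - 1 - i := by omega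
      rw [e, e', pow_succ, ← Nat.div_div_eq_div_mul]
      set c := b / 2 ^ (s 8 0 - 1 - i)
      rcases Nat.mod_two_eq_zero_or_one c with h | h
      · have : c = 2 * (c / 2) := by omega
        simp only [h]; conv_rhs => rw [this]
        simp; ring
      · have : c = 2 * (c / 2) + 1 := by omega
        simp only [h]; conv_rhs => rw [this]
        simp; ring
  · intro j acc hj
    simp only [eval, eval_mod2]
    rw [eval_shr (by simp; omega)]
    simp

end

end Ex

end RAM

namespace GVP

/-! ## Candidate prices -/

/-- A feasible point of a linear program can be improved to one at which the tight constraints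
have full rank. -/
theorem exists_tight {V ι : Type*} [Fintype ι] (a : ι → (V → ℝ) →ₗ[ℝ] ℝ) (b : ι → ℝ)
    (c : (V → ℝ) →ₗ[ℝ] ℝ) (hc : ∀ d, (∀ i, a i d ≤ 0) → c d ≤ 0)
    (hsep : ∀ d, (∀ i, a i d = 0) → d = 0) (Q : V → ℝ) (hQ : ∀ i, a i Q ≤ b i) :
    ∃ P, (∀ i, a i P ≤ b i) ∧ c Q ≤ c P ∧ ∀ d, (∀ i, a i P = b i → a i d = 0) → d = 0 := by
  classical
  let tight : (V → ℝ) → Finset ι := fun P => Finset.univ.filter fun i => a i P = b i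
  -- Induction on the number of constraints that are not tight.
  suffices h : ∀ k P, (∀ i, a i P ≤ b i) → c Q ≤ c P → Fintype.card ι - (tight P).card = k →
      ∃ P, (∀ i, a i P ≤ b i) ∧ c Q ≤ c P ∧ ∀ d, (∀ i, a i P = b i → a i d = 0) → d = 0 from
    h _ Q hQ le_rfl rfl
  intro k
  induction k using Nat.strong_induction_on with
  | _ k ih =>
    intro P hP hcP hk
    by_cases hopt : ∀ d, (∀ i, a i P = b i → a i d = 0) → d = 0
    · exact ⟨P, hP, hcP, hopt⟩
    push Not at hopt
    -- If the rank is not full, some direction preserves the tight constraints. With the right sign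
    -- it does not lower the objective and runs into a further constraint: `hc` provides one if the
    -- objective changes, `hsep` otherwise.
    obtain ⟨d, hd, hd0⟩ : ∃ d, (∀ i, a i P = b i → a i d = 0) ∧ 0 ≤ c d ∧ ∃ i, 0 < a i d := by
      obtain ⟨d, hd, hne⟩ := hopt
      have hneg : ∀ i, a i P = b i → a i (-d) = 0 := fun i hi => by rw [map_neg, hd i hi, neg_zero]
      have hpos : ∀ e, 0 < c e → ∃ i, 0 < a i e := fun e he => by
        by_contra! h
        exact absurd (hc e h) (not_le.2 he)
      rcases lt_trichotomy (c d) 0 with h | h | h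
      · exact ⟨-d, hneg, by rw [map_neg]; linarith, hpos _ (by rw [map_neg]; linarith)⟩
      · obtain ⟨i, hi⟩ : ∃ i, a i d ≠ 0 := by
          by_contra! h'
          exact hne (hsep d h')
        rcases lt_or_gt_of_ne hi with hi | hi
        · exact ⟨-d, hneg, by rw [map_neg]; linarith, i, by rw [map_neg]; linarith⟩
        · exact ⟨d, hd, h.ge, i, hi⟩
      · exact ⟨d, hd, h.le, hpos d h⟩
    obtain ⟨hcd, i₁, hi₁⟩ := hd0
    obtain ⟨i₀, hi₀, hmin⟩ := Finset.exists_min_image (Finset.univ.filter fun i => 0 < a i d)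
      (fun i => (b i - a i P) / a i d) ⟨i₁, by simpa using hi₁⟩
    simp only [Finset.mem_filter, Finset.mem_univ, true_and] at hi₀ hmin
    -- The longest step that stays feasible; it makes `i₀` tight and keeps the tight constraints
    -- tight.
    set ε := (b i₀ - a i₀ P) / a i₀ d with hε
    have hε0 : 0 ≤ ε := div_nonneg (by linarith [hP i₀]) hi₀.le
    have happ : ∀ i, a i (P + ε • d) = a i P + ε * a i d := fun i => by simp
    have htight : tight P ⊂ tight (P + ε • d) := by
      refine Finset.ssubset_iff_of_subset (fun i hi => ?_) |>.2 ⟨i₀, ?_, ?_⟩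
      · simp only [tight, Finset.mem_filter, Finset.mem_univ, true_and] at hi ⊢
        rw [happ, hd i hi, hi, mul_zero, add_zero]
      · simp only [tight, Finset.mem_filter, Finset.mem_univ, true_and]
        rw [happ, hε, div_mul_cancel₀ _ hi₀.ne']
        ring
      · simp only [tight, Finset.mem_filter, Finset.mem_univ, true_and]
        intro h
        exact hi₀.ne' (hd i₀ h)
    have hlt := Finset.card_lt_card htight
    have hle := Finset.card_le_univ (tight (P + ε • d))
    refine ih _ (by omega) (P + ε • d) (fun i => ?_) ?_ rfl
    · rw [happ]
      rcases le_or_gt (a i d) 0 with h | h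
      · nlinarith [hP i]
      · have := hmin i h
        rw [le_div_iff₀ h] at this
        linarith
    · rw [map_add, map_smul, smul_eq_mul]
      nlinarith

/-! ### Rigid prices on the cycles of a permutation -/

/-- The contribution of an edge with budget `w` to the revenue. -/
noncomputable def val (w a b : ℝ) : ℝ := if a + b ≤ w then a + b else 0

theorem val_nonneg {w a b : ℝ} (ha : 0 ≤ a) (hb : 0 ≤ b) : 0 ≤ val w a b := by
  unfold val; split_ifs <;> linarith

/-- The alternating sum of `w` over `u, φ u, …, φ^(j-1) u`. -/
def altSum {V : Type*} (φ : V → V) (w : V → ℕ) (u : V) (j : ℕ) : ℤ :=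
  ∑ i ∈ Finset.range j, (-1) ^ i * (w (φ^[i] u) : ℤ)

section
variable {V : Type*} {φ : V → V}

/-- The edges `a, φ a, …, φ^(i-1) a` belong to `T` and lead to `c`. -/
def TightPath (φ : V → V) (T : V → Prop) (a : V) (i : ℕ) (c : V) : Prop :=
  (∀ k < i, T (φ^[k] a)) ∧ φ^[i] a = c

/-- The vertices that are joined to `v` by a path with edges in `T`, with the parity of the path. -/
inductive Label (φ : V → V) (T : V → Prop) (v : V) : V → Bool → Prop
  | base : Label φ T v v true
  | forward {u : V} {b : Bool} : Label φ T v u b → T u → Label φ T v (φ u) (!b)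
  | backward {u : V} {b : Bool} : Label φ T v (φ u) b → T u → Label φ T v u (!b)

/-- As `φ` is injective, a step that changes direction merely undoes the last one. What remains
after cancelling is a straight path in one of the two directions, and cancelling preserves the
parity. -/
theorem Label.path (hφ : Function.Injective φ) {T : V → Prop} {v u : V} {b : Bool}
    (h : Label φ T v u b) :
    ∃ i : ℕ, (b = true ↔ Even i) ∧ (TightPath φ T v i u ∨ TightPath φ T u i v) := by
  induction h with
  | base => exact ⟨0, by simp, Or.inl ⟨by simp, rfl⟩⟩
  | @forward u b _ hu ih =>
    obtain ⟨i, hb, hi⟩ := ih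
    rcases hi with hi | hi
    · refine ⟨i + 1, ?_, Or.inl ⟨fun k hk => ?_, ?_⟩⟩
      · rw [Nat.even_add_one, ← hb]; cases b <;> simp
      · rcases Nat.lt_succ_iff_lt_or_eq.1 hk with hk | rfl
        · exact hi.1 k hk
        · rw [hi.2]; exact hu
      · rw [Function.iterate_succ_apply', hi.2]
    · cases i with
      | zero =>
        obtain rfl : u = v := hi.2
        refine ⟨1, ?_, Or.inl ⟨fun k hk => ?_, rfl⟩⟩
        · cases b <;> simp_all
        · obtain rfl : k = 0 := by omega
          exact hu
      | succ i =>
        refine ⟨i, ?_, Or.inr ⟨fun k hk => ?_, ?_⟩⟩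
        · rw [Nat.even_add_one] at hb; cases b <;> simp_all
        · have := hi.1 (k + 1) (by omega)
          rwa [Function.iterate_succ_apply] at this
        · rw [← Function.iterate_succ_apply]; exact hi.2
  | @backward u b _ hu ih =>
    obtain ⟨i, hb, hi⟩ := ih
    rcases hi with hi | hi
    · cases i with
      | zero =>
        refine ⟨1, ?_, Or.inr ⟨fun k hk => ?_, hi.2.symm⟩⟩
        · cases b <;> simp_all
        · obtain rfl : k = 0 := by omega
          exact hu
      | succ i =>
        refine ⟨i, ?_, Or.inl ⟨fun k hk => hi.1 k (by omega), ?_⟩⟩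
        · rw [Nat.even_add_one] at hb; cases b <;> simp_all
        · apply hφ
          rw [← Function.iterate_succ_apply' φ]; exact hi.2
    · refine ⟨i + 1, ?_, Or.inr ⟨fun k hk => ?_, ?_⟩⟩
      · rw [Nat.even_add_one, ← hb]; cases b <;> simp
      · cases k with
        | zero => exact hu
        | succ k =>
          rw [Function.iterate_succ_apply]
          exact hi.1 k (by omega)
      · rw [Function.iterate_succ_apply]; exact hi.2

/-- Substitute `P u = w u - P (φ u)` along the path. -/
theorem TightPath.price {T : V → Prop} {w : V → ℕ} {P : V → ℝ}
    (hT : ∀ v, T v → P v + P (φ v) = w v) {a c : V} {i : ℕ} (h : TightPath φ T a i c) :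
    P a = altSum φ w a i + (-1) ^ i * P c := by
  obtain ⟨h1, rfl⟩ := h
  induction i with
  | zero => simp [altSum]
  | succ i ih =>
    rw [ih fun k hk => h1 k (by omega), altSum, altSum, Finset.sum_range_succ]
    have := hT _ (h1 i (by omega))
    rw [← Function.iterate_succ_apply' φ] at this
    push_cast
    rw [← this]
    ring

/-- Whole turns around the cycle of `a` are dropped. This may change the parity of the length, which
is harmless where the price at the far end is zero. -/
theorem TightPath.reduce [Fintype V] (hφ : Function.Injective φ) {T : V → Prop} {a c : V} {i : ℕ}
    (h : TightPath φ T a i c) : ∃ j ≤ Fintype.card V, TightPath φ T a j c := by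
  have hp : a ∈ Function.periodicPts φ := hφ.mem_periodicPts a
  have hpos := Function.minimalPeriod_pos_of_mem_periodicPts hp
  refine ⟨i % Function.minimalPeriod φ a, ?_, fun k hk => h.1 k (hk.trans_le (Nat.mod_le _ _)), ?_⟩
  · exact (Nat.mod_lt _ hpos).le.trans Function.minimalPeriod_le_card
  · rw [Function.iterate_mod_minimalPeriod_eq]; exact h.2

/-- Two paths of different parity give a closed path of odd length. -/
theorem exists_odd_closed {T : V → Prop} (hφ : Function.Injective φ) {v u : V} {i j : ℕ}
    (hi : TightPath φ T v i u ∨ TightPath φ T u i v) (hj : TightPath φ T v j u ∨ TightPath φ T u j v)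
    (he : Even i) (ho : ¬ Even j) : ∃ k, ¬ Even k ∧ TightPath φ T v k v := by
  have par : ¬ Even (i + j) := by rw [Nat.even_add]; tauto
  have comp : ∀ {i j : ℕ}, TightPath φ T v i u → TightPath φ T u j v → TightPath φ T v (i + j) v := by
    intro i j hi hj
    refine ⟨fun k hk => ?_, ?_⟩
    · rcases lt_or_ge k i with h | h
      · exact hi.1 k h
      · obtain ⟨l, rfl⟩ := Nat.exists_eq_add_of_le h
        rw [add_comm, Function.iterate_add_apply, hi.2]
        exact hj.1 l (by omega)
    · rw [add_comm, Function.iterate_add_apply, hi.2, hj.2]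
  have diff1 : ∀ {i j : ℕ}, i ≤ j → TightPath φ T v i u → TightPath φ T v j u →
      TightPath φ T v (j - i) v := by
    intro i j hij hi hj
    refine ⟨fun k hk => hj.1 k (by omega), hφ.iterate i ?_⟩
    rw [← Function.iterate_add_apply, Nat.add_sub_cancel' hij, hi.2, hj.2]
  have diff2 : ∀ {i j : ℕ}, i ≤ j → TightPath φ T u i v → TightPath φ T u j v →
      TightPath φ T v (j - i) v := by
    intro i j hij hi hj
    refine ⟨fun k hk => ?_, ?_⟩
    · rw [← hi.2, ← Function.iterate_add_apply]
      exact hj.1 _ (by omega)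
    · conv_lhs => rw [← hi.2]
      rw [← Function.iterate_add_apply, Nat.sub_add_cancel hij, hj.2]
  have par' : i ≤ j → ¬ Even (j - i) := fun h => by rw [Nat.even_sub h]; tauto
  have par'' : j ≤ i → ¬ Even (i - j) := fun h => by rw [Nat.even_sub h]; tauto
  rcases hi with hi | hi <;> rcases hj with hj | hj
  · rcases le_total i j with h | h
    · exact ⟨_, par' h, diff1 h hi hj⟩
    · exact ⟨_, par'' h, diff1 h hj hi⟩
  · exact ⟨_, par, comp hi hj⟩
  · exact ⟨_, by rwa [add_comm] at par, comp hj hi⟩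
  · rcases le_total i j with h | h
    · exact ⟨_, par' h, diff2 h hi hj⟩
    · exact ⟨_, par'' h, diff2 h hj hi⟩

/-- If the tight constraints determine the price at `v`, then it is an alternating sum or half of
one. -/
theorem price_of_rigid [Fintype V] (hφ : Function.Injective φ) {T : V → Prop} {w : V → ℕ} {P : V → ℝ}
    (hP : ∀ v, 0 ≤ P v) (hT : ∀ v, T v → P v + P (φ v) = w v)
    (hrigid : ∀ d : V → ℝ, (∀ v, P v = 0 → d v = 0) → (∀ v, T v → d v + d (φ v) = 0) → d = 0) (v : V) :
    ∃ u, ∃ j ≤ Fintype.card V, P v = ((altSum φ w u j).natAbs : ℝ) ∨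
      2 * P v = ((altSum φ w u j).natAbs : ℝ) := by
  classical
  have habs : ∀ (x : ℝ) (z : ℤ), 0 ≤ x → (x = z ∨ x = -z) → x = (z.natAbs : ℝ) := by
    intro x z hx h
    rw [Nat.cast_natAbs, Int.cast_abs]
    rcases h with h | h
    · rw [← h, abs_of_nonneg hx]
    · rw [← abs_neg, ← h, abs_of_nonneg hx]
  -- A path to a price zero makes `P v` plus or minus an alternating sum, and `P v ≥ 0` settles the
  -- sign.
  have hzero : ∀ u i, (TightPath φ T v i u ∨ TightPath φ T u i v) → P u = 0 →
      ∃ u, ∃ j ≤ Fintype.card V, P v = ((altSum φ w u j).natAbs : ℝ) := by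
    rintro u i (h | h) hu
    · obtain ⟨j, hj, h⟩ := h.reduce hφ
      refine ⟨v, j, hj, habs _ _ (hP v) (Or.inl ?_)⟩
      rw [h.price hT, hu]; ring
    · obtain ⟨j, hj, h⟩ := h.reduce hφ
      refine ⟨u, j, hj, habs _ _ (hP v) ?_⟩
      have := h.price hT
      rcases neg_one_pow_eq_or ℝ j with e | e <;> rw [e, hu] at this
      · right; linarith
      · left; linarith
  by_cases hodd : ∃ k, ¬ Even k ∧ TightPath φ T v k v
  · obtain ⟨k, hk, hkv⟩ := hodd
    have hdvd : Function.minimalPeriod φ v ∣ k := Function.IsPeriodicPt.minimalPeriod_dvd hkv.2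
    have hkpos : 0 < k := by rcases Nat.eq_zero_or_pos k with rfl | h; simp at hk; exact h
    have hl : ¬ Even (Function.minimalPeriod φ v) := fun h => hk (h.trans_dvd hdvd)
    have hlv : TightPath φ T v (Function.minimalPeriod φ v) v :=
      ⟨fun i hi => hkv.1 i (hi.trans_le (Nat.le_of_dvd hkpos hdvd)), Function.iterate_minimalPeriod⟩
    refine ⟨v, Function.minimalPeriod φ v, Function.minimalPeriod_le_card,
      Or.inr (habs _ _ (mul_nonneg zero_le_two (hP v)) (Or.inl ?_))⟩
    have := hlv.price hT
    rw [Odd.neg_one_pow (Nat.not_even_iff_odd.1 hl)] at this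
    linarith
  by_cases hz : ∃ u i, (TightPath φ T v i u ∨ TightPath φ T u i v) ∧ P u = 0
  · obtain ⟨u, i, h, hu⟩ := hz
    obtain ⟨u, j, hj, h⟩ := hzero u i h hu
    exact ⟨u, j, hj, Or.inl h⟩
  -- Otherwise the tight component of `v` is bipartite and has no price zero. The values `1` and
  -- `-1` on its two sides, `0` elsewhere, form a nonzero direction that rigidity forbids.
  exfalso
  have hexcl : ∀ u, Label φ T v u true → Label φ T v u false → False := by
    intro u h1 h2
    obtain ⟨i, hi, hi'⟩ := h1.path hφ
    obtain ⟨j, hj, hj'⟩ := h2.path hφ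
    exact hodd (exists_odd_closed hφ hi' hj' (hi.1 rfl) (by simpa using hj))
  let d : V → ℝ := fun u => if Label φ T v u true then 1 else if Label φ T v u false then -1 else 0
  have hd := hrigid d (fun u hu => ?_) (fun u hu => ?_)
  · have : d v = 1 := if_pos Label.base
    rw [hd] at this
    simp at this
  · have : ∀ b, ¬ Label φ T v u b := fun b h => by
      obtain ⟨i, -, hi⟩ := h.path hφ
      exact hz ⟨u, i, hi, hu⟩
    simp [d, this]
  · have h1 : ∀ b, Label φ T v (φ u) b ↔ Label φ T v u (!b) := fun b =>
      ⟨fun h => h.backward hu, fun h => by simpa using h.forward hu⟩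
    simp only [d, h1, Bool.not_true, Bool.not_false]
    by_cases ht : Label φ T v u true
    · have hf : ¬ Label φ T v u false := hexcl u ht
      simp only [ht, hf, if_true, if_false]
      norm_num
    · by_cases hf : Label φ T v u false <;> simp only [ht, hf, if_true, if_false] <;> norm_num

/-- Some optimal prices on the cycles of a permutation are alternating sums of budgets or halves of
them. -/
theorem exists_candidate_prices [Fintype V] (hφ : Function.Injective φ) (w : V → ℕ)
    (hw : ∀ v, Even (w v)) (Q : V → ℝ) (hQ : ∀ v, 0 ≤ Q v) :
    ∃ P : V → ℕ, (∀ v, ∃ u, ∃ j ≤ Fintype.card V,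
        P v = (altSum φ w u j).natAbs ∨ P v = (altSum φ w u j).natAbs / 2) ∧
      ∑ v, val (w v) (Q v) (Q (φ v)) ≤ ∑ v, val (w v) (P v) (P (φ v)) := by
  classical
  -- The consumers who buy at `Q`. Only their constraints are imposed, the others being replaced by
  -- `0 ≤ w v`; at the new prices the other consumers can only add to the revenue.
  let S : V → Prop := fun v => Q v + Q (φ v) ≤ w v
  let a : V ⊕ V → (V → ℝ) →ₗ[ℝ] ℝ := Sum.elim (fun v => -(LinearMap.proj v : (V → ℝ) →ₗ[ℝ] ℝ))
    (fun v => if S v then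
      (LinearMap.proj v : (V → ℝ) →ₗ[ℝ] ℝ) + LinearMap.proj (φ v) else 0)
  let b : V ⊕ V → ℝ := Sum.elim (fun _ => 0) (fun v => w v)
  let c : (V → ℝ) →ₗ[ℝ] ℝ := ∑ v, a (Sum.inr v)
  have ha : ∀ v x, S v → a (Sum.inr v) x = x v + x (φ v) := fun v x h => by simp [a, h]
  have ha' : ∀ v x, ¬ S v → a (Sum.inr v) x = 0 := fun v x h => by simp [a, h]
  have hcx : ∀ x, c x = ∑ v, a (Sum.inr v) x := fun x => by simp [c, LinearMap.sum_apply]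
  -- The objective is the sum of the budget constraints, so it cannot grow in a direction in which
  -- no constraint grows; the sign constraints separate points.
  obtain ⟨P, hP, hcP, hrigid⟩ := exists_tight a b c
    (fun d hd => by rw [hcx]; exact Finset.sum_nonpos fun v _ => hd _)
    (fun d hd => funext fun v => by simpa [a] using hd (Sum.inl v)) Q (by
      rintro (v | v)
      · simpa [a, b] using hQ v
      · by_cases h : S v
        · rw [ha v _ h]; exact h
        · rw [ha' v _ h]; simp [b])
  have hP0 : ∀ v, 0 ≤ P v := fun v => by simpa [a, b] using hP (Sum.inl v)
  have hrig := price_of_rigid hφ (T := fun v => S v ∧ P v + P (φ v) = w v) hP0 (fun v h => h.2)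
    (fun d h1 h2 => hrigid d (by
      rintro (v | v) hv
      · have : P v = 0 := by simpa [a, b] using hv
        simp [a, h1 v this]
      · by_cases h : S v
        · rw [ha v _ h] at hv ⊢
          exact h2 v ⟨h, hv⟩
        · exact ha' v _ h))
  -- Even budgets make the halved alternating sums integers, so that natural number division is
  -- exact.
  have heven : ∀ u j, Even (altSum φ w u j).natAbs := fun u j => by
    rw [Int.natAbs_even]
    apply Finset.even_sum
    intro i _
    exact Even.mul_left ((Int.even_coe_nat _).2 (hw _)) _
  have hnat : ∀ v, ∃ p : ℕ, P v = p ∧ ∃ u, ∃ j ≤ Fintype.card V,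
        p = (altSum φ w u j).natAbs ∨ p = (altSum φ w u j).natAbs / 2 := by
    intro v
    obtain ⟨u, j, hj, h | h⟩ := hrig v
    · exact ⟨_, h, u, j, hj, Or.inl rfl⟩
    · obtain ⟨k, hk⟩ := heven u j
      refine ⟨_, ?_, u, j, hj, Or.inr rfl⟩
      rw [hk] at h ⊢
      rw [show (k + k) / 2 = k by omega]
      push_cast at h
      linarith
  choose p hp hp' using hnat
  refine ⟨p, hp', ?_⟩
  calc ∑ v, val (w v) (Q v) (Q (φ v)) = c Q := by
        rw [hcx]
        refine Finset.sum_congr rfl fun v _ => ?_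
        by_cases h : S v
        · rw [ha v _ h, val, if_pos h]
        · rw [ha' v _ h, val, if_neg h]
    _ ≤ c P := hcP
    _ ≤ _ := by
        rw [hcx]
        refine Finset.sum_le_sum fun v _ => ?_
        rw [← hp, ← hp]
        by_cases h : S v
        · have := hP (Sum.inr v)
          rw [ha v _ h] at this ⊢
          exact (if_pos this).ge
        · rw [ha' v _ h]
          exact val_nonneg (hP0 _) (hP0 _)

end

end GVP

namespace RAM

/-- The comparison in `argmax` is strict, so the first maximum is kept; `position` thereby finds the
least index. -/
theorem argmax_first (g : ℕ → ℕ) (n : ℕ) : ∀ i < argmax g n, g i < g (argmax g n) := by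
  induction n with
  | zero => intro i hi; simp [argmax, iterate] at hi
  | succ n ih =>
    have : argmax g (n + 1) = if g (argmax g n) < g n then n else argmax g n := rfl
    rw [this]
    split_ifs with h
    · intro i hi
      exact ((argmax_spec g (by omega)).2 i hi).trans_lt h
    · exact ih

end RAM

namespace GVP

open RAM Function

/-! ## Cycles of permutations of initial segments -/

/-- The function permutes `0, …, M - 1`. -/
structure PermOn (f : ℕ → ℕ) (M : ℕ) : Prop where
  maps : ∀ x < M, f x < M
  inj : ∀ x < M, ∀ y < M, f x = f y → x = y

/-- The greatest element of the cycle of `x`. -/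
def cycleMax (f : ℕ → ℕ) (M x : ℕ) : ℕ := f^[argmax (fun i => f^[i] x) M] x

/-- The restriction to an initial segment. -/
def PermOn.restrict {f : ℕ → ℕ} {M : ℕ} (hf : PermOn f M) (x : Fin M) : Fin M := ⟨f x, hf.maps x x.2⟩

namespace PermOn

variable {f : ℕ → ℕ} {M : ℕ} (hf : PermOn f M)
include hf

theorem iterate_lt {x : ℕ} (hx : x < M) (i : ℕ) : f^[i] x < M := by
  induction i with
  | zero => exact hx
  | succ i ih => rw [iterate_succ_apply']; exact hf.maps _ ih

theorem restrict_injective : Injective hf.restrict := fun x y h =>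
  Fin.ext (hf.inj x x.2 y y.2 (congrArg Fin.val h))

theorem iterate_restrict (i : ℕ) (x : Fin M) : ((hf.restrict^[i] x : Fin M) : ℕ) = f^[i] x := by
  induction i with
  | zero => rfl
  | succ i ih => rw [iterate_succ_apply', iterate_succ_apply', ← ih]; rfl

theorem exists_period {x : ℕ} (hx : x < M) : ∃ p, 0 < p ∧ p ≤ M ∧ f^[p] x = x := by
  have hp := hf.restrict_injective.mem_periodicPts ⟨x, hx⟩
  refine ⟨minimalPeriod hf.restrict ⟨x, hx⟩, minimalPeriod_pos_of_mem_periodicPts hp, ?_, ?_⟩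
  · exact (minimalPeriod_le_card).trans_eq (Fintype.card_fin M)
  · rw [← hf.iterate_restrict _ ⟨x, hx⟩, iterate_minimalPeriod]

theorem minimalPeriod_pos {x : ℕ} (hx : x < M) : 0 < minimalPeriod f x := by
  obtain ⟨p, h1, -, h3⟩ := hf.exists_period hx
  exact IsPeriodicPt.minimalPeriod_pos h1 h3

theorem minimalPeriod_le {x : ℕ} (hx : x < M) : minimalPeriod f x ≤ M := by
  obtain ⟨p, h1, h2, h3⟩ := hf.exists_period hx
  exact (IsPeriodicPt.minimalPeriod_le h1 h3).trans h2

/-- The period is at most `M`, so the first `M` iterates cover the whole cycle. -/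
theorem iterate_le_cycleMax {x : ℕ} (hx : x < M) (i : ℕ) : f^[i] x ≤ cycleMax f M x := by
  rw [← iterate_mod_minimalPeriod_eq (n := i)]
  exact (argmax_spec (fun i => f^[i] x) (by omega)).2 _
    ((Nat.mod_lt _ (hf.minimalPeriod_pos hx)).trans_le (hf.minimalPeriod_le hx))

theorem exists_iterate_eq {x : ℕ} (hx : x < M) (k : ℕ) : ∃ i, f^[i] (f^[k] x) = x := by
  have hp := hf.minimalPeriod_pos hx
  refine ⟨k * minimalPeriod f x - k, ?_⟩
  rw [← iterate_add_apply, Nat.sub_add_cancel (Nat.le_mul_of_pos_right _ hp), mul_comm]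
  exact (isPeriodicPt_minimalPeriod f x).mul_const k

theorem cycleMax_iterate {x : ℕ} (hx : x < M) (k : ℕ) : cycleMax f M (f^[k] x) = cycleMax f M x := by
  apply le_antisymm
  · rw [cycleMax, ← iterate_add_apply]
    exact hf.iterate_le_cycleMax hx _
  · obtain ⟨i, hi⟩ := hf.exists_iterate_eq hx k
    conv_lhs => rw [← hi]
    rw [cycleMax, ← iterate_add_apply]
    exact hf.iterate_le_cycleMax (hf.iterate_lt hx k) _

theorem cycleMax_lt {x : ℕ} (hx : x < M) : cycleMax f M x < M := hf.iterate_lt hx _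

/-- The greatest element lies on the cycle itself and so identifies it: go from `x` to the common
maximum and on to `y`. -/
theorem iterate_of_cycleMax_eq {x y : ℕ} (_hx : x < M) (hy : y < M)
    (h : cycleMax f M x = cycleMax f M y) : ∃ i, f^[i] x = y := by
  obtain ⟨i, hi⟩ := hf.exists_iterate_eq hy (argmax (fun i => f^[i] y) M)
  refine ⟨i + argmax (fun i => f^[i] x) M, ?_⟩
  rw [iterate_add_apply]
  rw [cycleMax, cycleMax] at h
  rw [h, hi]

/-- To compare sums over `0, …, M - 1` it suffices to compare the sums over each cycle. -/
theorem sum_le_sum {F G : ℕ → ℕ} (h : ∀ r < M, cycleMax f M r = r →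
      ∑ i ∈ Finset.range (minimalPeriod f r), F (f^[i] r)
        ≤ ∑ i ∈ Finset.range (minimalPeriod f r), G (f^[i] r)) :
    ∑ x ∈ Finset.range M, F x ≤ ∑ x ∈ Finset.range M, G x := by
  have maps : ∀ x ∈ Finset.range M, cycleMax f M x ∈ Finset.range M := fun x hx =>
    Finset.mem_range.2 (hf.cycleMax_lt (Finset.mem_range.1 hx))
  rw [← Finset.sum_fiberwise_of_maps_to maps F, ← Finset.sum_fiberwise_of_maps_to maps G]
  refine Finset.sum_le_sum fun r hr => ?_
  rw [Finset.mem_range] at hr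
  by_cases hroot : cycleMax f M r = r
  · have e : (Finset.range M).filter (fun x => cycleMax f M x = r)
        = (Finset.range (minimalPeriod f r)).image (fun i => f^[i] r) := by
      ext x
      simp only [Finset.mem_filter, Finset.mem_range, Finset.mem_image]
      constructor
      · rintro ⟨hx, hxr⟩
        obtain ⟨i, hi⟩ := hf.iterate_of_cycleMax_eq hr hx (hroot.trans hxr.symm)
        exact ⟨i % minimalPeriod f r, Nat.mod_lt _ (hf.minimalPeriod_pos hr), by
          rw [iterate_mod_minimalPeriod_eq, hi]⟩
      · rintro ⟨i, _, rfl⟩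
        exact ⟨hf.iterate_lt hr i, by rw [hf.cycleMax_iterate hr, hroot]⟩
    have inj : Set.InjOn (fun i => f^[i] r) (Finset.range (minimalPeriod f r)) := by
      intro i hi j hj hij
      rw [Finset.coe_range] at hi hj
      exact (iterate_eq_iterate_iff_of_lt_minimalPeriod hi hj).1 hij
    rw [e, Finset.sum_image inj, Finset.sum_image inj]
    exact h r hr hroot
  · have e : (Finset.range M).filter (fun x => cycleMax f M x = r) = ∅ := by
      rw [Finset.filter_eq_empty_iff]
      intro x hx hxr
      apply hroot
      rw [← hxr]
      exact hf.cycleMax_iterate (Finset.mem_range.1 hx) _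
    rw [e]; simp

end PermOn

/-! ## Two-colouring for two involutions -/

/-- A fixed point free involution of `0, …, M - 1`. -/
structure InvolOn (f : ℕ → ℕ) (M : ℕ) : Prop where
  maps : ∀ x < M, f x < M
  invol : ∀ x < M, f (f x) = x
  ne : ∀ x < M, f x ≠ x

/-- A colouring with two colours that distinguishes `x`, `σ x` and `x`, `τ x`. -/
def alternate (σ φ : ℕ → ℕ) (M x : ℕ) : ℕ := if cycleMax φ M x < cycleMax φ M (σ x) then 0 else 1

theorem InvolOn.comp {σ τ : ℕ → ℕ} {M : ℕ} (hσ : InvolOn σ M) (hτ : InvolOn τ M) :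
    PermOn (fun x => τ (σ x)) M where
  maps x hx := hτ.maps _ (hσ.maps x hx)
  inj x hx y hy h := by
    have := congrArg τ h
    simp only [hτ.invol _ (hσ.maps x hx), hτ.invol _ (hσ.maps y hy)] at this
    rw [← hσ.invol x hx, this, hσ.invol y hy]

/-- A reflection of the dihedral action generated by `σ` and `τ` has no fixed point: an equality for
`i + 2` at `x` gives one for `i` at `τ (σ x)`, down to a fixed point of `σ` or of `τ`. -/
theorem InvolOn.iterate_comp_ne {σ τ : ℕ → ℕ} {M : ℕ} (hσ : InvolOn σ M) (hτ : InvolOn τ M) (i : ℕ) :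
    ∀ x < M, (fun x => τ (σ x))^[i] x ≠ σ x := by
  have hφ := hσ.comp hτ
  induction i using Nat.twoStepInduction with
  | zero => exact fun x hx h => hσ.ne x hx h.symm
  | one => exact fun x hx h => hτ.ne _ (hσ.maps x hx) h
  | more i ih _ =>
    intro x hx h
    rw [iterate_succ_apply', iterate_succ_apply] at h
    apply ih _ (hφ.maps x hx)
    have hy := hφ.iterate_lt (hφ.maps x hx) i
    generalize (fun x => τ (σ x))^[i] (τ (σ x)) = y at h hy ⊢
    rw [← h, hτ.invol _ (hσ.maps y hy), hσ.invol y hy]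

/-- The cycles of `x` and `σ x` are different by `InvolOn.iterate_comp_ne`, so passing from `x` to
`σ x` reverses the strict comparison of their greatest elements. -/
theorem alternate_left {σ τ : ℕ → ℕ} {M : ℕ} (hσ : InvolOn σ M) (hτ : InvolOn τ M) {x : ℕ} (hx : x < M) :
    alternate σ (fun x => τ (σ x)) M (σ x) = 1 - alternate σ (fun x => τ (σ x)) M x := by
  have hne : cycleMax (fun x => τ (σ x)) M x ≠ cycleMax (fun x => τ (σ x)) M (σ x) := by
    intro h
    obtain ⟨i, hi⟩ := (hσ.comp hτ).iterate_of_cycleMax_eq hx (hσ.maps x hx) h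
    exact hσ.iterate_comp_ne hτ i x hx hi
  simp only [alternate, hσ.invol x hx]
  split_ifs <;> omega

/-- Since `τ x = τ (σ (σ x))`, the element `τ x` lies on the cycle of `σ x`, and likewise `x` on
that of `σ (τ x)`. -/
theorem alternate_right {σ τ : ℕ → ℕ} {M : ℕ} (hσ : InvolOn σ M) (hτ : InvolOn τ M) {x : ℕ} (hx : x < M) :
    alternate σ (fun x => τ (σ x)) M (τ x) = 1 - alternate σ (fun x => τ (σ x)) M x := by
  have hφ := hσ.comp hτ
  rw [← alternate_left hσ hτ hx]
  have h1 : cycleMax (fun x => τ (σ x)) M (τ x) = cycleMax (fun x => τ (σ x)) M (σ x) := by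
    have := hφ.cycleMax_iterate (hσ.maps x hx) 1
    simpa [hσ.invol x hx] using this
  have h2 : cycleMax (fun x => τ (σ x)) M (σ (τ x)) = cycleMax (fun x => τ (σ x)) M x := by
    have := hφ.cycleMax_iterate (hσ.maps _ (hτ.maps x hx)) 1
    simp only [iterate_one, hσ.invol _ (hτ.maps x hx), hτ.invol x hx] at this
    exact this.symm
  simp only [alternate, h1, h2, hσ.invol x hx]

end GVP

namespace GVP

open RAM Function

/-! ## Dynamic programming on the cycles of a permutation -/

/-- The position of `x` on the cycle of `r`: the least `j` with `f^(j+1) r = x`. -/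
def position (f : ℕ → ℕ) (M r x : ℕ) : ℕ := argmax (fun j => if f^[j + 1] r = x then 1 else 0) M

/-- The greatest weight of a walk of `i + 1` steps from `v` with labels below `C`, the first of which
is `x` and the last of which is `y`. -/
def walkMax (wt : ℕ → ℕ → ℕ → ℕ) (C : ℕ) (f : ℕ → ℕ) : ℕ → ℕ → ℕ → ℕ → ℕ
  | 0, v, x, y => wt v x y
  | i + 1, v, x, y =>
    let g := fun z => walkMax wt C f i v x z + wt (f^[i + 1] v) z y
    g (argmax g C)

/-- The labels of a heaviest closed walk along the cycle of `r`, in reverse order, for a table `T` of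
the function `walkMax`. -/
def labels (wt : ℕ → ℕ → ℕ → ℕ) (C : ℕ) (f : ℕ → ℕ) (T : ℕ → ℕ → ℕ → ℕ → ℕ) (M r : ℕ) : ℕ → ℕ :=
  let l := position f M r r
  let x₀ := argmax (fun x => T l r x x) C
  iterate (fun i acc => argmax (fun z => T (l - 1 - i) r x₀ z + wt (f^[l - i] r) z acc) C) x₀

/-- A labelling of the greatest weight. -/
def optLabel (wt : ℕ → ℕ → ℕ → ℕ) (C : ℕ) (f : ℕ → ℕ) (T : ℕ → ℕ → ℕ → ℕ → ℕ) (M x : ℕ) : ℕ :=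
  let r := cycleMax f M x
  labels wt C f T M r (position f M r r - position f M r x)

variable {wt : ℕ → ℕ → ℕ → ℕ} {C : ℕ} {f : ℕ → ℕ} {M : ℕ}

/-- Positions start at the successor of `r`, so `r` itself comes last, with position one less than
the period. -/
theorem PermOn.position_iterate (hf : PermOn f M) {r : ℕ} (hr : r < M) {j : ℕ}
    (hj : j < minimalPeriod f r) : position f M r (f^[j + 1] r) = j := by
  have hM := hf.minimalPeriod_le hr
  set g := fun i => if f^[i + 1] r = f^[j + 1] r then 1 else 0 with hg
  have h1 : g j ≤ g (argmax g M) := (argmax_spec g (by omega)).2 j (by omega)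
  have h2 := argmax_first g M
  have h3 : argmax g M < M := (argmax_spec g (by omega)).1
  change argmax g M = j
  have hgj : g j = 1 := if_pos rfl
  rcases lt_trichotomy (argmax g M) j with h | h | h
  · exfalso
    have h4 : f^[argmax g M + 1] r = f^[j + 1] r := by
      by_contra hne
      have : g (argmax g M) = 0 := if_neg hne
      omega
    rw [iterate_succ_apply', iterate_succ_apply'] at h4
    have := hf.inj _ (hf.iterate_lt hr _) _ (hf.iterate_lt hr _) h4
    have := (iterate_eq_iterate_iff_of_lt_minimalPeriod (h.trans hj) hj).1 this
    omega
  · exact h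
  · have h4 := h2 j h
    have : g (argmax g M) ≤ 1 := by simp only [hg]; split_ifs <;> omega
    omega

theorem PermOn.position_self (hf : PermOn f M) {r : ℕ} (hr : r < M) :
    position f M r r = minimalPeriod f r - 1 := by
  have h := hf.minimalPeriod_pos hr
  have := hf.position_iterate hr (j := minimalPeriod f r - 1) (by omega)
  rwa [Nat.sub_add_cancel h, iterate_minimalPeriod] at this

theorem le_walkMax (g : ℕ → ℕ) (v : ℕ) (hg : ∀ i, g i < C) (i : ℕ) :
    ∑ j ∈ Finset.range (i + 1), wt (f^[j] v) (g j) (g (j + 1)) ≤ walkMax wt C f i v (g 0) (g (i + 1)) := by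
  induction i with
  | zero => simp [walkMax]
  | succ i ih =>
    rw [Finset.sum_range_succ]
    refine (Nat.add_le_add_right ih _).trans ?_
    exact (argmax_spec (fun z => walkMax wt C f i v (g 0) z + wt (f^[i + 1] v) z (g (i + 1 + 1)))
      (Nat.zero_lt_of_lt (hg 0))).2 _ (hg (i + 1))

theorem labels_lt (hC : 0 < C) (T : ℕ → ℕ → ℕ → ℕ → ℕ) (r k : ℕ) : labels wt C f T M r k < C := by
  cases k with
  | zero => exact (argmax_spec _ hC).1
  | succ k => exact (argmax_spec _ hC).1

theorem optLabel_lt (hC : 0 < C) (T : ℕ → ℕ → ℕ → ℕ → ℕ) (x : ℕ) : optLabel wt C f T M x < C :=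
  labels_lt hC T _ _

/-- Backtracking: label number `k` belongs to `f^[l + 1 - k] r` and is the maximizer in the
recursion for `walkMax`, so the table entry is the weight of the labelled walk. The start is treated
apart because label `0` serves both ends of the closed walk. -/
theorem walkMax_labels (r l : ℕ) (hl : position f M r r = l) (j : ℕ) (hj : j ≤ l) :
    walkMax wt C f j r (labels wt C f (walkMax wt C f) M r 0) (labels wt C f (walkMax wt C f) M r (l - j))
      = ∑ i ∈ Finset.range (j + 1), wt (f^[i] r)
          (if i = 0 then labels wt C f (walkMax wt C f) M r 0
            else labels wt C f (walkMax wt C f) M r (l + 1 - i))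
          (labels wt C f (walkMax wt C f) M r (l - i)) := by
  induction j with
  | zero => simp [walkMax]
  | succ j ih =>
    rw [Finset.sum_range_succ, ← ih (by omega), walkMax]
    have e : labels wt C f (walkMax wt C f) M r (l - j) = argmax (fun z =>
        walkMax wt C f j r (labels wt C f (walkMax wt C f) M r 0) z
          + wt (f^[j + 1] r) z (labels wt C f (walkMax wt C f) M r (l - (j + 1)))) C := by
      have e1 : l - j = (l - (j + 1)) + 1 := by omega
      rw [e1]
      simp only [labels, hl]
      change argmax (fun z => walkMax wt C f (l - 1 - (l - (j + 1))) r _ z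
        + wt (f^[l - (l - (j + 1))] r) z _) C = _
      have e2 : l - 1 - (l - (j + 1)) = j := by omega
      have e3 : l - (l - (j + 1)) = j + 1 := by omega
      rw [e2, e3]
      rfl
    rw [if_neg (by omega), show l + 1 - (j + 1) = l - j by omega, ← e]

/-- Along a cycle, a labelling is a walk that begins and ends with the same label. The table bounds
the weight of every such walk, and the label at the root is chosen to maximize its diagonal entry.
-/
theorem PermOn.sum_le_sum_optLabel (hf : PermOn f M) (g : ℕ → ℕ) (hg : ∀ x < M, g x < C) :
    ∑ x ∈ Finset.range M, wt x (g x) (g (f x)) ≤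
      ∑ x ∈ Finset.range M, wt x (optLabel wt C f (walkMax wt C f) M x)
        (optLabel wt C f (walkMax wt C f) M (f x)) := by
  apply hf.sum_le_sum
  intro r hr hroot
  have hpos := hf.minimalPeriod_pos hr
  obtain ⟨l, hl⟩ : ∃ l, minimalPeriod f r = l + 1 := ⟨_, (Nat.sub_add_cancel hpos).symm⟩
  have hp : position f M r r = l := by rw [hf.position_self hr, hl]; rfl
  have hself : f^[l + 1] r = r := by rw [← hl]; exact iterate_minimalPeriod
  set L := labels wt C f (walkMax wt C f) M r with hL
  have hopt : ∀ i ≤ l, optLabel wt C f (walkMax wt C f) M (f^[i + 1] r) = L (l - i) := by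
    intro i hi
    simp only [optLabel]
    rw [hf.cycleMax_iterate hr, hroot, hp, hf.position_iterate hr (by omega)]
  have hopt0 : optLabel wt C f (walkMax wt C f) M r = L 0 := by
    have := hopt l le_rfl
    rwa [hself, Nat.sub_self] at this
  rw [hl]
  simp only [← iterate_succ_apply' f]
  calc ∑ i ∈ Finset.range (l + 1), wt (f^[i] r) (g (f^[i] r)) (g (f^[i + 1] r))
      ≤ walkMax wt C f l r (g r) (g r) := by
        have := le_walkMax (wt := wt) (f := f) (fun i => g (f^[i] r)) r
          (fun i => hg _ (hf.iterate_lt hr i)) l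
        simpa only [hself, iterate_zero, id] using this
    _ ≤ walkMax wt C f l r (L 0) (L 0) := by
        have h0 : L 0 = argmax (fun x => walkMax wt C f l r x x) C := by
          simp only [hL, labels, hp]; rfl
        rw [h0]
        exact (argmax_spec (fun x => walkMax wt C f l r x x) (Nat.zero_lt_of_lt (hg r hr))).2 _ (hg r hr)
    _ = _ := by
        have := walkMax_labels (wt := wt) (C := C) (f := f) (M := M) r l hp l le_rfl
        rw [Nat.sub_self] at this
        rw [this]
        refine Finset.sum_congr rfl fun i hi => ?_
        rw [Finset.mem_range] at hi
        rw [hopt i (by omega)]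
        congr 1
        cases i with
        | zero => simp [hopt0, hL]
        | succ i => rw [if_neg (by omega), hopt i (by omega)]; congr 1; omega

end GVP

namespace GVP

open RAM Function

/-! ## Half-edges

The edges are `0, …, m - 1`, the half-edges `2 e` and `2 e + 1`; every half-edge `h` has the two copies
`2 h` and `2 h + 1`. -/

/-- The other half of the same edge, in the same copy. -/
def flip (x : ℕ) : ℕ := if x / 2 % 2 = 0 then x + 2 else x - 2

/-- The same half-edge in the other copy. -/
def swap (x : ℕ) : ℕ := if x % 2 = 0 then x + 1 else x - 1

/-- The number of smaller half-edges with the same key. -/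
def rank (key : ℕ → ℕ) (h : ℕ) : ℕ := ∑ j ∈ Finset.range h, if key j = key h then 1 else 0

/-- The half-edges with equal keys are paired in their order. -/
def partner (key : ℕ → ℕ) (m h : ℕ) : ℕ :=
  RAM.find (fun j => key j = key h ∧ rank key j / 2 = rank key h / 2 ∧ j ≠ h) h (2 * m)

/-- The pairing of copies of half-edges with equal keys; the two copies of an unpaired half-edge are
paired. -/
def pairing (key : ℕ → ℕ) (m x : ℕ) : ℕ :=
  if partner key m (x / 2) = x / 2 then swap x else 2 * partner key m (x / 2) + x % 2

theorem flip_spec (x : ℕ) : flip x / 4 = x / 4 ∧ flip x / 2 ≠ x / 2 ∧ flip x % 2 = x % 2 ∧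
    flip (flip x) = x ∧ flip x ≠ x := by
  unfold flip
  split_ifs <;> omega

theorem involOn_flip (m : ℕ) : InvolOn flip (4 * m) where
  maps x hx := by have := (flip_spec x).1; omega
  invol x _ := (flip_spec x).2.2.2.1
  ne x _ := (flip_spec x).2.2.2.2

section
variable {key : ℕ → ℕ} {m : ℕ}

theorem rank_eq_card (h : ℕ) : rank key h = ((Finset.range h).filter fun j => key j = key h).card := by
  rw [rank, Finset.card_filter]

theorem rank_lt {h h' : ℕ} (hlt : h < h') (hk : key h = key h') : rank key h < rank key h' := by
  rw [rank_eq_card, rank_eq_card]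
  apply Finset.card_lt_card
  refine Finset.ssubset_iff_of_subset (fun j hj => ?_) |>.2 ⟨h, ?_, ?_⟩
  · rw [Finset.mem_filter, Finset.mem_range] at hj ⊢
    exact ⟨hj.1.trans hlt, hj.2.trans hk⟩
  · rw [Finset.mem_filter, Finset.mem_range]; exact ⟨hlt, hk⟩
  · simp

theorem rank_inj {h h' : ℕ} (hk : key h = key h') (hr : rank key h = rank key h') : h = h' := by
  rcases lt_trichotomy h h' with hlt | rfl | hlt
  · have := rank_lt hlt hk; omega
  · rfl
  · have := rank_lt hlt hk.symm; omega

/-- A half-edge is paired with the half-edge of its pair. -/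
theorem partner_eq {h h' : ℕ} (hh' : h' < 2 * m) (hk : key h' = key h)
    (hr : rank key h' / 2 = rank key h / 2) (hne : h' ≠ h) : partner key m h = h' := by
  have := (find_of_exists (d := h) (n := 2 * m)
    (p := fun j => key j = key h ∧ rank key j / 2 = rank key h / 2 ∧ j ≠ h) ⟨h', hh', hk, hr, hne⟩).2
  change key (partner key m h) = key h ∧ rank key (partner key m h) / 2 = rank key h / 2 ∧
    partner key m h ≠ h at this
  apply rank_inj (this.1.trans hk.symm)
  have h1 : rank key (partner key m h) ≠ rank key h := fun e => this.2.2 (rank_inj this.1 e)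
  have h2 : rank key h' ≠ rank key h := fun e => hne (rank_inj hk e)
  omega

theorem partner_spec {h : ℕ} (hh : h < 2 * m) : partner key m h < 2 * m ∧
    key (partner key m h) = key h ∧ rank key (partner key m h) / 2 = rank key h / 2 ∧
      partner key m (partner key m h) = h := by
  by_cases hex : ∃ j < 2 * m, key j = key h ∧ rank key j / 2 = rank key h / 2 ∧ j ≠ h
  · obtain ⟨j, hj, h1, h2, h3⟩ := hex
    rw [partner_eq hj h1 h2 h3]
    exact ⟨hj, h1, h2, partner_eq hh h1.symm h2.symm h3.symm⟩
  · push Not at hex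
    have : partner key m h = h := find_of_forall fun i hi hc => hc.2.2 (hex i hi hc.1 hc.2.1)
    rw [this, this]
    exact ⟨hh, rfl, rfl, rfl⟩

/-- This is the purpose of the two copies: a half-edge without partner would be a fixed point, but
its two copies can be exchanged. -/
theorem involOn_pairing (key : ℕ → ℕ) (m : ℕ) : InvolOn (pairing key m) (4 * m) where
  maps x hx := by
    have := (partner_spec (key := key) (m := m) (h := x / 2) (by omega)).1
    unfold pairing swap
    split_ifs <;> omega
  invol x hx := by
    have h := (partner_spec (key := key) (m := m) (h := x / 2) (by omega)).2.2.2
    by_cases hp : partner key m (x / 2) = x / 2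
    · have e : pairing key m x = swap x := if_pos hp
      have e' : swap x / 2 = x / 2 := by unfold swap; split_ifs <;> omega
      rw [e, pairing, e', if_pos hp]
      unfold swap; split_ifs <;> omega
    · have e : pairing key m x = 2 * partner key m (x / 2) + x % 2 := if_neg hp
      have e' : (2 * partner key m (x / 2) + x % 2) / 2 = partner key m (x / 2) := by omega
      rw [e, pairing, e', h, if_neg (Ne.symm hp)]
      omega
  ne x hx := by
    unfold pairing swap
    split_ifs <;> omega

theorem key_pairing {x : ℕ} (hx : x < 4 * m) : key (pairing key m x / 2) = key (x / 2) := by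
  by_cases hp : partner key m (x / 2) = x / 2
  · have e : pairing key m x = swap x := if_pos hp
    have e' : swap x / 2 = x / 2 := by unfold swap; split_ifs <;> omega
    rw [e, e']
  · have e : pairing key m x = 2 * partner key m (x / 2) + x % 2 := if_neg hp
    rw [e, show (2 * partner key m (x / 2) + x % 2) / 2 = partner key m (x / 2) by omega]
    exact (partner_spec (by omega)).2.1

theorem pairing_eq {h h' c : ℕ} (hh' : h' < 2 * m) (hk : key h' = key h)
    (hr : rank key h' / 2 = rank key h / 2) (hne : h' ≠ h) (hc : c < 2) :
    pairing key m (2 * h + c) = 2 * h' + c := by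
  have e : (2 * h + c) / 2 = h := by omega
  rw [pairing, e, partner_eq hh' hk hr hne, if_neg hne]
  omega

/-- Rank two would mean three half-edges with one key, for which `g` has only two values. -/
theorem rank_lt_two_of_injOn (g : ℕ → ℕ) (hg : ∀ h, h < 2 * m → g h < 2)
    (hinj : ∀ h h', h < 2 * m → h' < 2 * m → key h = key h' → g h = g h' → h = h') {h : ℕ} (hh : h < 2 * m) :
    rank key h < 2 := by
  by_contra! hr
  rw [rank_eq_card] at hr
  obtain ⟨a, ha, b, hb, hab⟩ := Finset.one_lt_card.1 hr
  rw [Finset.mem_filter, Finset.mem_range] at ha hb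
  have h1 : g a ≠ g b := fun e => hab (hinj a b (by omega) (by omega) (ha.2.trans hb.2.symm) e)
  have h2 : g a ≠ g h := fun e => ha.1.ne (hinj a h (by omega) hh ha.2 e)
  have h3 : g b ≠ g h := fun e => hb.1.ne (hinj b h (by omega) hh hb.2 e)
  have := hg a (by omega)
  have := hg b (by omega)
  have := hg h hh
  omega

end

/-! ## Optimal prices for keys shared by at most two half-edges -/

theorem sum_range_four_mul (A : ℕ → ℝ) (m : ℕ) : ∑ x ∈ Finset.range (4 * m), A x
    = ∑ e ∈ Finset.range m, (A (4 * e) + A (4 * e + 1) + A (4 * e + 2) + A (4 * e + 3)) := by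
  induction m with
  | zero => simp
  | succ m ih =>
    rw [show 4 * (m + 1) = 4 * m + 1 + 1 + 1 + 1 by ring, Finset.sum_range_succ, Finset.sum_range_succ,
      Finset.sum_range_succ, Finset.sum_range_succ, ih, Finset.sum_range_succ]
    ring

/-- The revenue from the edges `0, …, m - 1`, where edge `e` joins `key (2 e)` and `key (2 e + 1)`. -/
noncomputable def keyRevenue (w key : ℕ → ℕ) (m : ℕ) (q : ℕ → ℝ) : ℝ :=
  ∑ e ∈ Finset.range m, val (w e) (q (key (2 * e))) (q (key (2 * e + 1)))

/-- The end of the selected orientation at the vertex of `x`. -/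
def select (τ f : ℕ → ℕ) (x : ℕ) : ℕ := if f x = 0 then x else τ x

/-- The price of a key derived from prices `P` of the copies of the half-edges. -/
def keyPrice (key τ f P : ℕ → ℕ) (m k : ℕ) : ℕ :=
  let h := RAM.find (fun h => key h = k) (2 * m) (2 * m)
  if h = 2 * m then 0 else P (select τ f (2 * h))

theorem val_comm (w a b : ℝ) : val w a b = val w b a := by
  unfold val; rw [add_comm]

/-- An optimal solution for the cycles of `τ ∘ flip` yields optimal prices of the keys. -/
theorem keyRevenue_le {w key τ P : ℕ → ℕ} {m : ℕ} (hτ : InvolOn τ (4 * m))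
    (hkey : ∀ x < 4 * m, key (τ x / 2) = key (x / 2))
    (hpair : ∀ h < 2 * m, ∀ h' < 2 * m, key h' = key h → h' ≠ h → ∀ c < 2, τ (2 * h + c) = 2 * h' + c)
    (hP : ∀ Q : ℕ → ℝ, (∀ x, 0 ≤ Q x) →
      ∑ x ∈ Finset.range (4 * m), val (w (x / 4)) (Q x) (Q (τ (flip x))) ≤
        ∑ x ∈ Finset.range (4 * m), val (w (x / 4)) (P x) (P (τ (flip x))))
    (q : ℕ → ℝ) (hq : ∀ k, 0 ≤ q k) :
    keyRevenue w key m q ≤ keyRevenue w key m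
      (fun k => keyPrice key τ (alternate flip (fun x => τ (flip x)) (4 * m)) P m k) := by
  set f := alternate flip (fun x => τ (flip x)) (4 * m) with hf
  have hσ := involOn_flip m
  have f_flip : ∀ x < 4 * m, f (flip x) = 1 - f x := fun x hx => alternate_left hσ hτ hx
  have f_tau : ∀ x < 4 * m, f (τ x) = 1 - f x := fun x hx => alternate_right hσ hτ hx
  have f_le : ∀ x, f x = 0 ∨ f x = 1 := fun x => by
    simp only [hf, alternate]; split_ifs <;> simp
  -- the price of a half-edge in the copy `c`
  let p : ℕ → ℕ → ℕ := fun c h => P (select τ f (2 * h + c))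
  -- Two half-edges at one vertex are partners. Exactly one of them has `f = 0`, and both select it,
  -- so the vertex gets one price in each copy.
  have p_key : ∀ c < 2, ∀ h < 2 * m, ∀ h' < 2 * m, key h' = key h → p c h' = p c h := by
    intro c hc h hh h' hh' hk
    by_cases hne : h' = h
    · rw [hne]
    have h1 := hpair h hh h' hh' hk hne c hc
    have h2 := hpair h' hh' h hh hk.symm (Ne.symm hne) c hc
    have h3 := f_tau (2 * h + c) (by omega)
    rw [h1] at h3
    simp only [p, select, h1, h2, h3]
    rcases f_le (2 * h + c) with e | e <;> simp [e]
  let r : ℕ → ℕ → ℕ := fun c k =>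
    let h := RAM.find (fun h => key h = k) (2 * m) (2 * m)
    if h = 2 * m then 0 else p c h
  have r_key : ∀ c < 2, ∀ h < 2 * m, r c (key h) = p c h := by
    intro c hc h hh
    have := find_of_exists (p := fun j => key j = key h) (d := 2 * m) (n := 2 * m) ⟨h, hh, rfl⟩
    simp only [r]
    rw [if_neg this.1.ne]
    exact p_key c hc h hh _ this.1 this.2
  have h0 : (fun k => ((keyPrice key τ f P m k : ℕ) : ℝ)) = fun k => ((r 0 k : ℕ) : ℝ) := rfl
  rw [h0]
  have hlt : ∀ {e c : ℕ}, e < m → c < 4 → 4 * e + c < 4 * m := fun he hc => by omega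
  -- the edge `e` in the copy `c`
  have edge : ∀ e < m, ∀ c < 2, ∀ A : ℕ → ℝ,
      (if f (4 * e + c) = 0 then A (4 * e + c) else 0) +
        (if f (4 * e + 2 + c) = 0 then A (4 * e + 2 + c) else 0) =
      if f (4 * e + c) = 0 then A (4 * e + c) else A (4 * e + 2 + c) := by
    intro e he c hc A
    have h1 := f_flip (4 * e + c) (by omega)
    have h2 : flip (4 * e + c) = 4 * e + 2 + c := by
      unfold flip; rw [if_pos (by omega)]; omega
    rw [h2] at h1
    rcases f_le (4 * e + c) with h | h <;> simp [h, h1]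
  have sum_sel : ∀ A : ℕ → ℝ, ∑ x ∈ Finset.range (4 * m), (if f x = 0 then A x else 0) =
      ∑ e ∈ Finset.range m, ∑ c ∈ Finset.range 2,
        if f (4 * e + c) = 0 then A (4 * e + c) else A (4 * e + 2 + c) := by
    intro A
    rw [sum_range_four_mul]
    refine Finset.sum_congr rfl fun e he => ?_
    rw [Finset.mem_range] at he
    have e0 := edge e he 0 (by omega) A
    have e1 := edge e he 1 (by omega) A
    rw [Finset.sum_range_succ, Finset.sum_range_one, ← e0, ← e1]
    simp only [add_zero, show 4 * e + 2 + 1 = 4 * e + 3 by ring]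
    ring
  have flip0 : ∀ e c, c < 2 → flip (4 * e + c) = 4 * e + 2 + c := fun e c hc => by
    unfold flip; rw [if_pos (by omega)]; omega
  have flip1 : ∀ e c, c < 2 → flip (4 * e + 2 + c) = 4 * e + c := fun e c hc => by
    unfold flip; rw [if_neg (by omega)]; omega
  -- Every cycle occurs in both directions and `f = 0` selects one of them. Put `q` on the selected
  -- direction and leave `P` on the other: optimality of `P` then compares the selected parts alone.
  -- These contain each edge once in each copy.
  have main : ∀ q : ℕ → ℝ, (∀ k, 0 ≤ q k) → 2 * keyRevenue w key m q ≤
      keyRevenue w key m (fun k => r 0 k) + keyRevenue w key m (fun k => r 1 k) := by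
    intro q hq
    let Q : ℕ → ℝ := fun x => if f x = 0 then q (key (x / 2)) else P x
    have hQ := hP Q fun x => by simp only [Q]; split_ifs; exact hq _; positivity
    have fφ : ∀ x < 4 * m, f (τ (flip x)) = f x := fun x hx => by
      rw [f_tau _ (hσ.maps x hx), f_flip x hx]
      rcases f_le x with h | h <;> simp [h]
    have kφ : ∀ x < 4 * m, key (τ (flip x) / 2) = key (flip x / 2) := fun x hx => hkey _ (hσ.maps x hx)
    let B : ℕ → ℝ := fun x => if f x = 0 then 0 else val (w (x / 4)) (P x) (P (τ (flip x)))
    let A : ℕ → ℝ := fun x => val (w (x / 4)) (q (key (x / 2))) (q (key (flip x / 2)))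
    let A' : ℕ → ℝ := fun x => val (w (x / 4)) (P x) (P (τ (flip x)))
    have e1 : ∑ x ∈ Finset.range (4 * m), val (w (x / 4)) (Q x) (Q (τ (flip x)))
        = ∑ x ∈ Finset.range (4 * m), (if f x = 0 then A x else 0) + ∑ x ∈ Finset.range (4 * m), B x := by
      rw [← Finset.sum_add_distrib]
      refine Finset.sum_congr rfl fun x hx => ?_
      rw [Finset.mem_range] at hx
      simp only [Q, A, B, fφ x hx]
      split_ifs
      · rw [kφ x hx, add_zero]
      · rw [zero_add]
    have e2 : ∑ x ∈ Finset.range (4 * m), val (w (x / 4)) (P x) (P (τ (flip x)))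
        = ∑ x ∈ Finset.range (4 * m), (if f x = 0 then A' x else 0) + ∑ x ∈ Finset.range (4 * m), B x := by
      rw [← Finset.sum_add_distrib]
      refine Finset.sum_congr rfl fun x hx => ?_
      simp only [A', B]
      split_ifs <;> simp
    have e3 : ∑ x ∈ Finset.range (4 * m), (if f x = 0 then A x else 0) = 2 * keyRevenue w key m q := by
      rw [sum_sel, keyRevenue, Finset.mul_sum]
      refine Finset.sum_congr rfl fun e he => ?_
      rw [Finset.sum_congr rfl (g := fun _ => val (w e) (q (key (2 * e))) (q (key (2 * e + 1))))]
      · simp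
      · intro c hc
        rw [Finset.mem_range] at hc
        simp only [A, flip0 e c hc, flip1 e c hc]
        rw [show (4 * e + c) / 4 = e by omega, show (4 * e + c) / 2 = 2 * e by omega,
          show (4 * e + 2 + c) / 4 = e by omega, show (4 * e + 2 + c) / 2 = 2 * e + 1 by omega,
          val_comm _ (q (key (2 * e + 1))), ite_self]
    have e4 : ∑ x ∈ Finset.range (4 * m), (if f x = 0 then A' x else 0) =
        keyRevenue w key m (fun k => r 0 k) + keyRevenue w key m (fun k => r 1 k) := by
      rw [sum_sel, keyRevenue, keyRevenue, ← Finset.sum_add_distrib]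
      refine Finset.sum_congr rfl fun e he => ?_
      rw [Finset.mem_range] at he
      have hc : ∀ c < 2, (if f (4 * e + c) = 0 then A' (4 * e + c) else A' (4 * e + 2 + c)) =
          val (w e) (r c (key (2 * e))) (r c (key (2 * e + 1))) := by
        intro c hc
        have h1 := f_flip (4 * e + c) (by omega)
        rw [flip0 e c hc] at h1
        rw [r_key c hc _ (by omega), r_key c hc _ (by omega)]
        simp only [A', p, select, flip0 e c hc, flip1 e c hc,
          show 2 * (2 * e) + c = 4 * e + c by ring, show 2 * (2 * e + 1) + c = 4 * e + 2 + c by ring]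
        rw [show (4 * e + c) / 4 = e by omega, show (4 * e + 2 + c) / 4 = e by omega]
        rcases f_le (4 * e + c) with h | h
        · simp [h, h1]
        · simp only [h, h1]
          simp only [one_ne_zero, if_false, if_true]
          rw [val_comm]
      rw [Finset.sum_range_succ, Finset.sum_range_one, hc 0 (by omega), hc 1 (by omega)]
    rw [e1, e2, e3, e4] at hQ
    linarith
  -- Applied to the prices of copy `1`, the inequality shows that they earn no more than those of
  -- copy `0`; so copy `0` alone is optimal.
  have h1 := main (fun k => r 1 k) fun k => by positivity
  have h2 := main q hq
  linarith

end GVP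

namespace GVP

open RAM Function

/-! ### Numbered candidate prices and the dynamic program over them -/

/-- The contribution of an edge with budget `w`, for natural numbers. -/
def valN (w a b : ℕ) : ℕ := if a + b ≤ w then a + b else 0

theorem cast_valN (w a b : ℕ) : (valN w a b : ℝ) = val w a b := by
  unfold valN val
  split_ifs with h1 h2 h2
  · push_cast; rfl
  · exact absurd (by exact_mod_cast h1) h2
  · exact absurd (by exact_mod_cast h2) h1
  · simp

/-- The absolute value of an alternating sum, halved if `s ≠ 0`. -/
def candVal (f w : ℕ → ℕ) (u j s : ℕ) : ℕ :=
  let p := ∑ i ∈ Finset.range j, if i % 2 = 0 then w (f^[i] u) else 0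
  let n := ∑ i ∈ Finset.range j, if i % 2 = 0 then 0 else w (f^[i] u)
  if s = 0 then (p - n) + (n - p) else ((p - n) + (n - p)) / 2

/-- The list of candidate prices. -/
def cand (f w : ℕ → ℕ) (M c : ℕ) : ℕ := candVal f w (c / 2 / (M + 1)) (c / 2 % (M + 1)) (c % 2)

/-- The number of candidate prices. -/
def candCount (M : ℕ) : ℕ := (M + 1) * M * 2

/-- The weight of a step in terms of the numbers of the candidate prices. -/
def stepWeight (f w : ℕ → ℕ) (M v x y : ℕ) : ℕ := valN (w v) (cand f w M x) (cand f w M y)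

theorem exists_cand (f w : ℕ → ℕ) {M u j s : ℕ} (hu : u < M) (hj : j ≤ M) (hs : s < 2) :
    ∃ c < candCount M, cand f w M c = candVal f w u j s := by
  refine ⟨2 * ((M + 1) * u + j) + s, ?_, ?_⟩
  · have : (M + 1) * (u + 1) ≤ (M + 1) * M := Nat.mul_le_mul_left _ hu
    unfold candCount
    rw [mul_add, mul_one] at this
    omega
  · unfold cand
    have h1 : (2 * ((M + 1) * u + j) + s) / 2 = (M + 1) * u + j := by omega
    have h2 : ((M + 1) * u + j) / (M + 1) = u := by
      rw [Nat.mul_add_div (by omega), Nat.div_eq_of_lt (by omega), add_zero]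
    have h3 : ((M + 1) * u + j) % (M + 1) = j := by
      rw [Nat.mul_add_mod, Nat.mod_eq_of_lt (by omega)]
    rw [h1, h2, h3]
    congr 1
    omega

theorem argmax_congr {g g' : ℕ → ℕ} {n : ℕ} (h : ∀ i < n, g i = g' i) : argmax g n = argmax g' n := by
  induction n with
  | zero => rfl
  | succ n ih =>
    have e : ∀ g, argmax g (n + 1) = if g (argmax g n) < g n then n else argmax g n := fun _ => rfl
    rw [e, e, ih fun i hi => h i (by omega), h n (by omega)]
    rw [h (argmax g' n)]
    rcases Nat.eq_zero_or_pos n with rfl | hn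
    · exact Nat.one_pos
    · have := (argmax_spec g' hn).1; omega

/-- Only the entries of the table with small indices matter. -/
theorem optLabel_congr {wt : ℕ → ℕ → ℕ → ℕ} {C : ℕ} {f : ℕ → ℕ} {M : ℕ} {T T' : ℕ → ℕ → ℕ → ℕ → ℕ}
    (hf : PermOn f M) (h : ∀ i < M, ∀ v < M, ∀ x < C, ∀ y < C, T i v x y = T' i v x y) {x : ℕ}
    (hx : x < M) (hC : 0 < C) : optLabel wt C f T M x = optLabel wt C f T' M x := by
  have hr := hf.cycleMax_lt hx
  have hl : position f M (cycleMax f M x) (cycleMax f M x) < M :=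
    (argmax_spec _ (Nat.zero_lt_of_lt hx)).1
  simp only [optLabel, labels]
  set r := cycleMax f M x
  set l := position f M r r
  have e : argmax (fun x => T l r x x) C = argmax (fun x => T' l r x x) C :=
    argmax_congr fun i hi => h l hl r hr i hi i hi
  rw [e]
  apply iterate_congr
  intro i acc _
  apply argmax_congr
  intro z hz
  rw [h _ (by omega) r hr _ (argmax_spec _ hC).1 z hz]

/-- The sum with signs as a difference of two sums. -/
theorem altSum_eq (φ : ℕ → ℕ) (w : ℕ → ℕ) (u j : ℕ) : altSum φ w u j =
    ((∑ i ∈ Finset.range j, if i % 2 = 0 then w (φ^[i] u) else 0 : ℕ) : ℤ) -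
      ((∑ i ∈ Finset.range j, if i % 2 = 0 then 0 else w (φ^[i] u) : ℕ) : ℤ) := by
  rw [altSum, Nat.cast_sum, Nat.cast_sum, ← Finset.sum_sub_distrib]
  refine Finset.sum_congr rfl fun i _ => ?_
  by_cases h : i % 2 = 0
  · rw [Even.neg_one_pow (Nat.even_iff.2 h), if_pos h, if_pos h]; simp
  · rw [Odd.neg_one_pow (Nat.odd_iff.2 (by omega)), if_neg h, if_neg h]; simp

theorem candVal_zero (f w : ℕ → ℕ) (u j : ℕ) : candVal f w u j 0 = (altSum f w u j).natAbs := by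
  rw [altSum_eq]
  simp only [candVal, if_true]
  omega

theorem candVal_one (f w : ℕ → ℕ) (u j : ℕ) : candVal f w u j 1 = (altSum f w u j).natAbs / 2 := by
  rw [← candVal_zero]
  simp [candVal]

/-- Dynamic programming over the candidate prices is optimal among all real prices. -/
theorem PermOn.val_sum_le {f w : ℕ → ℕ} {M : ℕ} {T : ℕ → ℕ → ℕ → ℕ → ℕ} (hf : PermOn f M)
    (hw : ∀ x, x < M → Even (w x))
    (hT : ∀ i < M, ∀ v < M, ∀ x < candCount M, ∀ y < candCount M,
      T i v x y = walkMax (stepWeight f w M) (candCount M) f i v x y)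
    (Q : ℕ → ℝ) (hQ : ∀ x, 0 ≤ Q x) :
    ∑ x ∈ Finset.range M, val (w x) (Q x) (Q (f x)) ≤
      ∑ x ∈ Finset.range M, val (w x) (cand f w M (optLabel (stepWeight f w M) (candCount M) f T M x))
        (cand f w M (optLabel (stepWeight f w M) (candCount M) f T M (f x))) := by
  rcases Nat.eq_zero_or_pos M with rfl | hM
  · simp
  have hC : 0 < candCount M := by unfold candCount; positivity
  obtain ⟨P, hP, hle⟩ := exists_candidate_prices hf.restrict_injective (fun x => w x)
    (fun x => hw x x.2) (fun x => Q x) (fun x => hQ x)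
  have hlabel : ∀ x : Fin M, ∃ c < candCount M, cand f w M c = P x := by
    intro x
    obtain ⟨u, j, hj, h⟩ := hP x
    rw [Fintype.card_fin] at hj
    have e : altSum hf.restrict (fun x : Fin M => w x) u j = altSum f w u j := by
      simp only [altSum, hf.iterate_restrict]
    rw [e] at h
    rcases h with h | h
    · rw [h, ← candVal_zero]; exact exists_cand f w u.2 hj (by omega)
    · rw [h, ← candVal_one]; exact exists_cand f w u.2 hj (by omega)
  choose g hg hgP using hlabel
  let G : ℕ → ℕ := fun x => if h : x < M then g ⟨x, h⟩ else 0
  have hG : ∀ x (h : x < M), G x = g ⟨x, h⟩ := fun x h => dif_pos h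
  have key := hf.sum_le_sum_optLabel (wt := stepWeight f w M) (C := candCount M) G fun x hx => by
    rw [hG x hx]; exact hg _
  calc ∑ x ∈ Finset.range M, val (w x) (Q x) (Q (f x))
      = ∑ x : Fin M, val (w x) (Q x) (Q (hf.restrict x)) :=
        (Fin.sum_univ_eq_sum_range (fun x => val (w x) (Q x) (Q (f x))) M).symm
    _ ≤ _ := hle
    _ = ∑ x ∈ Finset.range M, ((stepWeight f w M x (G x) (G (f x)) : ℕ) : ℝ) := by
        rw [← Fin.sum_univ_eq_sum_range]
        refine Finset.sum_congr rfl fun x _ => ?_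
        rw [hG x x.2, hG (f x) (hf.maps x x.2), stepWeight, cast_valN, hgP, hgP]
        rfl
    _ ≤ _ := (Nat.cast_sum _ _).symm.trans_le (Nat.cast_le.2 key)
    _ = _ := by
        rw [Nat.cast_sum]
        refine Finset.sum_congr rfl fun x hx => ?_
        rw [Finset.mem_range] at hx
        rw [stepWeight, cast_valN, optLabel_congr hf hT hx hC, optLabel_congr hf hT (hf.maps x hx) hC]

/-! ## Splitting a graph of maximum degree four -/

/-- An orientation of the edges such that paired half-edges have different directions. -/
def orient (key : ℕ → ℕ) (m h : ℕ) : ℕ :=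
  alternate flip (fun x => pairing key m (flip x)) (4 * m) (2 * h)

theorem orient_lt (key : ℕ → ℕ) (m h : ℕ) : orient key m h < 2 := by
  unfold orient alternate; split_ifs <;> omega

theorem orient_other (key : ℕ → ℕ) {m e : ℕ} (he : e < m) :
    orient key m (2 * e + 1) = 1 - orient key m (2 * e) := by
  have := alternate_left (involOn_flip m) (involOn_pairing key m) (x := 2 * (2 * e)) (by omega)
  have e1 : flip (2 * (2 * e)) = 2 * (2 * e + 1) := by
    unfold flip; rw [if_pos (by omega)]; ring
  rwa [e1] at this

theorem orient_ne {key : ℕ → ℕ} {m h h' : ℕ} (hh : h < 2 * m) (hh' : h' < 2 * m) (hk : key h' = key h)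
    (hr : rank key h' / 2 = rank key h / 2) (hne : h' ≠ h) : orient key m h' ≠ orient key m h := by
  have := alternate_right (involOn_flip m) (involOn_pairing key m) (x := 2 * h) (by omega)
  have e1 : pairing key m (2 * h) = 2 * h' := pairing_eq hh' hk hr hne (c := 0) (by omega)
  rw [e1] at this
  change orient key m h' = 1 - orient key m h at this
  have := orient_lt key m h
  omega

/-- The key of a half-edge that consists of its end and its direction. -/
def endKey (key : ℕ → ℕ) (m h : ℕ) : ℕ := 2 * key h + orient key m h

/-- The key of a half-edge that consists of its end and a colour. -/
def splitKey (key key' : ℕ → ℕ) (m h : ℕ) : ℕ := 2 * key h + (orient key m h + orient key' m h) % 2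

/-- Half-edges with the same end, colour and first direction also agree in the second direction.
They share the key `key'`, which belongs to at most two half-edges; if they were different, they
would be partners there and have different second directions. So there is at most one half-edge for
each of the two first directions. -/
theorem rank_splitKey {key key' : ℕ → ℕ} {m : ℕ} (hr : ∀ h < 2 * m, rank key h < 4)
    (hk' : ∀ h < 2 * m, key' h = endKey key m h) {h : ℕ} (hh : h < 2 * m) :
    rank (splitKey key key' m) h < 2 := by
  have o1 := orient_lt key m
  have o2 := orient_lt key' m
  -- At most two pairs at each vertex, and one half-edge of a given direction in each.
  have hr' : ∀ h < 2 * m, rank key' h < 2 := fun h hh =>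
    rank_lt_two_of_injOn (m := m) (fun h => rank key h / 2) (fun h hh => by
        have := hr h hh; omega) (fun a b ha hb hab hg => by
        rw [hk' a ha, hk' b hb, endKey, endKey] at hab
        by_contra hne
        have := o1 a; have := o1 b
        exact orient_ne hb ha (by omega) hg hne (by omega)) hh
  refine rank_lt_two_of_injOn (m := m) (fun h => orient key m h) (fun h _ => o1 h)
    (fun a b ha hb hab hg => ?_) hh
  simp only [splitKey] at hab
  have := o2 a; have := o2 b
  by_contra hne
  have ea := hk' a ha
  have eb := hk' b hb
  simp only [endKey] at ea eb
  exact orient_ne (key := key') hb ha (by omega) (by have := hr' a ha; have := hr' b hb; omega) hne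
    (by omega)

/-- Both directions are reversed at the other end, so the parity of their sum depends on the edge
only. -/
theorem splitKey_other (key key' : ℕ → ℕ) {m e : ℕ} (he : e < m) :
    splitKey key key' m (2 * e + 1) % 2 = splitKey key key' m (2 * e) % 2 := by
  have := orient_lt key m (2 * e)
  have := orient_lt key' m (2 * e)
  simp only [splitKey, orient_other key he, orient_other key' he]
  omega

end GVP

namespace RAM.Ex

/-- A loop with an invariant of the accumulated value. -/
theorem eval_loop_of {s : Store} {ρ st : List ℕ} {c i b : Ex} {n a : ℕ} {f : ℕ → ℕ → ℕ} (P : ℕ → Prop)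
    (hc : c.eval s ρ [] = n) (hn : n ≤ s 8 0) (hi : i.eval s ρ [] = a) (ha : P a)
    (hb : ∀ j acc, j < n → P acc → b.eval s (j :: acc :: ρ) [] = f j acc)
    (hf : ∀ j acc, j < n → P acc → P (f j acc)) :
    (loop c i b).eval s ρ st = iterate f a n := by
  simp only [eval, hc, hi, min_eq_left hn]
  suffices h : ∀ k ≤ n, iterate (fun j acc => b.eval s (j :: acc :: ρ) []) a k = iterate f a k ∧
      P (iterate f a k) from (h n le_rfl).1
  intro k
  induction k with
  | zero => exact fun _ => ⟨rfl, ha⟩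
  | succ k ih =>
    intro hk
    obtain ⟨h1, h2⟩ := ih (by omega)
    rw [iterate, iterate, h1, hb k _ (by omega) h2]
    exact ⟨rfl, hf k _ (by omega) h2⟩

end RAM.Ex

namespace GVP

open RAM

/-! ## The programs for graphs of maximum degree two and four

The array `a` holds the keys of the half-edges, array `10` the budgets of the edges, array `16` the
table of the dynamic program. -/

namespace Program

open RAM.Ex

/-- The bounds for the loops of the programs. -/
structure Large (s : Store) : Prop where
  edges : 4 * s 0 1 + 8 ≤ s 8 0
  vertices : 4 * s 0 0 + 8 ≤ s 8 0
  cands : candCount (4 * s 0 1) ≤ s 8 0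
  table : 4 * s 0 1 * (4 * s 0 1) * candCount (4 * s 0 1) * candCount (4 * s 0 1) ≤ s 8 0
  vertices_sq : (2 * s 0 0 + 2) * (2 * s 0 0 + 2) ≤ s 8 0

def numEdges : Ex := .read 0 (.const 1)
def half2 : Ex := .add numEdges numEdges
def four : Ex := .add half2 half2

def rankE (a : ℕ) (h : Ex) : Ex :=
  call1 (.sum (.var 0) (.ite (eq (.read a (.var 0)) (.read a (.var 2))) (.const 1) (.const 0))) h

def partnerE (a : ℕ) (h : Ex) : Ex :=
  call1 (findE half2 (.var 0) (and (eq (.read a (.var 0)) (.read a (.var 2)))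
    (and (eq (.half (rankE a (.var 0))) (.half (rankE a (.var 2)))) (not (eq (.var 0) (.var 2)))))) h

def pairingE (a : ℕ) (x : Ex) : Ex :=
  call1 (.ite (eq (partnerE a (.half (.var 0))) (.half (.var 0)))
    (.ite (mod2 (.var 0)) (.sub (.var 0) (.const 1)) (.add (.var 0) (.const 1)))
    (.add (.add (partnerE a (.half (.var 0))) (partnerE a (.half (.var 0)))) (mod2 (.var 0)))) x

def flipE (x : Ex) : Ex :=
  call1 (.ite (mod2 (.half (.var 0))) (.sub (.var 0) (.const 2)) (.add (.var 0) (.const 2))) x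

def stepE (a : ℕ) (x : Ex) : Ex := pairingE a (flipE x)

def iterE (a : ℕ) (k x : Ex) : Ex := call2 (.loop (.var 0) (.var 1) (stepE a (.var 1))) k x

def cycleMaxE (a : ℕ) (x : Ex) : Ex :=
  call1 (iterE a (argmaxE four fun z => iterE a z (.var 2)) (.var 0)) x

def alternateE (a : ℕ) (x : Ex) : Ex :=
  call1 (.ite (lt (cycleMaxE a (.var 0)) (cycleMaxE a (flipE (.var 0)))) (.const 0) (.const 1)) x

def positionE (a : ℕ) (r x : Ex) : Ex :=
  call2 (argmaxE four fun z =>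
    .ite (eq (iterE a (.add z (.const 1)) (.var 2)) (.var 3)) (.const 1) (.const 0)) r x

def budgetE (x : Ex) : Ex := .read 10 (.half (.half x))

def candValE (a : ℕ) (u j t : Ex) : Ex :=
  let p := Ex.sum (.var 1) (.ite (mod2 (.var 0)) (.const 0) (budgetE (iterE a (.var 0) (.var 2))))
  let n := Ex.sum (.var 1) (.ite (mod2 (.var 0)) (budgetE (iterE a (.var 0) (.var 2))) (.const 0))
  let d := Ex.add (.sub p n) (.sub n p)
  call3 (.ite (.var 2) (.half d) d) u j t

def candE (a : ℕ) (c : Ex) : Ex :=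
  call1 (candValE a (div (.half (.var 0)) (.add four (.const 1)))
    (mod (.half (.var 0)) (.add four (.const 1))) (mod2 (.var 0))) c

def weightE (a : ℕ) (v x y : Ex) : Ex :=
  call3 (.ite (lt (budgetE (.var 0)) (.add (candE a (.var 1)) (candE a (.var 2)))) (.const 0)
    (.add (candE a (.var 1)) (candE a (.var 2)))) v x y

def countE : Ex := mul (mul (.add four (.const 1)) four) (.const 2)

def tableE (i v x y : Ex) : Ex :=
  .read 16 (.add (mul (.add (mul (.add (mul i four) v) countE) x) countE) y)

/-- The table of the dynamic program, read from array `16`. -/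
def table (s : Store) (i v x y : ℕ) : ℕ :=
  s 16 (((i * (4 * s 0 1) + v) * candCount (4 * s 0 1) + x) * candCount (4 * s 0 1) + y)

def walkStepE (a : ℕ) (z i v x y : Ex) : Ex :=
  .add (tableE (.sub i (.const 1)) v x z) (weightE a (iterE a i v) z y)

def walkE (a : ℕ) (i v x y : Ex) : Ex :=
  call4 (.ite (.var 0)
    (walkStepE a (argmaxE countE fun z => walkStepE a z (.var 2) (.var 3) (.var 4) (.var 5))
      (.var 0) (.var 1) (.var 2) (.var 3))
    (weightE a (.var 1) (.var 2) (.var 3))) i v x y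

/-- The entry of the table with number `var 0`. -/
def entryE (a : ℕ) : Ex :=
  walkE a (div (div (div (.var 0) countE) countE) four) (mod (div (div (.var 0) countE) countE) four)
    (mod (div (.var 0) countE) countE) (mod (.var 0) countE)

def firstE (r l : Ex) : Ex := call2 (argmaxE countE fun z => tableE (.var 3) (.var 2) z z) r l

def labelsAuxE (a : ℕ) (r k l x : Ex) : Ex :=
  call4 (.loop (.var 1) (.var 3) (argmaxE countE fun z =>
    .add (tableE (.sub (.sub (.var 6) (.const 1)) (.var 2)) (.var 4) (.var 7) z)
      (weightE a (iterE a (.sub (.var 6) (.var 2)) (.var 4)) z (.var 3)))) r k l x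

def labelsE (a : ℕ) (r k : Ex) : Ex :=
  call2 (labelsAuxE a (.var 0) (.var 1) (positionE a (.var 0) (.var 0))
    (firstE (.var 0) (positionE a (.var 0) (.var 0)))) r k

def optLabelE (a : ℕ) (x : Ex) : Ex :=
  call1 (call2 (labelsE a (.var 0) (.sub (positionE a (.var 0) (.var 0)) (positionE a (.var 0) (.var 1))))
    (cycleMaxE a (.var 0)) (.var 0)) x

def selectE (a : ℕ) (x : Ex) : Ex :=
  call1 (.ite (alternateE a (.var 0)) (pairingE a (.var 0)) (.var 0)) x

def keyPriceE (a : ℕ) (k : Ex) : Ex :=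
  call1 (call1 (.ite (eq (.var 0) half2) (.const 0)
    (candE a (optLabelE a (selectE a (.add (.var 0) (.var 0))))))
      (findE half2 half2 (eq (.read a (.var 0)) (.var 2)))) k

variable {s : Store} {ρ st : List ℕ} {a : ℕ}

@[simp] theorem eval_numEdges : numEdges.eval s ρ st = s 0 1 := by simp [numEdges]
@[simp] theorem eval_half2 : half2.eval s ρ st = 2 * s 0 1 := by simp [half2]; ring
@[simp] theorem eval_four : four.eval s ρ st = 4 * s 0 1 := by simp [four]; ring

@[simp] theorem eval_flipE (x : Ex) : (flipE x).eval s ρ [] = flip (x.eval s ρ []) := by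
  simp only [flipE, eval_call1, eval, eval_mod2, flip, List.getD_cons_zero]
  split_ifs <;> first | rfl | omega

@[simp] theorem eval_budgetE (x : Ex) : (budgetE x).eval s ρ st = s 10 (x.eval s ρ [] / 4) := by
  simp [budgetE, Nat.div_div_eq_div_mul]

section
variable (hs : Large s)
include hs

omit hs in
theorem eval_rankE {h : Ex} (hh : h.eval s ρ [] ≤ s 8 0) :
    (rankE a h).eval s ρ [] = rank (s a) (h.eval s ρ []) := by
  rw [rankE, eval_call1, eval_sum (n := h.eval s ρ []) (by simp) hh (by simp; intros; rfl)]
  rfl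

theorem eval_partnerE {h : Ex} (hh : h.eval s ρ [] ≤ s 8 0) :
    (partnerE a h).eval s ρ [] = partner (s a) (s 0 1) (h.eval s ρ []) := by
  have := hs.edges
  rw [partnerE, eval_call1, partner]
  refine eval_findE (by simp) (by omega) (by simp) fun j acc hj => ?_
  simp only [eval_and, eval_eq, eval_not, eval, ne_eq]
  rw [eval_rankE (by simp; omega), eval_rankE (by simpa using hh)]
  simp

theorem eval_pairingE {x : Ex} (hx : x.eval s ρ [] < 4 * s 0 1) :
    (pairingE a x).eval s ρ [] = pairing (s a) (s 0 1) (x.eval s ρ []) := by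
  have := hs.edges
  rw [pairingE, eval_call1]
  simp only [eval, eval_eq, eval_mod2, ne_eq]
  rw [eval_partnerE hs (by simp; omega)]
  simp only [eval, List.getD_cons_zero, not_not, pairing, swap]
  split_ifs <;> omega

omit hs in
theorem maps_flip {x : ℕ} (hx : x < 4 * s 0 1) : flip x < 4 * s 0 1 := (involOn_flip _).maps x hx

omit hs in
theorem permOn_step : PermOn (fun x => pairing (s a) (s 0 1) (flip x)) (4 * s 0 1) :=
  (involOn_flip _).comp (involOn_pairing (s a) _)

theorem eval_stepE {x : Ex} (hx : x.eval s ρ [] < 4 * s 0 1) :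
    (stepE a x).eval s ρ [] = pairing (s a) (s 0 1) (flip (x.eval s ρ [])) := by
  rw [stepE, eval_pairingE hs (by rw [eval_flipE]; exact maps_flip hx), eval_flipE]

theorem eval_iterE {k x : Ex} (hk : k.eval s ρ [] ≤ s 8 0) (hx : x.eval s ρ [] < 4 * s 0 1) :
    (iterE a k x).eval s ρ [] =
      (fun x => pairing (s a) (s 0 1) (flip x))^[k.eval s ρ []] (x.eval s ρ []) := by
  rw [iterE, eval_call2, ← iterate_const]
  refine eval_loop_of (fun acc => acc < 4 * s 0 1) (by simp) hk (by simp) hx (fun j acc _ hacc => ?_)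
    fun j acc _ hacc => (permOn_step (a := a)).maps _ hacc
  rw [eval_stepE hs (by simpa using hacc)]
  simp

theorem eval_cycleMaxE {x : Ex} (hx : x.eval s ρ [] < 4 * s 0 1) : (cycleMaxE a x).eval s ρ [] =
    cycleMax (fun x => pairing (s a) (s 0 1) (flip x)) (4 * s 0 1) (x.eval s ρ []) := by
  have h1 := hs.edges
  have e : (argmaxE four fun z => iterE a z (.var 2)).eval s [x.eval s ρ []] [] = argmax
      (fun i => (fun x => pairing (s a) (s 0 1) (flip x))^[i] (x.eval s ρ [])) (4 * s 0 1) := by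
    refine eval_argmaxE (by simp) (by omega) (fun j acc hj hacc => ?_) fun j acc hj hacc => ?_
    · rw [eval_iterE hs (by simp; omega) (by simpa using hx)]; simp
    · rw [eval_iterE hs (by simp; omega) (by simpa using hx)]; simp
  have h2 := (argmax_spec (fun i => (fun x => pairing (s a) (s 0 1) (flip x))^[i] (x.eval s ρ []))
    (Nat.zero_lt_of_lt hx)).1
  rw [cycleMaxE, eval_call1, eval_iterE hs (by rw [e]; omega) (by simpa using hx), e]
  rfl

theorem eval_alternateE {x : Ex} (hx : x.eval s ρ [] < 4 * s 0 1) : (alternateE a x).eval s ρ [] =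
    alternate flip (fun x => pairing (s a) (s 0 1) (flip x)) (4 * s 0 1) (x.eval s ρ []) := by
  rw [alternateE, eval_call1]
  simp only [eval, eval_lt, ne_eq, not_not, alternate]
  rw [eval_cycleMaxE hs (by simpa using hx), eval_cycleMaxE hs (by simpa using maps_flip hx)]
  simp

theorem eval_positionE {r x : Ex} (hr : r.eval s ρ [] < 4 * s 0 1) : (positionE a r x).eval s ρ [] =
    position (fun x => pairing (s a) (s 0 1) (flip x)) (4 * s 0 1) (r.eval s ρ []) (x.eval s ρ []) := by
  have h1 := hs.edges
  rw [positionE, eval_call2, position]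
  refine eval_argmaxE (by simp) (by omega) (fun j acc hj hacc => ?_) fun j acc hj hacc => ?_ <;>
  · simp only [eval, eval_eq, ne_eq, not_not]
    rw [eval_iterE hs (by simp; omega) (by simpa using hr)]
    simp only [eval, List.getD_cons_zero, List.getD_cons_succ]

theorem eval_candValE {u j t : Ex} (hu : u.eval s ρ [] < 4 * s 0 1) (hj : j.eval s ρ [] ≤ s 8 0) :
    (candValE a u j t).eval s ρ [] = candVal (fun x => pairing (s a) (s 0 1) (flip x))
      (fun x => s 10 (x / 4)) (u.eval s ρ []) (j.eval s ρ []) (t.eval s ρ []) := by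
  rw [candValE, eval_call3, candVal]
  set f := fun x => pairing (s a) (s 0 1) (flip x) with hf
  have hp : (Ex.sum (.var 1) (.ite (mod2 (.var 0)) (.const 0) (budgetE (iterE a (.var 0) (.var 2))))).eval s
      [u.eval s ρ [], j.eval s ρ [], t.eval s ρ []] [] = ∑ i ∈ Finset.range (j.eval s ρ []),
        if i % 2 = 0 then s 10 (f^[i] (u.eval s ρ []) / 4) else 0 := by
    refine eval_sum (by simp) hj fun i acc hi => ?_
    simp only [eval, eval_mod2, eval_budgetE]
    rw [eval_iterE hs (by simp; omega) (by simpa using hu)]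
    simp only [eval, List.getD_cons_zero, List.getD_cons_succ, ne_eq, ite_not]
    rfl
  have hn : (Ex.sum (.var 1) (.ite (mod2 (.var 0)) (budgetE (iterE a (.var 0) (.var 2))) (.const 0))).eval s
      [u.eval s ρ [], j.eval s ρ [], t.eval s ρ []] [] = ∑ i ∈ Finset.range (j.eval s ρ []),
        if i % 2 = 0 then 0 else s 10 (f^[i] (u.eval s ρ []) / 4) := by
    refine eval_sum (by simp) hj fun i acc hi => ?_
    simp only [eval, eval_mod2, eval_budgetE]
    rw [eval_iterE hs (by simp; omega) (by simpa using hu)]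
    simp only [eval, List.getD_cons_zero, List.getD_cons_succ, ne_eq, ite_not]
    rfl
  rw [eval]
  simp only [eval, hp, hn]
  simp

theorem eval_countE : countE.eval s ρ [] = candCount (4 * s 0 1) := by
  have := hs.edges
  rw [countE, eval_mul (by simp; omega), eval_mul (by simp; omega)]
  simp [candCount]

theorem eval_candE {c : Ex} (hc : c.eval s ρ [] < candCount (4 * s 0 1)) : (candE a c).eval s ρ [] =
    cand (fun x => pairing (s a) (s 0 1) (flip x)) (fun x => s 10 (x / 4)) (4 * s 0 1)
      (c.eval s ρ []) := by
  have h1 := hs.cands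
  have h2 := hs.edges
  rw [candE, eval_call1, cand]
  set x := c.eval s ρ []
  have hd : (div (.half (.var 0)) (.add four (.const 1))).eval s [x] [] = x / 2 / (4 * s 0 1 + 1) := by
    rw [eval_div (by simp; omega) (by simp)]; simp
  have hm : (mod (.half (.var 0)) (.add four (.const 1))).eval s [x] [] = x / 2 % (4 * s 0 1 + 1) := by
    rw [eval_mod (by simp; omega) (by simp)]; simp
  have hlt : x / 2 % (4 * s 0 1 + 1) < 4 * s 0 1 + 1 := Nat.mod_lt _ (by omega)
  rw [eval_candValE hs _ (by rw [hm]; omega), hd, hm]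
  · simp
  · rw [hd]
    apply Nat.div_lt_of_lt_mul
    unfold candCount at hc
    omega

theorem eval_weightE {v x y : Ex} (hx : x.eval s ρ [] < candCount (4 * s 0 1))
    (hy : y.eval s ρ [] < candCount (4 * s 0 1)) : (weightE a v x y).eval s ρ [] =
    stepWeight (fun x => pairing (s a) (s 0 1) (flip x)) (fun x => s 10 (x / 4)) (4 * s 0 1)
      (v.eval s ρ []) (x.eval s ρ []) (y.eval s ρ []) := by
  rw [weightE, eval_call3]
  simp only [eval, eval_lt, ne_eq, not_not, stepWeight, valN, eval_budgetE]
  rw [eval_candE hs (by simpa using hx), eval_candE hs (by simpa using hy)]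
  simp only [eval, List.getD_cons_zero, List.getD_cons_succ]
  split_ifs <;> omega

theorem eval_tableE (i v x y : Ex) : (tableE i v x y).eval s ρ [] =
    table s (i.eval s ρ []) (v.eval s ρ []) (x.eval s ρ []) (y.eval s ρ []) := by
  have h1 := hs.cands
  have h2 := hs.edges
  have h3 := eval_countE hs (ρ := ρ)
  rw [tableE, eval, eval, eval_mul (by omega), eval, eval_mul (by omega), eval,
    eval_mul (by simp; omega), h3, eval_four]
  rfl

theorem eval_walkStepE {z i v x y : Ex} (hi : i.eval s ρ [] ≤ s 8 0) (hv : v.eval s ρ [] < 4 * s 0 1)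
    (hz : z.eval s ρ [] < candCount (4 * s 0 1)) (hy : y.eval s ρ [] < candCount (4 * s 0 1)) :
    (walkStepE a z i v x y).eval s ρ [] =
      table s (i.eval s ρ [] - 1) (v.eval s ρ []) (x.eval s ρ []) (z.eval s ρ []) +
      stepWeight (fun x => pairing (s a) (s 0 1) (flip x)) (fun x => s 10 (x / 4)) (4 * s 0 1)
        ((fun x => pairing (s a) (s 0 1) (flip x))^[i.eval s ρ []] (v.eval s ρ []))
        (z.eval s ρ []) (y.eval s ρ []) := by
  rw [walkStepE, eval, eval_tableE hs, eval_weightE hs hz hy, eval_iterE hs hi hv]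
  rfl

/-- The hypothesis on the table concerns only walks that are one step shorter and have the same
start and first label; this suffices for one step of the recursion and is available while the table
is being filled. -/
theorem eval_walkE {i v x y : Ex} (hi : i.eval s ρ [] ≤ s 8 0) (hv : v.eval s ρ [] < 4 * s 0 1)
    (hx : x.eval s ρ [] < candCount (4 * s 0 1)) (hy : y.eval s ρ [] < candCount (4 * s 0 1))
    (hT : ∀ z < candCount (4 * s 0 1), i.eval s ρ [] ≠ 0 →
      table s (i.eval s ρ [] - 1) (v.eval s ρ []) (x.eval s ρ []) z =
      walkMax (stepWeight (fun x => pairing (s a) (s 0 1) (flip x)) (fun x => s 10 (x / 4)) (4 * s 0 1))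
        (candCount (4 * s 0 1)) (fun x => pairing (s a) (s 0 1) (flip x)) (i.eval s ρ [] - 1)
        (v.eval s ρ []) (x.eval s ρ []) z) :
    (walkE a i v x y).eval s ρ [] =
      walkMax (stepWeight (fun x => pairing (s a) (s 0 1) (flip x)) (fun x => s 10 (x / 4)) (4 * s 0 1))
        (candCount (4 * s 0 1)) (fun x => pairing (s a) (s 0 1) (flip x)) (i.eval s ρ [])
        (v.eval s ρ []) (x.eval s ρ []) (y.eval s ρ []) := by
  rw [walkE, eval_call4, eval]
  simp only [eval, List.getD_cons_zero]
  generalize i.eval s ρ [] = I at *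
  generalize v.eval s ρ [] = V at *
  generalize x.eval s ρ [] = X at *
  generalize y.eval s ρ [] = Y at *
  cases I with
  | zero =>
    simp only [ne_eq, not_true_eq_false, if_false, walkMax]
    rw [eval_weightE hs (by simpa using hx) (by simpa using hy)]
    simp
  | succ I =>
    simp only [ne_eq, Nat.succ_ne_zero, not_false_eq_true, if_true, walkMax]
    simp only [Nat.add_sub_cancel, ne_eq, Nat.succ_ne_zero, not_false_eq_true, true_imp_iff] at hT
    have e : (argmaxE countE fun z => walkStepE a z (.var 2) (.var 3) (.var 4) (.var 5)).eval s
        [I + 1, V, X, Y] [] = argmax (fun z => walkMax (stepWeight (fun x => pairing (s a) (s 0 1) (flip x))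
          (fun x => s 10 (x / 4)) (4 * s 0 1)) (candCount (4 * s 0 1))
          (fun x => pairing (s a) (s 0 1) (flip x)) I V X z +
          stepWeight (fun x => pairing (s a) (s 0 1) (flip x)) (fun x => s 10 (x / 4)) (4 * s 0 1)
            ((fun x => pairing (s a) (s 0 1) (flip x))^[I + 1] V) z Y) (candCount (4 * s 0 1)) := by
      refine eval_argmaxE (eval_countE hs) hs.cands (fun j acc hj hacc => ?_) fun j acc hj hacc => ?_
      · rw [eval_walkStepE hs (by simpa using hi) (by simpa using hv) (by simpa using hj)
          (by simpa using hy)]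
        simp only [eval, List.getD_cons_zero, List.getD_cons_succ, Nat.add_sub_cancel]
        rw [hT j hj]
      · rw [eval_walkStepE hs (by simpa using hi) (by simpa using hv) (by simpa using hacc)
          (by simpa using hy)]
        simp only [eval, List.getD_cons_zero, List.getD_cons_succ, Nat.add_sub_cancel]
        rw [hT acc hacc]
    rw [eval_walkStepE hs (by simpa using hi) (by simpa using hv)
      (by rw [e]; exact (argmax_spec _ (Nat.zero_lt_of_lt hx)).1) (by simpa using hy), e]
    simp only [eval, List.getD_cons_zero, List.getD_cons_succ, Nat.add_sub_cancel]
    rw [hT _ (argmax_spec _ (Nat.zero_lt_of_lt hx)).1]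

/-- The table is correct. -/
def TableSpec (s : Store) (a : ℕ) : Prop :=
  ∀ i < 4 * s 0 1, ∀ v < 4 * s 0 1, ∀ x < candCount (4 * s 0 1), ∀ y < candCount (4 * s 0 1),
    table s i v x y = walkMax (stepWeight (fun x => pairing (s a) (s 0 1) (flip x))
      (fun x => s 10 (x / 4)) (4 * s 0 1)) (candCount (4 * s 0 1))
      (fun x => pairing (s a) (s 0 1) (flip x)) i v x y

theorem eval_firstE {r l : Ex} : (firstE r l).eval s ρ [] = argmax (fun x =>
    table s (l.eval s ρ []) (r.eval s ρ []) x x) (candCount (4 * s 0 1)) := by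
  rw [firstE, eval_call2]
  refine eval_argmaxE (eval_countE hs) hs.cands (fun j acc hj hacc => ?_) fun j acc hj hacc => ?_ <;>
  · rw [eval_tableE hs]; simp

theorem eval_labelsE {r k : Ex} (hr : r.eval s ρ [] < 4 * s 0 1) (hk : k.eval s ρ [] < 4 * s 0 1) :
    (labelsE a r k).eval s ρ [] =
      labels (stepWeight (fun x => pairing (s a) (s 0 1) (flip x)) (fun x => s 10 (x / 4)) (4 * s 0 1))
        (candCount (4 * s 0 1)) (fun x => pairing (s a) (s 0 1) (flip x)) (table s) (4 * s 0 1)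
        (r.eval s ρ []) (k.eval s ρ []) := by
  have h1 := hs.edges
  rw [labelsE, eval_call2, labelsAuxE, eval_call4]
  rw [eval_firstE hs, eval_positionE hs (by simpa using hr)]
  simp only [eval, List.getD_cons_zero, List.getD_cons_succ, labels]
  generalize r.eval s ρ [] = R at *
  generalize k.eval s ρ [] = K at *
  have hl : position (fun x => pairing (s a) (s 0 1) (flip x)) (4 * s 0 1) R R < 4 * s 0 1 :=
    (argmax_spec _ (Nat.zero_lt_of_lt hr)).1
  generalize position (fun x => pairing (s a) (s 0 1) (flip x)) (4 * s 0 1) R R = l at *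
  have hC : 0 < candCount (4 * s 0 1) := by unfold candCount; have := Nat.zero_lt_of_lt hr; positivity
  rw [min_eq_left (by omega)]
  refine Eq.trans ?_ (eval_loop_of (s := s) (ρ := [R, K, l, argmax (fun x => table s l R x x)
    (candCount (4 * s 0 1))]) (st := []) (c := .var 1) (i := .var 3)
    (b := argmaxE countE fun z =>
    .add (tableE (.sub (.sub (.var 6) (.const 1)) (.var 2)) (.var 4) (.var 7) z)
      (weightE a (iterE a (.sub (.var 6) (.var 2)) (.var 4)) z (.var 3)))
    (fun acc => acc < candCount (4 * s 0 1)) (n := K)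
    (by simp) (by omega) (by simp) (argmax_spec _ hC).1 (fun j acc hj hacc => ?_)
    fun j acc hj hacc => (argmax_spec _ hC).1)
  · simp only [eval, List.getD_cons_zero, List.getD_cons_succ]
    rw [min_eq_left (by omega)]
  · refine eval_argmaxE (eval_countE hs) hs.cands (fun i acc' hi hacc' => ?_) fun i acc' hi hacc' => ?_
    · rw [eval, eval_tableE hs, eval_weightE hs (by simpa using hi) (by simpa using hacc),
        eval_iterE hs (by simp; omega) (by simpa using hr)]
      simp
    · rw [eval, eval_tableE hs, eval_weightE hs (by simpa using hacc') (by simpa using hacc),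
        eval_iterE hs (by simp; omega) (by simpa using hr)]
      simp

theorem eval_optLabelE {x : Ex} (hx : x.eval s ρ [] < 4 * s 0 1) : (optLabelE a x).eval s ρ [] =
    optLabel (stepWeight (fun x => pairing (s a) (s 0 1) (flip x)) (fun x => s 10 (x / 4)) (4 * s 0 1))
      (candCount (4 * s 0 1)) (fun x => pairing (s a) (s 0 1) (flip x)) (table s) (4 * s 0 1)
      (x.eval s ρ []) := by
  rw [optLabelE, eval_call1, eval_call2, eval_cycleMaxE hs (by simpa using hx), optLabel]
  simp only [eval, List.getD_cons_zero]
  generalize x.eval s ρ [] = X at *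
  have hr := (permOn_step (s := s) (a := a)).cycleMax_lt hx
  generalize cycleMax (fun x => pairing (s a) (s 0 1) (flip x)) (4 * s 0 1) X = r at *
  have hl : position (fun x => pairing (s a) (s 0 1) (flip x)) (4 * s 0 1) r r < 4 * s 0 1 :=
    (argmax_spec _ (Nat.zero_lt_of_lt hr)).1
  have e : (Ex.sub (positionE a (.var 0) (.var 0)) (positionE a (.var 0) (.var 1))).eval s [r, X] []
      = position (fun x => pairing (s a) (s 0 1) (flip x)) (4 * s 0 1) r r -
        position (fun x => pairing (s a) (s 0 1) (flip x)) (4 * s 0 1) r X := by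
    rw [eval, eval_positionE hs (by simpa using hr), eval_positionE hs (by simpa using hr)]
    simp
  rw [eval_labelsE hs (by simpa using hr) (by rw [e]; omega), e]
  simp

theorem eval_selectE {x : Ex} (hx : x.eval s ρ [] < 4 * s 0 1) : (selectE a x).eval s ρ [] =
    select (pairing (s a) (s 0 1)) (alternate flip (fun x => pairing (s a) (s 0 1) (flip x)) (4 * s 0 1))
      (x.eval s ρ []) := by
  rw [selectE, eval_call1, eval, eval_alternateE hs (by simpa using hx),
    eval_pairingE hs (by simpa using hx)]
  simp only [eval, List.getD_cons_zero, select]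
  split_ifs <;> first | rfl | contradiction

/-- The price of a copy of a half-edge. -/
noncomputable def copyPrice (s : Store) (a x : ℕ) : ℕ :=
  cand (fun x => pairing (s a) (s 0 1) (flip x)) (fun x => s 10 (x / 4)) (4 * s 0 1)
    (optLabel (stepWeight (fun x => pairing (s a) (s 0 1) (flip x)) (fun x => s 10 (x / 4)) (4 * s 0 1))
      (candCount (4 * s 0 1)) (fun x => pairing (s a) (s 0 1) (flip x)) (table s) (4 * s 0 1) x)

theorem eval_keyPriceE (k : Ex) : (keyPriceE a k).eval s ρ [] =
    keyPrice (s a) (pairing (s a) (s 0 1))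
      (alternate flip (fun x => pairing (s a) (s 0 1) (flip x)) (4 * s 0 1)) (copyPrice s a) (s 0 1)
      (k.eval s ρ []) := by
  have h1 := hs.edges
  have e : (findE half2 half2 (eq (.read a (.var 0)) (.var 2))).eval s [k.eval s ρ []] []
      = RAM.find (fun h => s a h = k.eval s ρ []) (2 * s 0 1) (2 * s 0 1) :=
    eval_findE (by simp) (by omega) (by simp) fun j acc _ => by simp
  rw [keyPriceE, eval_call1, eval_call1, e, keyPrice, eval]
  have hle : RAM.find (fun h => s a h = k.eval s ρ []) (2 * s 0 1) (2 * s 0 1) ≤ 2 * s 0 1 := by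
    by_cases h : ∃ i < 2 * s 0 1, s a i = k.eval s ρ []
    · exact (find_of_exists h).1.le
    · push Not at h
      exact (find_of_forall h).le
  generalize RAM.find (fun h => s a h = k.eval s ρ []) (2 * s 0 1) (2 * s 0 1) = h at *
  simp only [eval_eq, eval, List.getD_cons_zero, eval_half2, ne_eq, not_not]
  by_cases hh : h = 2 * s 0 1
  · rw [if_pos hh, if_pos hh]
  · rw [if_neg hh, if_neg hh]
    have es : (selectE a (.add (.var 0) (.var 0))).eval s [h] [] = select (pairing (s a) (s 0 1))
        (alternate flip (fun x => pairing (s a) (s 0 1) (flip x)) (4 * s 0 1)) (2 * h) := by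
      rw [eval_selectE hs (by simp; omega)]
      simp [two_mul]
    have hlt : select (pairing (s a) (s 0 1))
        (alternate flip (fun x => pairing (s a) (s 0 1) (flip x)) (4 * s 0 1)) (2 * h) < 4 * s 0 1 := by
      unfold select
      split_ifs
      · omega
      · exact (involOn_pairing _ _).maps _ (by omega)
    have eo := eval_optLabelE hs (a := a) (ρ := [h]) (by rw [es]; exact hlt)
    rw [es] at eo
    have hC : 0 < candCount (4 * s 0 1) := by
      unfold candCount; have := Nat.zero_lt_of_lt hlt; positivity
    rw [eval_candE hs (by rw [eo]; exact optLabel_lt hC _ _), eo]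
    rfl

omit hs in
/-- The prices computed from a correct table are optimal. -/
theorem keyRevenue_le_copyPrice (hT : TableSpec s a) (hw : ∀ e < s 0 1, Even (s 10 e))
    (hr : ∀ h < 2 * s 0 1, rank (s a) h < 2) (q : ℕ → ℝ) (hq : ∀ k, 0 ≤ q k) :
    keyRevenue (s 10) (s a) (s 0 1) q ≤ keyRevenue (s 10) (s a) (s 0 1) (fun k =>
      keyPrice (s a) (pairing (s a) (s 0 1))
        (alternate flip (fun x => pairing (s a) (s 0 1) (flip x)) (4 * s 0 1)) (copyPrice s a) (s 0 1) k) := by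
  refine keyRevenue_le (involOn_pairing _ _) (fun x hx => key_pairing hx) ?_ (fun Q hQ => ?_) q hq
  · intro h hh h' hh' hk hne c hc
    have := hr h hh
    have := hr h' hh'
    exact pairing_eq hh' hk (by omega) hne hc
  · exact (permOn_step (s := s) (a := a)).val_sum_le (w := fun x => s 10 (x / 4))
      (fun x hx => hw _ (by omega)) hT Q hQ

omit hs in
theorem index_decode {M C i v x y : ℕ} (hv : v < M) (hx : x < C) (hy : y < C) :
    (((i * M + v) * C + x) * C + y) / C / C / M = i ∧
    (((i * M + v) * C + x) * C + y) / C / C % M = v ∧ (((i * M + v) * C + x) * C + y) / C % C = x ∧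
      (((i * M + v) * C + x) * C + y) % C = y := by
  have h1 : ∀ {q r d : ℕ}, r < d → (q * d + r) / d = q := fun {q r d} h => by
    rw [add_comm, Nat.add_mul_div_right _ _ (Nat.zero_lt_of_lt h), Nat.div_eq_of_lt h, zero_add]
  have h2 : ∀ {q r d : ℕ}, r < d → (q * d + r) % d = r := fun {q r d} h => by
    rw [add_comm, Nat.add_mul_mod_self_right, Nat.mod_eq_of_lt h]
  rw [h1 hy, h1 hx, h1 hv, h2 hv, h2 hx, h2 hy]
  exact ⟨rfl, rfl, rfl, rfl⟩

omit hs in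
theorem mul_add_lt {C x y a : ℕ} (hy : y < C) (h : x < a) : x * C + y < a * C := by
  have := Nat.mul_le_mul_right C (Nat.succ_le_of_lt h)
  rw [Nat.succ_mul] at this
  omega

omit hs in
theorem index_lt {M C i v x y : ℕ} (hi : i < M) (hv : v < M) (hx : x < C) (hy : y < C) :
    ((i * M + v) * C + x) * C + y < M * M * C * C :=
  mul_add_lt hy (mul_add_lt hx (mul_add_lt hv hi))

-- An entry for a walk that is one step shorter precedes entry `t`, whatever its last label: the
-- length is the leading digit of the index.
omit hs in
theorem index_pred_lt {M C t z : ℕ} (h : t / C / C / M ≠ 0) (hC : 0 < C) (hz : z < C) :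
    (((t / C / C / M - 1) * M + t / C / C % M) * C + t / C % C) * C + z < t := by
  have e1 := Nat.div_add_mod' (t / C / C) M
  have k1 : (t / C / C / M - 1) * M + t / C / C % M < t / C / C := by
    have : (t / C / C / M - 1) * M < t / C / C / M * M :=
      Nat.mul_lt_mul_of_pos_right (Nat.sub_lt (Nat.pos_of_ne_zero h) one_pos) (Nat.pos_of_ne_zero fun h0 => h (by simp [h0]))
    omega
  have k2 := mul_add_lt (Nat.mod_lt (t / C) hC) k1
  have k3 := mul_add_lt hz (k2.trans_le (Nat.div_mul_le_self (t / C) C))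
  exact k3.trans_le (Nat.div_mul_le_self t C)

/-- The dynamic program fills the table correctly. -/
theorem tableSpec_filled (ha : a ≠ 16) : TableSpec (filled 16 (entryE a) s) a := by
  have e0 : filled 16 (entryE a) s 0 = s 0 := filled_of_ne (by decide)
  have e10 : filled 16 (entryE a) s 10 = s 10 := filled_of_ne (by decide)
  have ea : filled 16 (entryE a) s a = s a := filled_of_ne ha
  intro i hi v hv x hx y hy
  rw [e0] at hi hv hx hy
  simp only [table, e0, e10, ea]
  have hC := Nat.zero_lt_of_lt hx
  have hM := Nat.zero_lt_of_lt hv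
  have h4 := hs.edges
  have hcand := hs.cands
  set C := candCount (4 * s 0 1) with hCdef
  set M := 4 * s 0 1 with hMdef
  set W := stepWeight (fun x => pairing (s a) (s 0 1) (flip x)) (fun x => s 10 (x / 4)) M with hW
  set f := fun x => pairing (s a) (s 0 1) (flip x) with hf
  -- Course-of-values recursion over the index; length, start, first and last label are its digits
  -- in a mixed radix system.
  have key := filled_apply (a := 16) (e := entryE a) (M := s)
    (i := ((i * M + v) * C + x) * C + y)
    (fun t => walkMax W C f (t / C / C / M) (t / C / C % M) (t / C % C) (t % C)) (fun t ht M' hM' hprev => ?_) ?_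
  · obtain ⟨h1, h2, h3, h4⟩ := index_decode (i := i) hv hx hy
    rw [key, h1, h2, h3, h4]
  · have m0 := hM' 0 (by decide)
    have m8 := hM' 8 (by decide)
    have m10 := hM' 10 (by decide)
    have ma := hM' a ha
    have hs' : Large M' := by
      constructor <;> rw [m0, m8]
      exacts [hs.edges, hs.vertices, hs.cands, hs.table, hs.vertices_sq]
    have d1 : (div (.var 0) countE).eval M' [t] [] = t / C := by
      rw [eval_div (by simpa [m8] using ht) (by rw [eval_countE hs', m0]; exact hC), eval_countE hs', m0]
      rfl
    have d2 : (div (div (.var 0) countE) countE).eval M' [t] [] = t / C / C := by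
      rw [eval_div (by rw [d1, m8]; exact (Nat.div_le_self _ _).trans_lt ht)
        (by rw [eval_countE hs', m0]; exact hC), eval_countE hs', m0, d1]
    have lt2 : t / C / C < s 8 0 := ((Nat.div_le_self _ _).trans (Nat.div_le_self _ _)).trans_lt ht
    have d3 : (div (div (div (.var 0) countE) countE) four).eval M' [t] [] = t / C / C / M := by
      rw [eval_div (by rw [d2, m8]; exact lt2) (by rw [eval_four, m0]; exact hM), eval_four, m0, d2]
    have d4 : (mod (div (div (.var 0) countE) countE) four).eval M' [t] [] = t / C / C % M := by
      rw [eval_mod (by rw [d2, m8]; exact lt2) (by rw [eval_four, m0]; exact hM), eval_four, m0, d2]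
    have d5 : (mod (div (.var 0) countE) countE).eval M' [t] [] = t / C % C := by
      rw [eval_mod (by rw [d1, m8]; exact (Nat.div_le_self _ _).trans_lt ht)
        (by rw [eval_countE hs', m0]; exact hC), eval_countE hs', m0, d1]
    have d6 : (mod (.var 0) countE).eval M' [t] [] = t % C := by
      rw [eval_mod (by simpa [m8] using ht) (by rw [eval_countE hs', m0]; exact hC), eval_countE hs', m0]
      rfl
    have l4 := Nat.mod_lt (t / C / C) hM
    have l5 := Nat.mod_lt (t / C) hC
    have l6 := Nat.mod_lt t hC
    rw [entryE, eval_walkE hs']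
    · rw [d3, d4, d5, d6, m0, m10, ma]
    · rw [d3, m8]
      exact (Nat.div_le_self _ _).trans lt2.le
    · rw [d4, m0]; exact l4
    · rw [d5, m0]; exact l5
    · rw [d6, m0]; exact l6
    · intro z hz hi0
      rw [d3] at hi0 ⊢
      rw [d4, d5, m0, m10, ma, table, m0]
      rw [m0] at hz
      obtain ⟨h1, h2, h3, h4⟩ := index_decode (i := t / C / C / M - 1) l4 l5 hz
      rw [hprev]
      · rw [h1, h2, h3, h4]
      · exact index_pred_lt hi0 hC hz
  · refine lt_of_lt_of_le ?_ hs.table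
    exact index_lt hi hv hx hy

end

end Program

end GVP

/-! ## Instances in memory -/

namespace RAM

theorem iterate_mul (g : ℕ → ℕ) (a n : ℕ) :
    iterate (fun j acc => acc * g j) a n = a * ∏ j ∈ Finset.range n, g j := by
  induction n with
  | zero => simp [iterate]
  | succ n ih => rw [iterate, ih, Finset.prod_range_succ, mul_assoc]

theorem size_sum_le (f : ℕ → ℕ) (n : ℕ) :
    (∑ i ∈ Finset.range n, f i).size ≤ ∑ i ∈ Finset.range n, ((f i).size + 1) := by
  induction n with
  | zero => simp
  | succ n ih =>
    rw [Finset.sum_range_succ, Finset.sum_range_succ]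
    exact (Nat.size_add_le _ _).trans (by omega)

theorem getD_ofFn {n : ℕ} (f : Fin n → ℕ) (i : Fin n) : (List.ofFn f).getD i 0 = f i := by
  simp [List.getD]

theorem sum_map_ofFn {n : ℕ} (f : Fin n → ℕ) (g : ℕ → ℕ) :
    ((List.ofFn f).map g).sum = ∑ i, g (f i) := by
  simp [List.map_ofFn, List.sum_ofFn]

theorem filled_rec {a : ℕ} {e : Ex} {M : Store} {i : ℕ} (hi : i < M 8 0) :
    ∃ M' : Store, (∀ a' ≠ a, M' a' = M a') ∧ (∀ j < i, M' a j = filled a e M a j) ∧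
      filled a e M a i = e.eval M' [i] [] := by
  have : ∀ t j, j < t → fillSteps a e M t a j = e.eval (fillSteps a e M j) [j] [] := by
    intro t
    induction t with
    | zero => intro j h; omega
    | succ t ih =>
      intro j ht
      rw [fillSteps]
      by_cases hit : j = t
      · subst hit; rw [set_same]
      · rw [set_of_ne (by omega), ih j (by omega)]
  refine ⟨fillSteps a e M i, fun a' ha' => fillSteps_of_ne ha' _, fun j hj => ?_, this _ _ hi⟩
  rw [this i j hj, filled, this _ j (by omega)]

theorem filled_eq {a : ℕ} {e : Ex} {M : Store} {i v : ℕ} (hi : i < M 8 0)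
    (h : ∀ M' : Store, (∀ a' ≠ a, M' a' = M a') → e.eval M' [i] [] = v) : filled a e M a i = v := by
  obtain ⟨M', h1, -, h3⟩ := filled_rec (e := e) hi
  rw [h3, h M' h1]

end RAM

namespace GVP

open RAM

/-- The memory starts with an encoding of `I` and the bound for the loops is large. -/
structure Represents (M : Store) (I : PricingInstance) : Prop where
  n : M 0 0 = I.n
  m : M 0 1 = I.m
  src : ∀ e : Fin I.m, M 2 e = I.src e
  tgt : ∀ e : Fin I.m, M 3 e = I.tgt e
  num : ∀ e : Fin I.m, M 4 e = (I.budget e).num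
  den : ∀ e : Fin I.m, M 5 e = (I.budget e).den
  num_lt : ∀ e < M 0 1, M 4 e < 2 ^ M 8 0
  den_lt : ∀ e < M 0 1, M 5 e < 2 ^ M 8 0
  large : Program.Large M

theorem Represents.congr {M M' : Store} {I : PricingInstance} (hM : Represents M I)
    (h : ∀ a < 6, M' a = M a) (h8 : M' 8 = M 8) : Represents M' I := by
  have h0 := h 0 (by decide)
  constructor <;> try simp only [h0, h 2 (by decide), h 3 (by decide), h 4 (by decide), h 5 (by decide), h8]
  · exact hM.n
  · exact hM.m
  · exact hM.src
  · exact hM.tgt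
  · exact hM.num
  · exact hM.den
  · exact hM.num_lt
  · exact hM.den_lt
  · constructor <;> rw [h0, h8]
    exacts [hM.large.edges, hM.large.vertices, hM.large.cands, hM.large.table, hM.large.vertices_sq]

theorem Represents.filled {M : Store} {I : PricingInstance} (hM : Represents M I) {a : ℕ} {e : Ex}
    (ha : 8 < a) : Represents (filled a e M) I :=
  hM.congr (fun _ h => filled_of_ne (by omega)) (filled_of_ne (by omega))

/-- The initial memory represents the instance. -/
theorem represents_of_prepared {w : List (List ℕ)} {M : Store} {I : PricingInstance}
    (hM : Prepared w M) (hw : ∀ a < 6, load w a = load I.encode a) : Represents M I := by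
  have e : ∀ a < 6, M a = load I.encode a := fun a ha => by rw [hM.1 a (by omega), hw a ha]
  have h0 : M 0 0 = I.n := by rw [e 0 (by decide)]; rfl
  have h1 : M 0 1 = I.m := by rw [e 0 (by decide)]; rfl
  have hb : M 8 0 = baseBound M ^ 8 := by
    rw [hM.2]; unfold baseBound
    rw [hM.1 0 (by omega), hM.1 4 (by omega), hM.1 5 (by omega)]
  have hb1 : 4 * (M 0 0 + M 0 1) + 8 ≤ baseBound M := Nat.le_add_right _ _
  have hb2 : baseBound M ≤ M 8 0 := by rw [hb]; exact Nat.le_self_pow (by decide) _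
  have hS : ∑ i ∈ Finset.range (M 0 1), (M 4 i + M 5 i) < 2 ^ M 8 0 := by
    refine (Nat.lt_size_self _).trans_le (Nat.pow_le_pow_right (by decide) (le_trans ?_ hb2))
    exact Nat.le_add_left _ _
  have hle : ∀ e < M 0 1, M 4 e + M 5 e ≤ ∑ i ∈ Finset.range (M 0 1), (M 4 i + M 5 i) := fun e he =>
    Finset.single_le_sum (f := fun i => M 4 i + M 5 i) (fun _ _ => Nat.zero_le _)
      (Finset.mem_range.2 he)
  constructor
  · exact h0
  · exact h1
  · intro i; rw [e 2 (by decide)]; exact getD_ofFn (fun e => (I.src e : ℕ)) i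
  · intro i; rw [e 3 (by decide)]; exact getD_ofFn (fun e => (I.tgt e : ℕ)) i
  · intro i; rw [e 4 (by decide)]; exact getD_ofFn (fun e => (I.budget e).num) i
  · intro i; rw [e 5 (by decide)]; exact getD_ofFn (fun e => (I.budget e).den) i
  · intro i hi; have := hle i hi; omega
  · intro i hi; have := hle i hi; omega
  · have hp : ∀ k ≤ 8, baseBound M ^ k ≤ M 8 0 := fun k hk => by
      rw [hb]; exact Nat.pow_le_pow_right (by omega) hk
    have p2 := hp 2 (by decide)
    have p3 := hp 3 (by decide)
    have p8 := hp 8 (by decide)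
    have hC : candCount (4 * M 0 1) ≤ 2 * baseBound M ^ 2 := by
      calc candCount (4 * M 0 1) = (4 * M 0 1 + 1) * (4 * M 0 1) * 2 := rfl
        _ ≤ baseBound M * baseBound M * 2 := by gcongr <;> omega
        _ = _ := by ring
    have h2 : 2 ≤ baseBound M := by omega
    constructor
    · omega
    · omega
    · refine hC.trans (le_trans ?_ p3)
      rw [pow_succ' _ 2]; gcongr
    -- The table has `M * M * C * C` entries with `M` linear and `C` quadratic in `baseBound`, at
    -- most `4 * baseBound ^ 6` in all. This is why the cap is an eighth power.
    · calc _ ≤ baseBound M * baseBound M * (2 * baseBound M ^ 2) * (2 * baseBound M ^ 2) := by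
            gcongr <;> omega
        _ = 2 * 2 * baseBound M ^ 6 := by ring
        _ ≤ baseBound M * baseBound M * baseBound M ^ 6 := by gcongr
        _ = baseBound M ^ 8 := by ring
        _ ≤ _ := p8
    · calc _ ≤ baseBound M * baseBound M := by gcongr <;> omega
        _ = baseBound M ^ 2 := by ring
        _ ≤ _ := p2

/-- Vertices and edges are listed one by one, so `n` and `m` themselves, not only their bit lengths,
are bounded by the input length. -/
theorem PricingInstance.inputSize_encode (I : PricingInstance) : I.n ≤ inputSize I.encode ∧
    I.m ≤ inputSize I.encode ∧ (∑ i ∈ Finset.range I.m, (load I.encode 4 i + load I.encode 5 i)).size ≤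
      inputSize I.encode := by
  have e : inputSize I.encode = (I.n.size + 1 + (I.m.size + 1)) + ((∑ v : Fin I.n, ((v : ℕ).size + 1)) +
      ((∑ e, ((I.src e : ℕ).size + 1)) + ((∑ e, ((I.tgt e : ℕ).size + 1)) +
      ((∑ e, ((I.budget e).num.size + 1)) + ((∑ e, ((I.budget e).den.size + 1))))))) := by
    simp only [inputSize, PricingInstance.encode, List.map_cons, List.map_nil, List.sum_cons, List.sum_nil,
      sum_map_ofFn, add_zero]
  have hn : I.n ≤ ∑ v : Fin I.n, ((v : ℕ).size + 1) := by
    simp [Finset.sum_add_distrib]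
  have hm : I.m ≤ ∑ e, ((I.src e : ℕ).size + 1) := by
    simp [Finset.sum_add_distrib]
  refine ⟨by omega, by omega, ?_⟩
  refine (size_sum_le _ _).trans ?_
  have h4 : ∀ i : Fin I.m, load I.encode 4 i = (I.budget i).num := fun i =>
    getD_ofFn (fun e => (I.budget e).num) i
  have h5 : ∀ i : Fin I.m, load I.encode 5 i = (I.budget i).den := fun i =>
    getD_ofFn (fun e => (I.budget e).den) i
  rw [Finset.sum_range (fun i => (load I.encode 4 i + load I.encode 5 i).size + 1)]
  have : ∑ i : Fin I.m, ((load I.encode 4 i + load I.encode 5 i).size + 1) ≤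
      ∑ i : Fin I.m, (((I.budget i).num.size + 1) + ((I.budget i).den.size + 1)) := by
    refine Finset.sum_le_sum fun i _ => ?_
    rw [h4, h5]
    have := Nat.size_add_le (I.budget i).num (I.budget i).den
    omega
  rw [Finset.sum_add_distrib (f := fun i => (I.budget i).num.size + 1)] at this
  omega

/-- The ends of the edges: half-edge `2 e` is the first end of edge `e` and half-edge `2 e + 1` is
the second one. -/
def endVertex (M : Store) (h : ℕ) : ℕ := if h % 2 = 0 then M 2 (h / 2) else M 3 (h / 2)

/-- Without loops, an edge contributes at most one half-edge to a vertex, so halving is injective on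
the half-edges there. The bound is strict because `rank` does not count `h` itself. -/
theorem rank_endVertex {M : Store} {I : PricingInstance} (hM : Represents M I) {d : ℕ}
    (hd : ∀ v, I.degree v ≤ d) {h : ℕ} (hh : h < 2 * M 0 1) : rank (endVertex M) h < d := by
  rw [hM.m] at hh
  have val : ∀ j (hj : j / 2 < I.m), endVertex M j =
      if j % 2 = 0 then (I.src ⟨j / 2, hj⟩ : ℕ) else I.tgt ⟨j / 2, hj⟩ := fun j hj => by
    rw [endVertex, ← hM.src ⟨j / 2, hj⟩, ← hM.tgt ⟨j / 2, hj⟩]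
  have hv : ∃ v : Fin I.n, endVertex M h = v := by
    rw [val h (by omega)]
    split_ifs
    exacts [⟨_, rfl⟩, ⟨_, rfl⟩]
  obtain ⟨v, hv⟩ := hv
  refine lt_of_lt_of_le ?_ (hd v)
  have key : ((Finset.range (h + 1)).filter fun j => endVertex M j = v).card ≤ I.degree v := by
    rw [PricingInstance.degree, ← Finset.card_map Fin.valEmbedding]
    refine Finset.card_le_card_of_injOn (fun j => j / 2) (fun j hj => ?_) fun j hj j' hj' hjj => ?_
    · simp only [Finset.coe_filter, Finset.mem_range, Set.mem_ofPred_eq] at hj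
      simp only [Finset.coe_map, Set.mem_image, Finset.mem_coe, Finset.mem_filter, Finset.mem_univ,
        true_and]
      refine ⟨⟨j / 2, by omega⟩, ?_, rfl⟩
      have := hj.2
      rw [val j (by omega)] at this
      split_ifs at this
      · exact Or.inl (Fin.ext this)
      · exact Or.inr (Fin.ext this)
    · simp only [Finset.coe_filter, Finset.mem_range, Set.mem_ofPred_eq] at hj hj'
      have h1 := hj.2
      have h2 := hj'.2
      rw [val j (by omega)] at h1
      rw [val j' (by omega)] at h2
      simp only at hjj
      simp only [← hjj] at h2
      have hne : (I.src ⟨j / 2, by omega⟩ : ℕ) ≠ I.tgt ⟨j / 2, by omega⟩ := fun h =>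
        I.src_ne_tgt _ (Fin.ext h)
      split_ifs at h1 h2 <;> omega
  refine lt_of_lt_of_le ?_ key
  rw [rank_eq_card, Finset.range_add_one, Finset.filter_insert, if_pos hv,
    Finset.card_insert_of_notMem (by simp), hv]
  exact Nat.lt_succ_self _

namespace Program

open RAM.Ex

/-! ### Scaled budgets -/

/-- The budget of edge `var 0`, scaled. -/
def scaledBudgetE : Ex := bigmul (.loop numEdges (.const 2) (bigmul (.var 1)
  (.ite (eq (.var 0) (.var 2)) (.read 4 (.var 0)) (.read 5 (.var 0))))) (.const 1)

/-- The scaling factor. -/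
def scaleE : Ex := .loop numEdges (.const 2) (bigmul (.var 1) (.read 5 (.var 0)))

/-- Array `10` holds the budgets, scaled by the number in array `11`. -/
def Scaled (M : Store) (I : PricingInstance) (D : ℕ) : Prop :=
  0 < D ∧ (∀ i < M 8 0, M 11 i = D) ∧
    ∀ e : Fin I.m, Even (M 10 e) ∧ (M 10 e : ℝ) = D * ((I.budget e : ℚ≥0) : ℝ)

/-- The scaling factor is twice the product of all denominators. A scaled budget is twice its
numerator times the other denominators, which is even and needs no division. -/
theorem scaled_filled {M : Store} {I : PricingInstance} (hM : Represents M I) :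
    ∃ D, Scaled (filled 11 scaleE (filled 10 scaledBudgetE M)) I D := by
  have hlarge := hM.large.edges
  set M1 := filled 10 scaledBudgetE M with hM1
  have e8 : M1 8 = M 8 := filled_of_ne (by decide)
  have h10 : ∀ i < M 8 0, M1 10 i = 2 * ∏ j ∈ Finset.range (M 0 1), if j = i then M 4 j else M 5 j := by
    intro i hi
    refine filled_eq hi fun M' hM' => ?_
    have m8 := hM' 8 (by decide)
    have m0 := hM' 0 (by decide)
    rw [scaledBudgetE, eval_bigmul (by simp [m8]; omega), ← iterate_mul]
    simp only [eval, mul_one]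
    simp only [eval_numEdges, m8, m0]
    rw [min_eq_left (by omega)]
    refine iterate_congr fun j acc hj => ?_
    have h4 := hM.num_lt j hj
    have h5 := hM.den_lt j hj
    have : (Ex.ite (eq (.var 0) (.var 2)) (.read 4 (.var 0)) (.read 5 (.var 0))).eval M' [j, acc, i] [] =
        if j = i then M 4 j else M 5 j := by
      simp [hM']
    rw [eval_bigmul, this]
    · simp
    · rw [this, m8]; split_ifs <;> assumption
  have hprod : ∀ i < M1 8 0, filled 11 scaleE M1 11 i = 2 * ∏ j ∈ Finset.range (M 0 1), M 5 j := by
    intro i hi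
    refine filled_eq hi fun M' hM' => ?_
    have m8 : M' 8 = M 8 := (hM' 8 (by decide)).trans e8
    have m0 : M' 0 = M 0 := (hM' 0 (by decide)).trans (filled_of_ne (by decide))
    have m5 : M' 5 = M 5 := (hM' 5 (by decide)).trans (filled_of_ne (by decide))
    rw [← iterate_mul]
    simp only [scaleE, eval, eval_numEdges, m8, m0]
    rw [min_eq_left (by omega)]
    refine iterate_congr fun j acc hj => ?_
    rw [eval_bigmul (by simpa [m5, m8] using hM.den_lt j hj)]
    simp [m5]
  refine ⟨2 * ∏ j ∈ Finset.range (M 0 1), M 5 j, ?_, ?_, fun e => ?_⟩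
  · refine Nat.mul_pos two_pos (Finset.prod_pos fun j hj => ?_)
    rw [Finset.mem_range, hM.m] at hj
    rw [hM.den ⟨j, hj⟩]
    exact (I.budget _).den_pos
  · intro i hi
    exact hprod i (by simpa [filled_of_ne] using hi)
  · have he : (e : ℕ) < M 0 1 := by rw [hM.m]; exact e.2
    have hf : filled 11 scaleE M1 10 = M1 10 := filled_of_ne (by decide)
    rw [hf, h10 e (by omega)]
    refine ⟨even_two_mul _, ?_⟩
    rw [← Finset.mul_prod_erase _ _ (Finset.mem_range.2 he),
      ← Finset.mul_prod_erase (Finset.range (M 0 1)) (fun j => M 5 j) (Finset.mem_range.2 he), if_pos rfl,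
      hM.num e, hM.den e]
    have : ∏ j ∈ (Finset.range (M 0 1)).erase e, (if j = (e : ℕ) then M 4 j else M 5 j) =
        ∏ j ∈ (Finset.range (M 0 1)).erase e, M 5 j :=
      Finset.prod_congr rfl fun j hj => if_neg (Finset.ne_of_mem_erase hj)
    rw [this]
    have hb : ((I.budget e : ℚ≥0) : ℝ) = (I.budget e).num / (I.budget e).den := by
      exact NNRat.cast_def _
    have hden : ((I.budget e).den : ℝ) ≠ 0 := by exact_mod_cast (I.budget e).den_ne_zero
    rw [hb]
    push_cast
    field_simp

theorem val_mul {D : ℝ} (hD : 0 < D) (w a b : ℝ) : val (D * w) (D * a) (D * b) = D * val w a b := by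
  unfold val
  simp only [← mul_add, mul_le_mul_iff_right₀ hD, mul_ite, mul_zero]

theorem keyRevenue_eq {M : Store} {I : PricingInstance} {D : ℕ} (hM : Represents M I) (hD : Scaled M I D)
    {q : Fin I.n → ℝ≥0} {Q : ℕ → ℝ} (hQ : ∀ v : Fin I.n, Q v = D * q v) :
    keyRevenue (M 10) (endVertex M) (M 0 1) Q = D * I.revenue q := by
  rw [keyRevenue, PricingInstance.revenue, Finset.mul_sum, hM.m, Finset.sum_range]
  refine Finset.sum_congr rfl fun e _ => ?_
  have h0 : endVertex M (2 * e) = I.src e := by rw [← hM.src e]; simp [endVertex]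
  have h1 : endVertex M (2 * e + 1) = I.tgt e := by
    rw [← hM.tgt e, endVertex, if_neg (by omega)]; congr 1; omega
  rw [h0, h1, hQ, hQ, (hD.2.2 e).2, val_mul (by exact_mod_cast hD.1)]
  rfl

/-- The prices in array `p` are written to the output. -/
theorem exists_output {M : Store} {I : PricingInstance} {D : ℕ} (hM : Represents M I) (hD : Scaled M I D)
    {ρ : ℝ} {p : ℕ} (hp : 8 < p)
    (h : ∀ q : ℕ → ℝ, (∀ k, 0 ≤ q k) → keyRevenue (M 10) (endVertex M) (M 0 1) q ≤
      ρ * keyRevenue (M 10) (endVertex M) (M 0 1) (fun k => M p k)) :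
    ∃ y : I.Fractions, Holds (staged [(1, .read 11 (.var 0)), (0, .read p (.var 0))] M)
      (I.encodePrices y) ∧ I.IsApprox ρ y.price := by
  have hn : I.n ≤ M 8 0 := by have := hM.large.vertices; have := hM.n; omega
  -- The computed prices are integers in the scaled instance, so the scaling factor is a common
  -- denominator.
  refine ⟨fun v => (M p v, ⟨D, hD.1⟩), ?_, fun q => ?_⟩
  · intro a ha i hi
    simp only [staged]
    have e1 : ∀ i < M 8 0, filled 1 (.read 11 (.var 0)) M 1 i = D := fun i hi => by
      rw [filled_eq (v := M 11 i) hi fun M' hM' => by simp [hM']]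
      exact hD.2.1 i hi
    have e2 : ∀ i < M 8 0, filled 0 (.read p (.var 0)) (filled 1 (.read 11 (.var 0)) M) 0 i = M p i :=
      fun i hi => by
        refine filled_eq (by rwa [filled_of_ne (by decide)]) fun M' hM' => ?_
        simp only [eval, List.getD_cons_zero]
        rw [hM' p (by omega), filled_of_ne (by omega)]
    match a, ha, hi with
    | 0, _, hi =>
      have hi' : i < I.n := by simpa [PricingInstance.encodePrices] using hi
      rw [e2 i (by omega)]
      simp [PricingInstance.encodePrices]
    | 1, _, hi =>
      have hi' : i < I.n := by simpa [PricingInstance.encodePrices] using hi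
      rw [filled_of_ne (by decide), e1 i (by omega)]
      simp [PricingInstance.encodePrices]
  · have hD0 : (0 : ℝ) < D := by exact_mod_cast hD.1
    have h1 := keyRevenue_eq hM hD (q := q)
      (Q := fun k => if hk : k < I.n then D * q ⟨k, hk⟩ else 0) (fun v => by simp)
    have h2 := keyRevenue_eq hM hD
      (q := PricingInstance.Fractions.price (I := I) fun v => (M p v, ⟨D, hD.1⟩)) (Q := fun k => M p k) (fun v => by
        simp only [PricingInstance.Fractions.price]
        push_cast
        simp
        field_simp)
    have h3 := h (fun k => if hk : k < I.n then D * q ⟨k, hk⟩ else 0) (fun k => by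
      split_ifs
      · positivity
      · exact le_rfl)
    rw [h1, h2] at h3
    refine le_of_mul_le_mul_left (h3.trans_eq ?_) hD0
    ring

end Program

end GVP

/-! ## Graphs of maximum degree two -/

namespace GVP

open RAM

theorem keyRevenue_congr {w key key' : ℕ → ℕ} {m : ℕ} {q q' : ℕ → ℝ}
    (hk : ∀ h < 2 * m, key h = key' h) (hq : ∀ h < 2 * m, q (key' h) = q' (key' h)) :
    keyRevenue w key m q = keyRevenue w key' m q' := by
  refine Finset.sum_congr rfl fun e he => ?_
  rw [Finset.mem_range] at he
  rw [hk _ (by omega), hk _ (by omega), hq _ (by omega), hq _ (by omega)]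

theorem rank_congr {key key' : ℕ → ℕ} {m h : ℕ} (hk : ∀ h < 2 * m, key h = key' h) (hh : h < 2 * m) :
    rank key h = rank key' h := by
  refine Finset.sum_congr rfl fun j hj => ?_
  rw [Finset.mem_range] at hj
  rw [hk h hh, hk j (by omega)]

namespace Program

open RAM.Ex

/-- Two stages that compute in array `17` optimal prices of the keys in array `a`. -/
theorem keyRevenue_le_filled {s : Store} (hs : Large s) {a : ℕ} (ha : 10 < a) (ha' : a < 16)
    (hw : ∀ e < s 0 1, Even (s 10 e)) (hr : ∀ h < 2 * s 0 1, rank (s a) h < 2)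
    (hk : ∀ h < 2 * s 0 1, s a h < s 8 0) (q : ℕ → ℝ) (hq : ∀ k, 0 ≤ q k) :
    keyRevenue (s 10) (s a) (s 0 1) q ≤ keyRevenue (s 10) (s a) (s 0 1) (fun k =>
      filled 17 (keyPriceE a (.var 0)) (filled 16 (entryE a) s) 17 k) := by
  set T := filled 16 (entryE a) s with hT
  have t0 : T 0 = s 0 := filled_of_ne (by decide)
  have t8 : T 8 = s 8 := filled_of_ne (by decide)
  have t10 : T 10 = s 10 := filled_of_ne (by decide)
  have ta : T a = s a := filled_of_ne (by omega)
  have hTs : TableSpec T a := tableSpec_filled hs (by omega)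
  have h1 := keyRevenue_le_copyPrice hTs (by rwa [t0, t10]) (by rwa [t0, ta]) q hq
  rw [t10, t0, ta] at h1
  refine h1.trans_eq (keyRevenue_congr (fun _ _ => rfl) fun h hh => ?_)
  rw [filled_eq (by rw [t8]; exact hk h hh) fun M' hM' => ?_]
  have m0 : M' 0 = s 0 := (hM' 0 (by decide)).trans t0
  have m8 : M' 8 = s 8 := (hM' 8 (by decide)).trans t8
  have m10 : M' 10 = s 10 := (hM' 10 (by decide)).trans t10
  have ma : M' a = s a := (hM' a (by omega)).trans ta
  have m16 : M' 16 = T 16 := hM' 16 (by decide)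
  have hM : Large M' := by
    constructor <;> rw [m0, m8]
    exacts [hs.edges, hs.vertices, hs.cands, hs.table, hs.vertices_sq]
  have hc : copyPrice M' a = copyPrice T a := by
    funext x
    have ht : table M' = table T := by
      funext i v x y
      simp only [table, m0, t0, m16]
    simp only [copyPrice, ht, m0, m10, ma, t0, t10, ta]
  rw [eval_keyPriceE hM, hc, m0, ma]
  rfl

/-- The end of half-edge `var 0`. -/
def endE : Ex := .ite (mod2 (.var 0)) (.read 3 (.half (.var 0))) (.read 2 (.half (.var 0)))

theorem filled_endE {M : Store} {h : ℕ} (hh : h < M 8 0) : filled 12 endE M 12 h = endVertex M h := by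
  refine filled_eq hh fun M' hM' => ?_
  simp only [endE, eval, eval_mod2, hM' 2 (by decide), hM' 3 (by decide), List.getD_cons_zero, endVertex,
    ne_eq, ite_not]

/-- The common part of all programs. -/
def scaleStages : List (ℕ × Ex) := [(10, scaledBudgetE), (11, scaleE), (12, endE)]

theorem staged_append (l l' : List (ℕ × Ex)) (M : Store) : staged (l ++ l') M = staged l' (staged l M) := by
  induction l generalizing M with
  | nil => rfl
  | cons p l ih => exact ih _

theorem Scaled.congr {M M' : Store} {I : PricingInstance} {D : ℕ} (h : Scaled M I D) (h8 : M' 8 = M 8)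
    (h10 : M' 10 = M 10) (h11 : M' 11 = M 11) : Scaled M' I D := by
  simpa only [Scaled, h8, h10, h11] using h

theorem scaleStages_spec {M : Store} {I : PricingInstance} (hM : Represents M I) :
    Represents (staged scaleStages M) I ∧ (∃ D, Scaled (staged scaleStages M) I D) ∧
    (∀ h < 2 * I.m, staged scaleStages M 12 h = endVertex (staged scaleStages M) h) ∧
    ∀ a, a < 10 → staged scaleStages M a = M a := by
  obtain ⟨D, hD⟩ := scaled_filled hM
  have hR := (hM.filled (a := 10) (e := scaledBudgetE) (by decide)).filled (a := 11) (e := scaleE) (by decide)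
  refine ⟨hR.filled (by decide), ⟨D, hD.congr ?_ ?_ ?_⟩, fun h hh => ?_, fun a ha => ?_⟩
  · exact filled_of_ne (by decide)
  · exact filled_of_ne (by decide)
  · exact filled_of_ne (by decide)
  · have := hR.large.edges
    have := hR.m
    have hv : endVertex (staged scaleStages M) =
        endVertex (filled 11 scaleE (filled 10 scaledBudgetE M)) := by
      funext h
      simp only [endVertex, scaleStages, staged, filled_of_ne (show (2 : ℕ) ≠ 12 by decide),
        filled_of_ne (show (3 : ℕ) ≠ 12 by decide)]
    rw [hv]
    exact filled_endE (M := filled 11 scaleE (filled 10 scaledBudgetE M)) (by omega)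
  · simp only [scaleStages, staged]
    rw [filled_of_ne (by omega), filled_of_ne (by omega), filled_of_ne (by omega)]

/-- The program for graphs of maximum degree two. -/
def degreeTwo : List (ℕ × Ex) := scaleStages ++ ([(16, entryE 12), (17, keyPriceE 12 (.var 0))] ++
  [(1, .read 11 (.var 0)), (0, .read 17 (.var 0))])

theorem endVertex_lt {M : Store} {I : PricingInstance} (hM : Represents M I) {h : ℕ} (hh : h < 2 * M 0 1) :
    endVertex M h < M 0 0 := by
  rw [hM.m] at hh
  rw [hM.n, endVertex]
  have h2 := hM.src ⟨h / 2, by omega⟩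
  have h3 := hM.tgt ⟨h / 2, by omega⟩
  simp only at h2 h3
  split_ifs
  · rw [h2]; exact (I.src _).2
  · rw [h3]; exact (I.tgt _).2

theorem degreeTwo_spec {M : Store} {I : PricingInstance} (hM : Represents M I) (hd : ∀ v, I.degree v ≤ 2) :
    ∃ y : I.Fractions, Holds (staged degreeTwo M) (I.encodePrices y) ∧ I.IsApprox 1 y.price := by
  rw [degreeTwo, staged_append, staged_append]
  obtain ⟨hR, ⟨D, hD⟩, h12, -⟩ := scaleStages_spec hM
  generalize staged scaleStages M = S at *
  rw [← hR.m] at h12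
  refine exists_output ((hR.filled (by decide)).filled (by decide)) (D := D) (hD.congr ?_ ?_ ?_) (by decide)
    fun q hq => ?_
  · simp only [filled_of_ne (show (8 : ℕ) ≠ 16 by decide), filled_of_ne (show (8 : ℕ) ≠ 17 by decide)]
  · simp only [filled_of_ne (show (10 : ℕ) ≠ 16 by decide), filled_of_ne (show (10 : ℕ) ≠ 17 by decide)]
  · simp only [filled_of_ne (show (11 : ℕ) ≠ 16 by decide), filled_of_ne (show (11 : ℕ) ≠ 17 by decide)]
  · have key := keyRevenue_le_filled hR.large (a := 12) (by decide) (by decide) (fun e he => by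
      rw [hR.m] at he; exact (hD.2.2 ⟨e, he⟩).1) (fun h hh => by
        rw [rank_congr h12 hh]; exact rank_endVertex hR hd hh) (fun h hh => by
        rw [h12 h hh]; have := endVertex_lt hR hh; have := hR.large.vertices; omega) q hq
    rw [keyRevenue_congr h12 fun _ _ => rfl, keyRevenue_congr h12 fun _ _ => rfl] at key
    rw [one_mul]
    have e : ∀ a < 16, filled 17 (keyPriceE 12 (.var 0)) (filled 16 (entryE 12) S) a = S a := fun a ha => by
      rw [filled_of_ne (by omega), filled_of_ne (by omega)]
    have hv : endVertex (filled 17 (keyPriceE 12 (.var 0)) (filled 16 (entryE 12) S)) = endVertex S := by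
      funext h
      simp only [endVertex, e 2 (by decide), e 3 (by decide)]
    rw [hv, e 0 (by decide), e 10 (by decide)]
    exact key

/-! ## Graphs of maximum degree four -/

/-- The direction of the half-edge `h`. -/
def orientE (a : ℕ) (h : Ex) : Ex := alternateE a (.add h h)

theorem eval_orientE {s : Store} (hs : Large s) {ρ : List ℕ} {a : ℕ} {h : Ex}
    (hh : h.eval s ρ [] < 2 * s 0 1) : (orientE a h).eval s ρ [] = orient (s a) (s 0 1) (h.eval s ρ []) := by
  rw [orientE, eval_alternateE hs (by rw [eval]; omega), eval, ← two_mul]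
  rfl

def endKeyE : Ex := .add (.add (.read 12 (.var 0)) (.read 12 (.var 0))) (orientE 12 (.var 0))

def splitKeyE : Ex := .add (.add (.read 12 (.var 0)) (.read 12 (.var 0)))
  (mod2 (.add (orientE 12 (.var 0)) (orientE 13 (.var 0))))

/-- The revenue of the prices of the copies of colour `c`. -/
def colourRevenueE (c : Ex) : Ex := call1 (.sum numEdges
  (.ite (lt (.read 10 (.var 0)) (.add
      (.read 17 (.add (.add (.read 2 (.var 0)) (.read 2 (.var 0))) (.var 2)))
      (.read 17 (.add (.add (.read 3 (.var 0)) (.read 3 (.var 0))) (.var 2))))) (.const 0)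
    (.add (.read 17 (.add (.add (.read 2 (.var 0)) (.read 2 (.var 0))) (.var 2)))
      (.read 17 (.add (.add (.read 3 (.var 0)) (.read 3 (.var 0))) (.var 2)))))) c

theorem eval_colourRevenueE {s : Store} (hs : Large s) {ρ : List ℕ} (c : Ex) :
    ((colourRevenueE c).eval s ρ [] : ℝ) = keyRevenue (s 10) (endVertex s) (s 0 1)
      (fun v => s 17 (2 * v + c.eval s ρ [])) := by
  have := hs.edges
  rw [colourRevenueE, eval_call1, eval_sum (n := s 0 1) (f := fun e =>
    valN (s 10 e) (s 17 (2 * s 2 e + c.eval s ρ [])) (s 17 (2 * s 3 e + c.eval s ρ [])))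
    (by simp) (by omega), keyRevenue, Nat.cast_sum]
  · refine Finset.sum_congr rfl fun e _ => ?_
    rw [cast_valN]
    have h1 : (2 * e + 1) / 2 = e := by omega
    have h2 : (2 * e + 1) % 2 = 1 := by omega
    simp [endVertex, h1, h2]
  · intro j acc hj
    simp only [eval, eval_lt, ne_eq, not_not, List.getD_cons_zero, List.getD_cons_succ, valN, ← two_mul]
    split_ifs <;> omega

/-- The program for graphs of maximum degree four. -/
def degreeFour : List (ℕ × Ex) := scaleStages ++ ([(13, endKeyE), (14, splitKeyE), (16, entryE 14),
  (17, keyPriceE 14 (.var 0)), (18, argmaxE (.const 2) colourRevenueE),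
  (19, .read 17 (.add (.add (.var 0) (.var 0)) (.read 18 (.var 0))))] ++
  [(1, .read 11 (.var 0)), (0, .read 19 (.var 0))])

/-- The two colour classes together bring at least the revenue of the split graph. -/
theorem keyRevenue_split_le {w key skey : ℕ → ℕ} {m : ℕ} (h2 : ∀ h < 2 * m, skey h / 2 = key h)
    (ho : ∀ e < m, skey (2 * e + 1) % 2 = skey (2 * e) % 2) (P : ℕ → ℝ) (hP : ∀ k, 0 ≤ P k) :
    keyRevenue w skey m P ≤ keyRevenue w key m (fun v => P (2 * v + 0)) +
      keyRevenue w key m (fun v => P (2 * v + 1)) := by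
  unfold keyRevenue
  rw [← Finset.sum_add_distrib]
  refine Finset.sum_le_sum fun e he => ?_
  rw [Finset.mem_range] at he
  have e1 : skey (2 * e) = 2 * key (2 * e) + skey (2 * e) % 2 := by
    rw [← h2 _ (by omega)]; omega
  have e2 : skey (2 * e + 1) = 2 * key (2 * e + 1) + skey (2 * e) % 2 := by
    rw [← h2 _ (by omega), ← ho e he]; omega
  rw [e1, e2]
  have n0 := val_nonneg (w := w e) (hP (2 * key (2 * e) + 0)) (hP (2 * key (2 * e + 1) + 0))
  have n1 := val_nonneg (w := w e) (hP (2 * key (2 * e) + 1)) (hP (2 * key (2 * e + 1) + 1))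
  rcases Nat.mod_two_eq_zero_or_one (skey (2 * e)) with h | h <;> rw [h] <;> linarith

/-- Prices of the vertices, given to both of their copies, are prices of the split graph. Its
optimum is at most the sum of what the two colours' prices earn on the whole graph, hence at most
twice the better of the two. -/
theorem degreeFour_spec {M : Store} {I : PricingInstance} (hM : Represents M I) (hd : ∀ v, I.degree v ≤ 4) :
    ∃ y : I.Fractions, Holds (staged degreeFour M) (I.encodePrices y) ∧ I.IsApprox 2 y.price := by
  rw [degreeFour, staged_append, staged_append]
  obtain ⟨hR, ⟨D, hD⟩, h12, -⟩ := scaleStages_spec hM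
  generalize staged scaleStages M = S at *
  rw [← hR.m] at h12
  have hedge := hR.large.edges
  have hvert := hR.large.vertices
  simp only [staged]
  set S1 := filled 13 endKeyE S with hS1
  set S2 := filled 14 splitKeyE S1 with hS2
  set S3 := filled 17 (keyPriceE 14 (.var 0)) (filled 16 (entryE 14) S2) with hS3
  set S4 := filled 18 (argmaxE (.const 2) colourRevenueE) S3 with hS4
  set S5 := filled 19 (.read 17 (.add (.add (.var 0) (.var 0)) (.read 18 (.var 0)))) S4 with hS5
  have e1 : ∀ a < 13, S1 a = S a := fun a ha => filled_of_ne (by omega)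
  have e2 : ∀ a < 13, S2 a = S a := fun a ha => (filled_of_ne (by omega)).trans (e1 a ha)
  have e3 : ∀ a < 13, S3 a = S a := fun a ha =>
    ((filled_of_ne (by omega)).trans (filled_of_ne (by omega))).trans (e2 a ha)
  have e4 : ∀ a < 13, S4 a = S a := fun a ha => (filled_of_ne (by omega)).trans (e3 a ha)
  have e5 : ∀ a < 13, S5 a = S a := fun a ha => (filled_of_ne (by omega)).trans (e4 a ha)
  have rep : ∀ T : Store, (∀ a < 13, T a = S a) → Represents T I := fun T hT =>
    hR.congr (fun a ha => hT a (by omega)) (hT 8 (by decide))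
  have h13 : ∀ h < 2 * S 0 1, S1 13 h = endKey (S 12) (S 0 1) h := fun h hh => by
    refine filled_eq (by omega) fun M' hM' => ?_
    have hM'' := rep M' fun a ha => hM' a (by omega)
    rw [endKeyE, eval, eval_orientE hM''.large (by simpa [hM'] using hh)]
    simp [hM', endKey, two_mul]
  have h14 : ∀ h < 2 * S 0 1, S2 14 h = splitKey (S 12) (S1 13) (S 0 1) h := fun h hh => by
    refine filled_eq (by rw [e1 8 (by decide)]; omega) fun M' hM' => ?_
    have m0 : M' 0 = S 0 := (hM' 0 (by decide)).trans (e1 0 (by decide))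
    have m12 : M' 12 = S 12 := (hM' 12 (by decide)).trans (e1 12 (by decide))
    have m13 : M' 13 = S1 13 := hM' 13 (by decide)
    have hM'' := rep M' fun a ha => (hM' a (by omega)).trans (e1 a ha)
    have o (a : ℕ) : (orientE a (.var 0)).eval M' [h] [] = orient (M' a) (S 0 1) h := by
      rw [eval_orientE hM''.large (by simpa [m0] using hh), m0]; rfl
    simp [splitKeyE, o, m12, m13, splitKey, two_mul]
  have hkey : ∀ h < 2 * S 0 1, S2 14 h / 2 = S 12 h := fun h hh => by
    rw [h14 h hh, splitKey]; omega
  have hoth : ∀ e < S 0 1, S2 14 (2 * e + 1) % 2 = S2 14 (2 * e) % 2 := fun e he => by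
    rw [h14 _ (by omega), h14 _ (by omega), splitKey_other _ _ he]
  have hr14 : ∀ h < 2 * S 0 1, rank (S2 14) h < 2 := fun h hh => by
    rw [rank_congr h14 hh]
    exact rank_splitKey (fun h hh => by rw [rank_congr h12 hh]; exact rank_endVertex hR hd hh) h13 hh
  have hlt14 : ∀ h < 2 * S 0 1, S2 14 h < S 8 0 := fun h hh => by
    have := hkey h hh
    have := endVertex_lt hR hh
    rw [← h12 h hh] at this
    omega
  have hev : endVertex S3 = endVertex S := by
    funext h; simp only [endVertex, e3 2 (by decide), e3 3 (by decide)]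
  have hev5 : endVertex S5 = endVertex S := by
    funext h; simp only [endVertex, e5 2 (by decide), e5 3 (by decide)]
  -- the choice of the colour
  set R : ℕ → ℝ := fun c => keyRevenue (S 10) (endVertex S) (S 0 1) (fun v => S3 17 (2 * v + c)) with hRdef
  have hcol : ∃ c < 2, (∀ i < S 8 0, S4 18 i = c) ∧ ∀ c' < 2, R c' ≤ R c := by
    have hsp := argmax_spec (fun c => (colourRevenueE (.const c)).eval S3 [] []) two_pos
    have hval : ∀ (T : Store) (ρ : List ℕ) (c : Ex), (∀ a < 18, T a = S3 a) →
        ((colourRevenueE c).eval T ρ [] : ℝ) = R (c.eval T ρ []) := fun T ρ c hT => by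
      have hT' := rep T fun a ha => (hT a (by omega)).trans (e3 a ha)
      rw [eval_colourRevenueE hT'.large, hRdef]
      simp only [hT 17 (by decide), hT 10 (by decide), hT 0 (by decide), e3 10 (by decide), e3 0 (by decide)]
      congr 1
      funext h; simp only [endVertex, hT 2 (by decide), hT 3 (by decide), e3 2 (by decide), e3 3 (by decide)]
    refine ⟨_, hsp.1, fun i hi => ?_, fun c' hc' => ?_⟩
    · refine filled_eq (by rw [e3 8 (by decide)]; exact hi) fun M' hM' => ?_
      have hT : ∀ a < 18, M' a = S3 a := fun a ha => hM' a (by omega)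
      refine eval_argmaxE rfl (by rw [hT 8 (by decide), e3 8 (by decide)]; omega)
        (fun j acc _ _ => ?_) fun j acc _ _ => ?_ <;>
      · apply Nat.cast_injective (R := ℝ)
        rw [hval M' _ _ hT, hval S3 _ _ fun _ _ => rfl]
        rfl
    · have := hsp.2 c' hc'
      have hh : ((colourRevenueE (.const c')).eval S3 [] [] : ℝ) ≤ _ := Nat.cast_le.2 this
      rw [hval S3 _ _ fun _ _ => rfl, hval S3 _ _ fun _ _ => rfl] at hh
      exact hh
  obtain ⟨c, hc, h18, hmax⟩ := hcol
  have h19 : ∀ v < S 0 0, S5 19 v = S3 17 (2 * v + c) := fun v hv => by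
    refine filled_eq (by rw [e4 8 (by decide)]; omega) fun M' hM' => ?_
    have m17 : M' 17 = S3 17 := (hM' 17 (by decide)).trans (filled_of_ne (by decide))
    simp only [eval, m17, hM' 18 (by decide), List.getD_cons_zero, h18 v (by omega), ← two_mul]
  refine exists_output (rep S5 e5) (D := D) (hD.congr (e5 8 (by decide)) (e5 10 (by decide))
    (e5 11 (by decide))) (by decide) fun q hq => ?_
  rw [hev5, e5 0 (by decide), e5 10 (by decide)]
  have hfin : keyRevenue (S 10) (endVertex S) (S 0 1) (fun k => S5 19 k) = R c :=
    keyRevenue_congr (fun _ _ => rfl) fun h hh => by rw [h19 _ (endVertex_lt hR hh)]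
  rw [hfin]
  have k1 : keyRevenue (S 10) (endVertex S) (S 0 1) q = keyRevenue (S 10) (S2 14) (S 0 1) (fun k => q (k / 2)) := by
    refine Finset.sum_congr rfl fun e he => ?_
    rw [Finset.mem_range] at he
    simp only [hkey _ (show 2 * e < 2 * S 0 1 by omega), hkey _ (show 2 * e + 1 < 2 * S 0 1 by omega),
      h12 _ (show 2 * e < 2 * S 0 1 by omega), h12 _ (show 2 * e + 1 < 2 * S 0 1 by omega)]
  have k2 := keyRevenue_le_filled (rep S2 e2).large (a := 14) (by decide) (by decide) (fun e he => by
      rw [e2 0 (by decide), hR.m] at he; rw [e2 10 (by decide)]; exact (hD.2.2 ⟨e, he⟩).1)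
      (by rwa [e2 0 (by decide)]) (by rwa [e2 0 (by decide), e2 8 (by decide)])
      (fun k => q (k / 2)) (fun k => hq _)
  rw [e2 10 (by decide), e2 0 (by decide), ← k1] at k2
  have k3 := keyRevenue_split_le (w := S 10) (key := endVertex S) (skey := S2 14) (m := S 0 1)
    (fun h hh => by rw [hkey h hh, h12 h hh]) hoth (fun k => S3 17 k) (fun k => Nat.cast_nonneg _)
  have r0 := hmax 0 (by decide)
  have r1 := hmax 1 (by decide)
  change _ ≤ R 0 + R 1 at k3
  linarith

end Program

end GVP

/-! ## Cuts of graphs with a given colouring -/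

namespace GVP

open Finset

/-- The representative of the pair of the colour `i ≤ q` in round `r < q` of the perfect matchings
of the colours `0, …, q`. -/
def pairRep (q r i : ℕ) : ℕ :=
  if i < q then min i (if i ≤ r then r - i else r + q - i)
  else if r % 2 = 0 then r / 2 else (r + q) / 2

/-- The position of the colour `i` in its pair. -/
def pairFlip (q r i : ℕ) : ℕ := if pairRep q r i = i then 0 else 1

theorem pairRep_lt {q r i : ℕ} (hq : q % 2 = 1) (hr : r < q) : pairRep q r i < q := by
  unfold pairRep; split_ifs <;> omega

/-- The common representative is one of the two members of the pair, so exactly one of them has the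
flip `0`. -/
theorem pairFlip_ne {q r i j : ℕ} (hq : q % 2 = 1) (hr : r < q) (hi : i ≤ q) (hj : j ≤ q) (hij : i ≠ j)
    (h : pairRep q r i = pairRep q r j) : (pairFlip q r i + pairFlip q r j) % 2 = 1 := by
  unfold pairFlip pairRep at *
  split_ifs at * <;> omega

/-- The round-robin schedule: colours `i, j < q` meet in round `i + j` modulo `q`, and `i` meets the
extra colour `q` in round `2 * i` modulo `q`; oddness of `q` makes doubling invertible. -/
theorem exists_pairRep_eq {q i j : ℕ} (hq : q % 2 = 1) (hi : i ≤ q) (hj : j ≤ q) (hij : i ≠ j) :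
    ∃ r < q, pairRep q r i = pairRep q r j := by
  rcases hi.lt_or_eq with hi' | hi'
  · rcases hj.lt_or_eq with hj' | hj'
    · refine ⟨if i + j < q then i + j else i + j - q, by split_ifs <;> omega, ?_⟩
      unfold pairRep
      split_ifs <;> omega
    · refine ⟨if 2 * i < q then 2 * i else 2 * i - q, by split_ifs <;> omega, ?_⟩
      unfold pairRep
      split_ifs <;> omega
  · refine ⟨if 2 * j < q then 2 * j else 2 * j - q, by split_ifs <;> omega, ?_⟩
    unfold pairRep
    split_ifs <;> omega

/-- The weight of the edges inside of the pairs of round `r`; `c e` and `d e` are the colours of the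
ends of `e`. -/
def roundWeight (g c d : ℕ → ℕ) (m q r : ℕ) : ℕ :=
  ∑ e ∈ range m, if pairRep q r (c e) = pairRep q r (d e) then g e else 0

/-- The ends of an edge have different colours, which meet in some round. So the `q` rounds together
cover all the weight, and the heaviest has at least a fraction `1 / q` of it. -/
theorem sum_le_roundWeight {g c d : ℕ → ℕ} {m q r : ℕ} (hq : q % 2 = 1) (hc : ∀ e < m, c e ≤ q)
    (hd : ∀ e < m, d e ≤ q) (hcd : ∀ e < m, c e ≠ d e)
    (hr : ∀ r' < q, roundWeight g c d m q r' ≤ roundWeight g c d m q r) :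
    ∑ e ∈ range m, g e ≤ q * roundWeight g c d m q r := by
  calc ∑ e ∈ range m, g e ≤ ∑ e ∈ range m, ∑ r' ∈ range q,
        if pairRep q r' (c e) = pairRep q r' (d e) then g e else 0 := by
        refine sum_le_sum fun e he => ?_
        rw [mem_range] at he
        obtain ⟨r', hr', h⟩ := exists_pairRep_eq hq (hc e he) (hd e he) (hcd e he)
        calc g e = if pairRep q r' (c e) = pairRep q r' (d e) then g e else 0 := (if_pos h).symm
          _ ≤ _ := single_le_sum (f := fun r' => if pairRep q r' (c e) = pairRep q r' (d e) then g e else 0)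
            (fun _ _ => Nat.zero_le _) (mem_range.2 hr')
    _ = ∑ r' ∈ range q, roundWeight g c d m q r' := sum_comm
    _ ≤ ∑ r' ∈ range q, roundWeight g c d m q r := sum_le_sum fun r' hr' => hr r' (mem_range.1 hr')
    _ = _ := by simp

/-- The weight of the edges `e` whose larger end is `i`. -/
def stepAll (g a b : ℕ → ℕ) (m i : ℕ) : ℕ :=
  ∑ e ∈ range m, if a e ≠ b e ∧ max (a e) (b e) = i then g e else 0

/-- The weight of those among them that are satisfied if `i` gets the value `0`. -/
def stepZero (g a b f x : ℕ → ℕ) (m i : ℕ) : ℕ :=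
  ∑ e ∈ range m, if a e ≠ b e ∧ max (a e) (b e) = i then g e * ((x (min (a e) (b e)) + f e) % 2) else 0

/-- A greedy assignment satisfies half of the parity constraints. -/
theorem sum_le_of_greedy {g a b f x : ℕ → ℕ} {m B : ℕ} (ha : ∀ e < m, a e < B) (hb : ∀ e < m, b e < B)
    (hx : ∀ i < B, x i = if 2 * stepZero g a b f x m i < stepAll g a b m i then 1 else 0) :
    (∑ e ∈ range m, if a e ≠ b e then g e else 0) ≤
      2 * ∑ e ∈ range m, if a e ≠ b e then g e * ((x (a e) + x (b e) + f e) % 2) else 0 := by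
  -- Each edge is charged to its larger end, the later of the two to receive a value.
  have fib : ∀ G : ℕ → ℕ, (∑ e ∈ range m, if a e ≠ b e then G e else 0) =
      ∑ i ∈ range B, ∑ e ∈ range m, if a e ≠ b e ∧ max (a e) (b e) = i then G e else 0 := by
    intro G
    rw [sum_comm]
    refine sum_congr rfl fun e he => ?_
    rw [mem_range] at he
    by_cases h : a e = b e
    · simp [h]
    · rw [if_pos h, sum_eq_single (max (a e) (b e))]
      · rw [if_pos ⟨h, rfl⟩]
      · exact fun i _ hi => if_neg fun h' => hi h'.2.symm
      · intro h'
        exact absurd (mem_range.2 (max_lt (ha e he) (hb e he))) h'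
  rw [fib g, fib fun e => g e * ((x (a e) + x (b e) + f e) % 2), mul_sum]
  refine sum_le_sum fun i hi => ?_
  have hxi := hx i (mem_range.1 hi)
  change stepAll g a b m i ≤ _
  have hsplit : ∀ e, a e ≠ b e ∧ max (a e) (b e) = i → x (a e) + x (b e) = x (min (a e) (b e)) + x i := by
    rintro e ⟨-, rfl⟩
    rcases le_total (a e) (b e) with h | h
    · rw [min_eq_left h, max_eq_right h]
    · rw [min_eq_right h, max_eq_left h, add_comm]
  -- Of the edges charged to `i`, the value `1` satisfies exactly those that `0` does not, so the
  -- better value satisfies half of their weight.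
  by_cases hlt : 2 * stepZero g a b f x m i < stepAll g a b m i
  · rw [if_pos hlt] at hxi
    have : stepZero g a b f x m i + (∑ e ∈ range m, if a e ≠ b e ∧ max (a e) (b e) = i then
        g e * ((x (a e) + x (b e) + f e) % 2) else 0) = stepAll g a b m i := by
      rw [stepZero, stepAll, ← sum_add_distrib]
      refine sum_congr rfl fun e _ => ?_
      split_ifs with h
      · rw [hsplit e h, hxi, ← mul_add]
        have : (x (min (a e) (b e)) + f e) % 2 + (x (min (a e) (b e)) + 1 + f e) % 2 = 1 := by omega
        rw [this, mul_one]
      · rfl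
    omega
  · rw [if_neg hlt] at hxi
    have : stepZero g a b f x m i = ∑ e ∈ range m, if a e ≠ b e ∧ max (a e) (b e) = i then
        g e * ((x (a e) + x (b e) + f e) % 2) else 0 := by
      refine sum_congr rfl fun e _ => ?_
      split_ifs with h
      · rw [hsplit e h, hxi, add_zero]
      · rfl
    omega

/-- The weight of the edges cut by the greedy assignment for the best round. -/
theorem sum_le_cut {g c d x : ℕ → ℕ} {m q r : ℕ} (hq : q % 2 = 1) (hrq : r < q) (hc : ∀ e < m, c e ≤ q)
    (hd : ∀ e < m, d e ≤ q) (hcd : ∀ e < m, c e ≠ d e)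
    (hr : ∀ r' < q, roundWeight g c d m q r' ≤ roundWeight g c d m q r)
    (hx : ∀ i < q, x i = if 2 * stepZero g (fun e => pairRep q r (c e)) (fun e => pairRep q r (d e))
      (fun e => pairFlip q r (c e) + pairFlip q r (d e)) x m i <
      stepAll g (fun e => pairRep q r (c e)) (fun e => pairRep q r (d e)) m i then 1 else 0) :
    (q + 1) * ∑ e ∈ range m, g e ≤ 2 * q * ∑ e ∈ range m,
      if (x (pairRep q r (c e)) + pairFlip q r (c e)) % 2 ≠ (x (pairRep q r (d e)) + pairFlip q r (d e)) % 2
        then g e else 0 := by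
  have h1 := sum_le_roundWeight hq hc hd hcd hr
  have h2 := sum_le_of_greedy (fun e _ => pairRep_lt hq hrq) (fun e _ => pairRep_lt hq hrq) hx
  have h3 : ∑ e ∈ range m, g e = roundWeight g c d m q r +
      ∑ e ∈ range m, if pairRep q r (c e) ≠ pairRep q r (d e) then g e else 0 := by
    rw [roundWeight, ← sum_add_distrib]
    refine sum_congr rfl fun e _ => ?_
    by_cases h : pairRep q r (c e) = pairRep q r (d e) <;> simp [h]
  -- Edges inside a pair are always cut because the flips of their ends differ. For the others,
  -- being cut is the parity constraint of the greedy assignment.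
  have h4 : roundWeight g c d m q r + (∑ e ∈ range m, if pairRep q r (c e) ≠ pairRep q r (d e) then
      g e * ((x (pairRep q r (c e)) + x (pairRep q r (d e)) +
        (pairFlip q r (c e) + pairFlip q r (d e))) % 2) else 0) ≤ ∑ e ∈ range m,
      if (x (pairRep q r (c e)) + pairFlip q r (c e)) % 2 ≠ (x (pairRep q r (d e)) + pairFlip q r (d e)) % 2
        then g e else 0 := by
    rw [roundWeight, ← sum_add_distrib]
    refine sum_le_sum fun e he => ?_
    rw [mem_range] at he
    by_cases h : pairRep q r (c e) = pairRep q r (d e)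
    · have := pairFlip_ne hq hrq (hc e he) (hd e he) (hcd e he) h
      rw [if_pos h, if_neg (not_not.2 h), h, if_pos (by omega), add_zero]
    · rw [if_neg h, if_pos h, zero_add]
      split_ifs with h'
      · exact mul_le_of_le_one_right (Nat.zero_le _) (by omega)
      · have : (x (pairRep q r (c e)) + x (pairRep q r (d e)) +
          (pairFlip q r (c e) + pairFlip q r (d e))) % 2 = 0 := by omega
        rw [this, mul_zero]
  generalize (∑ e ∈ range m, if (x (pairRep q r (c e)) + pairFlip q r (c e)) % 2 ≠
    (x (pairRep q r (d e)) + pairFlip q r (d e)) % 2 then g e else 0) = C at *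
  -- With total weight `W` and weight `R` inside the pairs, the cut is at least `R + (W - R) / 2`;
  -- the claim follows with `W ≤ q * R`.
  have h5 : roundWeight g c d m q r + ∑ e ∈ range m, g e ≤ 2 * C := by omega
  have := Nat.mul_le_mul_left q h5
  linarith

/-! ## Prices of single vertices -/

/-- The revenue from the half-edges at `v` if `v` has the price `x` and its neighbours are free. -/
def objective (w key : ℕ → ℕ) (m v x : ℕ) : ℕ :=
  ∑ h ∈ range (2 * m), if key h = v then valN (w (h / 2)) x 0 else 0

/-- The best price of `v` if its neighbours are free. -/
def bestPrice (w key : ℕ → ℕ) (m v : ℕ) : ℕ := w (RAM.argmax (fun e => objective w key m v (w e)) m)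

/-- The revenue from the half-edge `h` for the prices `p` if the other end is free. -/
def gain (w key p : ℕ → ℕ) (h : ℕ) : ℕ := valN (w (h / 2)) (p (key h)) 0

theorem sum_range_two_mul {R : Type*} [AddCommMonoid R] (A : ℕ → R) (m : ℕ) :
    ∑ h ∈ range (2 * m), A h = ∑ e ∈ range m, (A (2 * e) + A (2 * e + 1)) := by
  induction m with
  | zero => simp
  | succ m ih => rw [mul_add, sum_range_succ, sum_range_succ, ih, sum_range_succ, add_assoc]

/-- Raising `x` to the smallest budget not below it among the edges at `v` loses no buyer, so
budgets are the only prices to try. -/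
theorem objective_le_bestPrice (w key : ℕ → ℕ) (m v : ℕ) (x : ℝ) :
    (∑ h ∈ range (2 * m), if key h = v then val (w (h / 2)) x 0 else 0) ≤
      objective w key m v (bestPrice w key m v) := by
  by_cases hex : ∃ h ∈ range (2 * m), key h = v ∧ x ≤ w (h / 2)
  · have hne : ((range (2 * m)).filter fun h => key h = v ∧ x ≤ w (h / 2)).Nonempty := by
      obtain ⟨h, h1, h2⟩ := hex
      exact ⟨h, mem_filter.2 ⟨h1, h2⟩⟩
    obtain ⟨h0, hh0, hmin⟩ := exists_min_image _ (fun h => w (h / 2)) hne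
    obtain ⟨h0m, -, hx0⟩ := mem_filter.1 hh0
    have h0m' : h0 / 2 < m := by rw [mem_range] at h0m; omega
    have hb : objective w key m v (w (h0 / 2)) ≤ objective w key m v (bestPrice w key m v) :=
      (RAM.argmax_spec (fun e => objective w key m v (w e)) (Nat.zero_lt_of_lt h0m')).2 _ h0m'
    refine le_trans ?_ (Nat.cast_le.2 hb)
    rw [objective, Nat.cast_sum]
    refine sum_le_sum fun h hh => ?_
    split_ifs with hk
    · rw [cast_valN]
      unfold val
      by_cases hxh : x ≤ w (h / 2)
      · have : (w (h0 / 2) : ℝ) ≤ w (h / 2) := Nat.cast_le.2 (hmin h (mem_filter.2 ⟨hh, hk, hxh⟩))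
        simp only [Nat.cast_zero, add_zero]
        rw [if_pos hxh, if_pos this]
        exact hx0
      · rw [add_zero, if_neg hxh]
        split_ifs <;> positivity
    · simp
  · push Not at hex
    refine (Finset.sum_nonpos fun h hh => ?_).trans (Nat.cast_nonneg _)
    split_ifs with hk
    · unfold val
      rw [add_zero, if_neg (not_le.2 (hex h hh hk))]
    · exact le_rfl

theorem val_le_add {w a b : ℝ} (ha : 0 ≤ a) (hb : 0 ≤ b) : val w a b ≤ val w a 0 + val w 0 b := by
  unfold val
  split_ifs <;> linarith

/-- The gains bound every revenue. -/
theorem keyRevenue_le_gain {w key : ℕ → ℕ} {m n : ℕ} (hkey : ∀ h < 2 * m, key h < n) {q : ℕ → ℝ}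
    (hq : ∀ k, 0 ≤ q k) : keyRevenue w key m q ≤
      (∑ e ∈ range m, (gain w key (bestPrice w key m) (2 * e) + gain w key (bestPrice w key m) (2 * e + 1)) : ℕ) := by
  have fib : ∀ F : ℕ → ℕ → ℝ, ∑ h ∈ range (2 * m), F h (key h) =
      ∑ v ∈ range n, ∑ h ∈ range (2 * m), if key h = v then F h v else 0 := by
    intro F
    rw [sum_comm]
    refine sum_congr rfl fun h hh => ?_
    rw [mem_range] at hh
    rw [sum_ite_eq, if_pos (mem_range.2 (hkey h hh))]
  calc keyRevenue w key m q ≤ ∑ h ∈ range (2 * m), val (w (h / 2)) (q (key h)) 0 := by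
        rw [sum_range_two_mul, keyRevenue]
        refine sum_le_sum fun e _ => ?_
        have e1 : 2 * e / 2 = e := by omega
        have e2 : (2 * e + 1) / 2 = e := by omega
        rw [e1, e2, val_comm _ (q (key (2 * e + 1))) 0]
        exact val_le_add (hq _) (hq _)
    _ = ∑ v ∈ range n, ∑ h ∈ range (2 * m), if key h = v then val (w (h / 2)) (q v) 0 else 0 :=
        fib fun h v => val (w (h / 2)) (q v) 0
    _ ≤ ∑ v ∈ range n, (objective w key m v (bestPrice w key m v) : ℝ) :=
        sum_le_sum fun v _ => objective_le_bestPrice w key m v (q v)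
    _ = ∑ v ∈ range n, ∑ h ∈ range (2 * m),
          if key h = v then (valN (w (h / 2)) (bestPrice w key m v) 0 : ℝ) else 0 := by
        simp only [objective, Nat.cast_sum, Nat.cast_ite, Nat.cast_zero]
    _ = ∑ h ∈ range (2 * m), (gain w key (bestPrice w key m) h : ℝ) :=
        (fib fun h v => (valN (w (h / 2)) (bestPrice w key m v) 0 : ℝ)).symm
    _ = _ := by rw [← sum_range_two_mul, Nat.cast_sum]

/-- The weight of the directed cut from the side `b` to the other one. -/
def cutGain (g side key : ℕ → ℕ) (m b : ℕ) : ℕ :=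
  ∑ e ∈ range m, ((if side (key (2 * e)) = b ∧ side (key (2 * e + 1)) ≠ b then g (2 * e) else 0) +
    if side (key (2 * e + 1)) = b ∧ side (key (2 * e)) ≠ b then g (2 * e + 1) else 0)

/-- An edge from side `b` to the free side pays exactly the gain of its end on side `b`; all other
edges contribute at least zero. -/
theorem cutGain_le_keyRevenue (w key p side : ℕ → ℕ) (m b : ℕ) :
    (cutGain (gain w key p) side key m b : ℝ) ≤
      keyRevenue w key m (fun v => ((if side v = b then p v else 0 : ℕ) : ℝ)) := by
  rw [cutGain, keyRevenue, Nat.cast_sum]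
  refine sum_le_sum fun e _ => ?_
  have e1 : 2 * e / 2 = e := by omega
  have e2 : (2 * e + 1) / 2 = e := by omega
  rw [← cast_valN]
  refine Nat.cast_le.2 ?_
  simp only [gain, e1, e2, valN]
  by_cases h1 : side (key (2 * e)) = b <;> by_cases h2 : side (key (2 * e + 1)) = b <;> simp [h1, h2]

/-- An edge of the cut gives the gain of one end to each of the two directed cuts. -/
theorem cut_le_cutGain {g side key : ℕ → ℕ} {m : ℕ} (hs : ∀ v, side v < 2) :
    (∑ e ∈ range m, if side (key (2 * e)) ≠ side (key (2 * e + 1)) then g (2 * e) + g (2 * e + 1) else 0) ≤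
      cutGain g side key m 0 + cutGain g side key m 1 := by
  rw [cutGain, cutGain, ← sum_add_distrib]
  refine sum_le_sum fun e _ => ?_
  have h1 := hs (key (2 * e))
  have h2 := hs (key (2 * e + 1))
  interval_cases side (key (2 * e)) <;> interval_cases side (key (2 * e + 1)) <;> simp [add_comm]

end GVP

/-! ## Graphs with a given colouring -/

namespace RAM

theorem staged_of_ne {l : List (ℕ × Ex)} {a : ℕ} (h : ∀ p ∈ l, p.1 ≠ a) (M : Store) :
    staged l M a = M a := by
  induction l generalizing M with
  | nil => rfl
  | cons p l ih =>
    rw [staged, ih fun p' hp' => h p' (by simp [hp']), filled_of_ne (h p (by simp)).symm]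

/-- An entry computed by stages that use increasing arrays. -/
theorem staged_eq {l : List (ℕ × Ex)} (hl : l.Pairwise fun p p' => p.1 < p'.1) (h8 : ∀ p ∈ l, 8 < p.1)
    {a : ℕ} {e : Ex} (hp : (a, e) ∈ l) {M : Store} {i : ℕ} (hi : i < M 8 0) :
    ∃ M' : Store, (∀ a' < a, M' a' = staged l M a') ∧ (∀ j < i, M' a j = staged l M a j) ∧
      staged l M a i = e.eval M' [i] [] := by
  induction l generalizing M with
  | nil => simp at hp
  | cons p l ih =>
    rw [List.pairwise_cons] at hl
    rcases List.mem_cons.1 hp with rfl | hp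
    · obtain ⟨M', h1, h2, h3⟩ := filled_rec (a := a) (e := e) hi
      have hs : ∀ a' ≤ a, staged l (filled a e M) a' = filled a e M a' := fun a' ha' =>
        staged_of_ne (fun p' hp' => by have := hl.1 p' hp'; simp only at this; omega) _
      refine ⟨M', fun a' ha' => ?_, fun j hj => ?_, ?_⟩
      · rw [staged, hs a' (by omega), filled_of_ne (by omega), h1 a' (by omega)]
      · rw [staged, hs a le_rfl, h2 j hj]
      · rw [staged, hs a le_rfl, h3]
    · refine ih hl.2 (fun p' hp' => h8 p' (by simp [hp'])) hp ?_
      have := h8 p (by simp)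
      rwa [filled_of_ne (by omega)]

end RAM

namespace GVP

open RAM

/-- The number of rounds for `K` colours. -/
def rounds (K : ℕ) : ℕ := (K - 1) / 2 * 2 + 1

namespace Program

open RAM.Ex

def numVertices : Ex := .read 0 (.const 0)
def numColours : Ex := .read 6 (.const 0)

def roundsE : Ex :=
  .add (.add (.half (.sub (.ite (lt numVertices numColours) numVertices numColours) (.const 1)))
    (.half (.sub (.ite (lt numVertices numColours) numVertices numColours) (.const 1)))) (.const 1)

theorem eval_roundsE {s : Store} {ρ st : List ℕ} :
    roundsE.eval s ρ st = rounds (min (s 6 0) (s 0 0)) := by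
  have h : (Ex.ite (lt numVertices numColours) numVertices numColours).eval s ρ [] = min (s 6 0) (s 0 0) := by
    simp only [eval, eval_lt, numVertices, numColours, ne_eq, not_not]
    split_ifs <;> omega
  have h' : (Ex.half (.sub (.ite (lt numVertices numColours) numVertices numColours) (.const 1))).eval s ρ [] =
      (min (s 6 0) (s 0 0) - 1) / 2 := by
    rw [eval, eval, h, eval]
  have h1 : ∀ x y : Ex, (Ex.add x y).eval s ρ [] = x.eval s ρ [] + y.eval s ρ [] := fun _ _ => rfl
  rw [roundsE, eval, h1, h', eval, rounds]
  omega

def minE (x y : Ex) : Ex := .ite (lt x y) x y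
def maxE (x y : Ex) : Ex := .ite (lt x y) y x

@[simp] theorem eval_minE {s : Store} {ρ : List ℕ} (x y : Ex) :
    (minE x y).eval s ρ [] = min (x.eval s ρ []) (y.eval s ρ []) := by
  simp only [minE, eval, eval_lt, ne_eq, not_not]; split_ifs <;> omega

@[simp] theorem eval_maxE {s : Store} {ρ : List ℕ} (x y : Ex) :
    (maxE x y).eval s ρ [] = max (x.eval s ρ []) (y.eval s ρ []) := by
  simp only [maxE, eval, eval_lt, ne_eq, not_not]; split_ifs <;> omega

def pairRepE (r i : Ex) : Ex := call2 (.ite (lt (.var 1) roundsE)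
  (minE (.var 1) (.ite (lt (.var 0) (.var 1)) (.sub (.add (.var 0) roundsE) (.var 1)) (.sub (.var 0) (.var 1))))
  (.ite (mod2 (.var 0)) (.half (.add (.var 0) roundsE)) (.half (.var 0)))) r i

theorem eval_pairRepE {s : Store} {ρ : List ℕ} (r i : Ex) : (pairRepE r i).eval s ρ [] =
    pairRep (rounds (min (s 6 0) (s 0 0))) (r.eval s ρ []) (i.eval s ρ []) := by
  rw [pairRepE, eval_call2]
  simp only [eval, eval_lt, eval_minE, eval_mod2, eval_roundsE, List.getD_cons_zero, List.getD_cons_succ,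
    ne_eq, not_not, pairRep]
  split_ifs <;> omega

/-- The number of classes is given in binary and may be exponential in the input length. If it
exceeds the number of vertices, every vertex becomes a class of its own, which keeps the number of
rounds small. -/
def colourE : Ex := .ite (lt numVertices numColours) (.var 0) (.read 7 (.var 0))

def objectiveE (v x : Ex) : Ex := call2 (.sum half2 (.ite (eq (.read 12 (.var 0)) (.var 2))
  (.ite (lt (.read 10 (.half (.var 0))) (.var 3)) (.const 0) (.var 3)) (.const 0))) v x

def bestPriceE : Ex := .read 10 (argmaxE numEdges fun e => objectiveE (.var 2) (.read 10 e))

def gainE : Ex := .ite (lt (.read 10 (.half (.var 0))) (.read 14 (.read 12 (.var 0)))) (.const 0)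
  (.read 14 (.read 12 (.var 0)))

def firstHalf : Ex := .add (.var 0) (.var 0)
def secondHalf : Ex := .add firstHalf (.const 1)
def gainSumE : Ex := .add (.read 15 firstHalf) (.read 15 secondHalf)

def roundWeightE : Ex := .sum numEdges (.ite (eq (pairRepE (.var 2) (.read 13 (.read 12 firstHalf)))
  (pairRepE (.var 2) (.read 13 (.read 12 secondHalf)))) gainSumE (.const 0))

def bestRoundE : Ex := argmaxE roundsE fun r => .read 16 r

def repE : Ex := pairRepE (.read 17 (.var 0)) (.read 13 (.var 0))

def pairFlipE : Ex := .ite (eq (.read 18 (.var 0)) (.read 13 (.var 0))) (.const 0) (.const 1)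

def repOf (h : Ex) : Ex := .read 18 (.read 12 h)
def flipOf (h : Ex) : Ex := .read 19 (.read 12 h)

def lastStepE : Ex := and (not (eq (repOf firstHalf) (repOf secondHalf)))
  (eq (maxE (repOf firstHalf) (repOf secondHalf)) (.var 2))

def stepAllE : Ex := .sum numEdges (.ite lastStepE gainSumE (.const 0))

def stepZeroE : Ex := .sum numEdges (.ite lastStepE
  (.ite (mod2 (.add (.read 20 (minE (repOf firstHalf) (repOf secondHalf)))
    (.add (flipOf firstHalf) (flipOf secondHalf)))) gainSumE (.const 0)) (.const 0))

def greedyE : Ex := .ite (lt (.add stepZeroE stepZeroE) stepAllE) (.const 1) (.const 0)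

def sideE : Ex := mod2 (.add (.read 20 (.read 18 (.var 0))) (.read 19 (.var 0)))

def sideOf (h : Ex) : Ex := .read 21 (.read 12 h)

def cutGainE : Ex := .sum numEdges (.add
  (.ite (and (eq (sideOf firstHalf) (.var 2)) (not (eq (sideOf secondHalf) (.var 2))))
    (.read 15 firstHalf) (.const 0))
  (.ite (and (eq (sideOf secondHalf) (.var 2)) (not (eq (sideOf firstHalf) (.var 2))))
    (.read 15 secondHalf) (.const 0)))

def bestSideE : Ex := argmaxE (.const 2) fun b => .read 22 b

def finalPriceE : Ex := .ite (eq (.read 21 (.var 0)) (.read 23 (.var 0))) (.read 14 (.var 0)) (.const 0)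

/-- Each stage reads only arrays with smaller numbers, except that `greedyE` also reads its own
earlier entries. -/
def partiteStages : List (ℕ × Ex) := [(13, colourE), (14, bestPriceE), (15, gainE), (16, roundWeightE),
  (17, bestRoundE), (18, repE), (19, pairFlipE), (20, greedyE), (21, sideE), (22, cutGainE),
  (23, bestSideE), (24, finalPriceE)]

/-- The program for graphs with a given colouring. -/
def partite : List (ℕ × Ex) := scaleStages ++ (partiteStages ++
  [(1, .read 11 (.var 0)), (0, .read 24 (.var 0))])

theorem partiteStages_eq {a : ℕ} {e : Ex} (hp : (a, e) ∈ partiteStages) {M : Store} {i : ℕ}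
    (hi : i < M 8 0) : ∃ M' : Store, (∀ a' < a, M' a' = staged partiteStages M a') ∧
      (∀ j < i, M' a j = staged partiteStages M a j) ∧ staged partiteStages M a i = e.eval M' [i] [] := by
  refine staged_eq ?_ ?_ hp hi
  · simp [partiteStages]
  · simp [partiteStages]

@[simp] theorem eval_firstHalf {s : Store} {ρ st : List ℕ} {e : ℕ} :
    firstHalf.eval s (e :: ρ) st = 2 * e := by simp [firstHalf, two_mul]

@[simp] theorem eval_secondHalf {s : Store} {ρ st : List ℕ} {e : ℕ} :
    secondHalf.eval s (e :: ρ) st = 2 * e + 1 := by simp [secondHalf]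

theorem eval_objectiveE {s : Store} (hs : Large s) {ρ : List ℕ} (v x : Ex) :
    (objectiveE v x).eval s ρ [] = objective (s 10) (s 12) (s 0 1) (v.eval s ρ []) (x.eval s ρ []) := by
  have := hs.edges
  rw [objectiveE, eval_call2, objective]
  refine eval_sum (by simp) (by omega) fun j acc hj => ?_
  simp only [eval, eval_eq, eval_lt, List.getD_cons_zero, List.getD_cons_succ, ne_eq, not_not, valN, add_zero]
  split_ifs <;> omega

theorem eval_greedyE {s : Store} {m i : ℕ} {g a b f f' x : ℕ → ℕ} (hm : s 0 1 = m) (h8 : m ≤ s 8 0)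
    (hg : ∀ e < m, ∀ ρ, gainSumE.eval s (e :: ρ) [] = g e)
    (ha : ∀ e < m, ∀ ρ, (repOf firstHalf).eval s (e :: ρ) [] = a e)
    (hb : ∀ e < m, ∀ ρ, (repOf secondHalf).eval s (e :: ρ) [] = b e)
    (hf : ∀ e < m, ∀ ρ, (flipOf firstHalf).eval s (e :: ρ) [] = f e)
    (hf' : ∀ e < m, ∀ ρ, (flipOf secondHalf).eval s (e :: ρ) [] = f' e)
    (hx : ∀ j < i, s 20 j = x j) : greedyE.eval s [i] [] =
      if 2 * stepZero g a b (fun e => f e + f' e) x m i < stepAll g a b m i then 1 else 0 := by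
  have hlast : ∀ e < m, ∀ acc, lastStepE.eval s [e, acc, i] [] = 0 ↔
      ¬ (a e ≠ b e ∧ max (a e) (b e) = i) := by
    intro e he acc
    simp only [lastStepE, eval_and, eval_not, eval_eq, eval_maxE, ha e he, hb e he, eval,
      List.getD_cons_zero, List.getD_cons_succ, ne_eq, not_not]
  have hall : stepAllE.eval s [i] [] = stepAll g a b m i := by
    refine eval_sum (by simp [hm]) h8 fun e acc he => ?_
    rw [eval, hg e he]
    simp only [hlast e he, ne_eq, not_not, eval]
  have hzero : stepZeroE.eval s [i] [] = stepZero g a b (fun e => f e + f' e) x m i := by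
    refine eval_sum (by simp [hm]) h8 fun e acc he => ?_
    rw [eval]
    by_cases h : a e ≠ b e ∧ max (a e) (b e) = i
    · rw [if_pos (mt (hlast e he acc).1 (not_not.2 h)), if_pos h, eval, hg e he]
      simp only [eval_mod2, eval, eval_minE, ha e he, hb e he, hf e he, hf' e he]
      -- The ends differ and the larger is `i`, so the smaller one already has its value.
      rw [hx _ (by omega)]
      rcases Nat.mod_two_eq_zero_or_one (x (min (a e) (b e)) + (f e + f' e)) with h0 | h0 <;> simp [h0]
    · rw [if_neg (not_not.2 ((hlast e he acc).2 h)), if_neg h, eval]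
  rw [greedyE, eval]
  simp only [eval_lt, eval, hall, hzero, ne_eq, not_not, ← two_mul]

theorem eval_cutGainE {s : Store} {m b : ℕ} {G side key : ℕ → ℕ} (hm : s 0 1 = m) (h8 : m ≤ s 8 0)
    (hk : s 12 = key) (hs : ∀ h < 2 * m, s 21 (key h) = side (key h)) (hG : ∀ h < 2 * m, s 15 h = G h) :
    cutGainE.eval s [b] [] = cutGain G side key m b := by
  refine eval_sum (by simp [hm]) h8 fun e acc he => ?_
  have s1 : (sideOf firstHalf).eval s [e, acc, b] [] = side (key (2 * e)) := by
    simp only [sideOf, eval, eval_firstHalf, hk]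
    exact hs _ (by omega)
  have s2 : (sideOf secondHalf).eval s [e, acc, b] [] = side (key (2 * e + 1)) := by
    simp only [sideOf, eval, eval_secondHalf, hk]
    exact hs _ (by omega)
  simp only [eval, eval_and, eval_not, eval_eq, s1, s2, eval_firstHalf, eval_secondHalf,
    hG _ (show 2 * e < 2 * m by omega), hG _ (show 2 * e + 1 < 2 * m by omega),
    List.getD_cons_zero, List.getD_cons_succ, ne_eq, not_not]

/-- The approximation factor of the greedy cut. -/
theorem keyRevenue_le_cut {w key col side x : ℕ → ℕ} {m n q r : ℕ} {Q : ℕ → ℝ} (hQ : ∀ k, 0 ≤ Q k)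
    (hkey : ∀ h < 2 * m, key h < n) (hq : q % 2 = 1) (hr : r < q) (hcol : ∀ v < n, col v ≤ q)
    (hcd : ∀ e < m, col (key (2 * e)) ≠ col (key (2 * e + 1)))
    (hmax : ∀ r' < q, roundWeight (fun e => gain w key (bestPrice w key m) (2 * e) +
        gain w key (bestPrice w key m) (2 * e + 1)) (fun e => col (key (2 * e)))
        (fun e => col (key (2 * e + 1))) m q r' ≤
      roundWeight (fun e => gain w key (bestPrice w key m) (2 * e) +
        gain w key (bestPrice w key m) (2 * e + 1)) (fun e => col (key (2 * e)))
        (fun e => col (key (2 * e + 1))) m q r)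
    (hx : ∀ i < q, x i = if 2 * stepZero (fun e => gain w key (bestPrice w key m) (2 * e) +
        gain w key (bestPrice w key m) (2 * e + 1)) (fun e => pairRep q r (col (key (2 * e))))
        (fun e => pairRep q r (col (key (2 * e + 1))))
        (fun e => pairFlip q r (col (key (2 * e))) + pairFlip q r (col (key (2 * e + 1)))) x m i <
      stepAll (fun e => gain w key (bestPrice w key m) (2 * e) +
        gain w key (bestPrice w key m) (2 * e + 1)) (fun e => pairRep q r (col (key (2 * e))))
        (fun e => pairRep q r (col (key (2 * e + 1)))) m i then 1 else 0)
    (hside : ∀ v, side v = (x (pairRep q r (col v)) + pairFlip q r (col v)) % 2) {b : ℕ}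
    (hb : ∀ b' < 2, cutGain (gain w key (bestPrice w key m)) side key m b' ≤
      cutGain (gain w key (bestPrice w key m)) side key m b) :
    keyRevenue w key m Q ≤ 4 * (q : ℝ) / (q + 1) * keyRevenue w key m
      (fun v => ((if side v = b then bestPrice w key m v else 0 : ℕ) : ℝ)) := by
  have k1 := keyRevenue_le_gain (w := w) hkey hQ
  have k2 := sum_le_cut hq hr (fun e he => hcol _ (hkey _ (by omega)))
    (fun e he => hcol _ (hkey _ (by omega))) hcd hmax hx
  have k3 := cut_le_cutGain (g := gain w key (bestPrice w key m)) (key := key) (m := m) (side := side)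
    fun v => by rw [hside]; exact Nat.mod_lt _ two_pos
  have k4 := cutGain_le_keyRevenue w key (bestPrice w key m) side m b
  have k5 := hb 0 (by decide)
  have k6 := hb 1 (by decide)
  simp only [← hside] at k2
  generalize ∑ e ∈ Finset.range m, (gain w key (bestPrice w key m) (2 * e) +
    gain w key (bestPrice w key m) (2 * e + 1)) = U at *
  generalize (cutGain (gain w key (bestPrice w key m)) side key m b) = C at *
  have k7 : (q + 1) * U ≤ 4 * q * C := by
    refine k2.trans ?_
    calc _ ≤ 2 * q * (C + C) := Nat.mul_le_mul_left _ (k3.trans (Nat.add_le_add k5 k6))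
      _ = _ := by ring
  have k8 : ((q : ℝ) + 1) * U ≤ 4 * q * C := by exact_mod_cast k7
  rw [div_mul_eq_mul_div, le_div_iff₀ (by positivity), mul_comm]
  calc _ ≤ ((q : ℝ) + 1) * U := by gcongr
    _ ≤ _ := k8
    _ ≤ _ := by gcongr

set_option maxHeartbeats 1000000 in
theorem partite_spec {M : Store} {I : PricingInstance} (hM : Represents M I)
    (hcol : ∀ v < I.n, M 7 v < M 6 0) (hproper : ∀ e : Fin I.m, M 7 (I.src e) ≠ M 7 (I.tgt e)) :
    ∃ y : I.Fractions, Holds (staged partite M) (I.encodePrices y) ∧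
      I.IsApprox (4 * (rounds (min (M 6 0) I.n) : ℝ) / (rounds (min (M 6 0) I.n) + 1)) y.price := by
  rw [partite, staged_append, staged_append]
  obtain ⟨hR, ⟨D, hD⟩, h12, hlow⟩ := scaleStages_spec hM
  rw [← hlow 6 (by decide)]
  rw [← hlow 6 (by decide), ← hlow 7 (by decide)] at hcol
  rw [← hlow 7 (by decide)] at hproper
  generalize staged scaleStages M = S at *
  have hedge := hR.large.edges
  have hvert := hR.large.vertices
  have hn := hR.n
  rw [← hR.m] at h12
  rw [← hn] at hcol ⊢
  set T := staged partiteStages S with hT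
  have stage : ∀ {a : ℕ} {e : Ex}, (a, e) ∈ partiteStages → ∀ {i : ℕ}, i < S 8 0 →
      ∃ M' : Store, (∀ a' < a, M' a' = T a') ∧ (∀ j < i, M' a j = T a j) ∧ T a i = e.eval M' [i] [] :=
    fun hp _ hi => partiteStages_eq hp hi
  have low : ∀ a < 13, T a = S a := fun a ha => staged_of_ne (by
    simp only [partiteStages, List.mem_cons, List.not_mem_nil, or_false, forall_eq_or_imp, forall_eq]
    omega) _
  have rep : ∀ T : Store, (∀ a < 13, T a = S a) → Represents T I := fun T hT =>
    hR.congr (fun a ha => hT a (by omega)) (hT 8 (by decide))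
  have hkey : ∀ h < 2 * S 0 1, S 12 h < S 0 0 := fun h hh => by
    rw [h12 h hh]; exact endVertex_lt hR hh
  set q := rounds (min (S 6 0) (S 0 0)) with hq
  have hqodd : q % 2 = 1 := by rw [hq, rounds]; omega
  have hqn : q ≤ S 0 0 + 1 := by rw [hq, rounds]; omega
  -- the colours
  set col : ℕ → ℕ := fun v => if S 0 0 < S 6 0 then v else S 7 v with hcoldef
  have f13 : ∀ v < S 8 0, T 13 v = col v := fun v hv => by
    obtain ⟨M', h1, -, h3⟩ := stage (a := 13) (e := colourE) (by simp [partiteStages]) hv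
    rw [h3]
    simp [colourE, numVertices, numColours, h1, low, hcoldef]
  -- All colours are below `min (S 6 0) (S 0 0)`, which is at most `q + 1`; if it is odd, colour `q`
  -- remains empty.
  have hcolq : ∀ v < S 0 0, col v ≤ q := fun v hv => by
    have := hcol v hv
    simp only [hcoldef, hq, rounds]
    split_ifs <;> omega
  -- the prices
  set p : ℕ → ℕ := bestPrice (S 10) (S 12) (S 0 1) with hp
  have f14 : ∀ v < S 8 0, T 14 v = p v := fun v hv => by
    obtain ⟨M', h1, -, h3⟩ := stage (a := 14) (e := bestPriceE) (by simp [partiteStages]) hv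
    have h1' : ∀ a < 13, M' a = S a := fun a ha => (h1 a (by omega)).trans (low a ha)
    rw [h3, bestPriceE, eval, h1' 10 (by decide), hp, bestPrice]
    congr 1
    refine eval_argmaxE (by simp [h1']) (by rw [h1' 8 (by decide)]; omega) (fun j acc _ _ => ?_)
      fun j acc _ _ => ?_ <;>
    · rw [eval_objectiveE (rep M' h1').large]
      simp [h1']
  set G : ℕ → ℕ := gain (S 10) (S 12) p with hG
  have f15 : ∀ h < 2 * S 0 1, T 15 h = G h := fun h hh => by
    obtain ⟨M', h1, -, h3⟩ := stage (a := 15) (e := gainE) (by simp [partiteStages])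
      (show h < S 8 0 by omega)
    have hk := hkey h hh
    rw [h3, hG, gain, valN]
    simp only [gainE, eval, eval_lt, List.getD_cons_zero, h1 14 (by decide), h1 12 (by decide),
      h1 10 (by decide), low 12 (by decide), low 10 (by decide), f14 _ (show S 12 h < S 8 0 by omega), ne_eq, not_not]
    split_ifs <;> omega
  set g : ℕ → ℕ := fun e => G (2 * e) + G (2 * e + 1) with hg
  have hgain : ∀ M' : Store, M' 15 = T 15 → ∀ e < S 0 1, ∀ ρ, gainSumE.eval M' (e :: ρ) [] = g e := by
    intro M' h15 e he ρ
    simp only [gainSumE, eval, eval_firstHalf, eval_secondHalf, h15, f15 _ (show 2 * e < 2 * S 0 1 by omega),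
      f15 _ (show 2 * e + 1 < 2 * S 0 1 by omega), hg]
  set c : ℕ → ℕ := fun e => col (S 12 (2 * e)) with hc
  set d : ℕ → ℕ := fun e => col (S 12 (2 * e + 1)) with hd
  have hk1 : ∀ e < S 0 1, S 12 (2 * e) < S 0 0 := fun e he => hkey _ (by omega)
  have hk2 : ∀ e < S 0 1, S 12 (2 * e + 1) < S 0 0 := fun e he => hkey _ (by omega)
  have hcd : ∀ e < S 0 1, c e ≠ d e := fun e he => by
    rw [hR.m] at he
    have := hproper ⟨e, he⟩
    rw [← hR.src, ← hR.tgt] at this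
    have hne : S 2 e ≠ S 3 e := by
      have := I.src_ne_tgt ⟨e, he⟩
      intro h
      rw [hR.src ⟨e, he⟩, hR.tgt ⟨e, he⟩] at h
      exact this (Fin.ext h)
    have e1 : (2 * e + 1) / 2 = e := by omega
    have e2 : (2 * e + 1) % 2 = 1 := by omega
    rw [← hR.m] at he
    simp only [hc, hd, hcoldef, h12 _ (show 2 * e < 2 * S 0 1 by omega),
      h12 _ (show 2 * e + 1 < 2 * S 0 1 by omega), endVertex, e1, e2]
    split_ifs <;> simp_all
  -- the best round
  have f16 : ∀ r < S 8 0, T 16 r = roundWeight g c d (S 0 1) q r := fun r hr => by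
    obtain ⟨M', h1, -, h3⟩ := stage (a := 16) (e := roundWeightE) (by simp [partiteStages]) hr
    have h1' : ∀ a < 13, M' a = S a := fun a ha => (h1 a (by omega)).trans (low a ha)
    rw [h3, roundWeight]
    refine eval_sum (by simp [h1']) (by rw [h1' 8 (by decide)]; omega) fun e acc he => ?_
    have k1 := hk1 e he
    have k2 := hk2 e he
    rw [eval, hgain M' (h1 15 (by decide)) e he]
    simp only [eval_eq, eval_pairRepE, eval, eval_firstHalf, eval_secondHalf, List.getD_cons_zero,
      List.getD_cons_succ, h1 13 (by decide), h1' 12 (by decide), h1' 6 (by decide), h1' 0 (by decide),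
      f13 _ (show S 12 (2 * e) < S 8 0 by omega), f13 _ (show S 12 (2 * e + 1) < S 8 0 by omega), ne_eq, not_not]
    rfl
  set r0 := argmax (roundWeight g c d (S 0 1) q) q with hr0
  obtain ⟨hr0q, hr0max⟩ := argmax_spec (roundWeight g c d (S 0 1) q) (show 0 < q by omega)
  rw [← hr0] at hr0q hr0max
  have f17 : ∀ i < S 8 0, T 17 i = r0 := fun i hi => by
    obtain ⟨M', h1, -, h3⟩ := stage (a := 17) (e := bestRoundE) (by simp [partiteStages]) hi
    have h1' : ∀ a < 13, M' a = S a := fun a ha => (h1 a (by omega)).trans (low a ha)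
    rw [h3]
    refine eval_argmaxE (by rw [eval_roundsE, h1' 6 (by decide), h1' 0 (by decide)])
      (by rw [h1' 8 (by decide)]; omega) (fun j acc _ _ => ?_) fun j acc _ _ => ?_ <;>
    · simp only [eval, List.getD_cons_zero, List.getD_cons_succ, h1 16 (by decide)]
      exact f16 _ (by omega)
  -- the sides
  have f18 : ∀ v < S 8 0, T 18 v = pairRep q r0 (col v) := fun v hv => by
    obtain ⟨M', h1, -, h3⟩ := stage (a := 18) (e := repE) (by simp [partiteStages]) hv
    rw [h3, repE, eval_pairRepE, h1 6 (by decide), h1 0 (by decide)]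
    simp only [eval, List.getD_cons_zero, h1 17 (by decide), h1 13 (by decide), f17 v hv, f13 v hv,
      low 6 (by decide), low 0 (by decide), hq]
  have f19 : ∀ v < S 8 0, T 19 v = pairFlip q r0 (col v) := fun v hv => by
    obtain ⟨M', h1, -, h3⟩ := stage (a := 19) (e := pairFlipE) (by simp [partiteStages]) hv
    rw [h3, pairFlip]
    simp only [pairFlipE, eval, eval_eq, List.getD_cons_zero, h1 18 (by decide), h1 13 (by decide),
      f18 v hv, f13 v hv, ne_eq, not_not]
  have f20 : ∀ i < q, T 20 i = if 2 * stepZero g (fun e => pairRep q r0 (c e)) (fun e => pairRep q r0 (d e))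
      (fun e => pairFlip q r0 (c e) + pairFlip q r0 (d e)) (T 20) (S 0 1) i <
      stepAll g (fun e => pairRep q r0 (c e)) (fun e => pairRep q r0 (d e)) (S 0 1) i then 1 else 0 := by
    intro i hi
    obtain ⟨M', h1, h2, h3⟩ := stage (a := 20) (e := greedyE) (by simp [partiteStages])
      (show i < S 8 0 by omega)
    have h1' : ∀ a < 13, M' a = S a := fun a ha => (h1 a (by omega)).trans (low a ha)
    have hrepOf : ∀ e < S 0 1, ∀ ρ, (repOf firstHalf).eval M' (e :: ρ) [] = pairRep q r0 (c e) ∧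
        (repOf secondHalf).eval M' (e :: ρ) [] = pairRep q r0 (d e) ∧
        (flipOf firstHalf).eval M' (e :: ρ) [] = pairFlip q r0 (c e) ∧
        (flipOf secondHalf).eval M' (e :: ρ) [] = pairFlip q r0 (d e) := by
      intro e he ρ
      have k1 := hk1 e he
      have k2 := hk2 e he
      simp only [repOf, flipOf, eval, eval_firstHalf, eval_secondHalf, h1 18 (by decide), h1 19 (by decide), h1' 12 (by decide)]
      rw [f18 _ (by omega), f18 _ (by omega), f19 _ (by omega), f19 _ (by omega)]
      exact ⟨rfl, rfl, rfl, rfl⟩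
    rw [h3]
    exact eval_greedyE (by rw [h1' 0 (by decide)]) (by rw [h1' 8 (by decide)]; omega)
      (hgain M' (h1 15 (by decide))) (fun e he ρ => (hrepOf e he ρ).1) (fun e he ρ => (hrepOf e he ρ).2.1)
      (fun e he ρ => (hrepOf e he ρ).2.2.1) (fun e he ρ => (hrepOf e he ρ).2.2.2) h2
  set side : ℕ → ℕ := fun v => (T 20 (pairRep q r0 (col v)) + pairFlip q r0 (col v)) % 2 with hside
  have hside2 : ∀ v, side v < 2 := fun v => Nat.mod_lt _ two_pos
  have f21 : ∀ v < S 8 0, T 21 v = side v := fun v hv => by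
    obtain ⟨M', h1, -, h3⟩ := stage (a := 21) (e := sideE) (by simp [partiteStages]) hv
    rw [h3, sideE, eval_mod2]
    simp only [eval, List.getD_cons_zero, h1 18 (by decide), h1 19 (by decide), h1 20 (by decide),
      f18 v hv, f19 v hv, hside]
  have f22 : ∀ b < S 8 0, T 22 b = cutGain G side (S 12) (S 0 1) b := fun b hb => by
    obtain ⟨M', h1, -, h3⟩ := stage (a := 22) (e := cutGainE) (by simp [partiteStages]) hb
    have h1' : ∀ a < 13, M' a = S a := fun a ha => (h1 a (by omega)).trans (low a ha)
    rw [h3]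
    refine eval_cutGainE (by rw [h1' 0 (by decide)]) (by rw [h1' 8 (by decide)]; omega) (h1' 12 (by decide))
      (fun h hh => ?_) fun h hh => ?_
    · have := hkey h hh
      rw [h1 21 (by decide)]
      exact f21 _ (by omega)
    · rw [h1 15 (by decide)]
      exact f15 h hh
  obtain ⟨hb2, hbmax⟩ := argmax_spec (cutGain G side (S 12) (S 0 1)) two_pos
  set b0 := argmax (cutGain G side (S 12) (S 0 1)) 2 with hb0
  have f23 : ∀ i < S 8 0, T 23 i = b0 := fun i hi => by
    obtain ⟨M', h1, -, h3⟩ := stage (a := 23) (e := bestSideE) (by simp [partiteStages]) hi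
    have h1' : ∀ a < 13, M' a = S a := fun a ha => (h1 a (by omega)).trans (low a ha)
    rw [h3]
    refine eval_argmaxE (by simp) (by rw [h1' 8 (by decide)]; omega) (fun j acc _ _ => ?_)
      fun j acc _ _ => ?_ <;>
    · simp only [eval, List.getD_cons_zero, List.getD_cons_succ, h1 22 (by decide)]
      exact f22 _ (by omega)
  have f24 : ∀ v < S 8 0, T 24 v = if side v = b0 then p v else 0 := fun v hv => by
    obtain ⟨M', h1, -, h3⟩ := stage (a := 24) (e := finalPriceE) (by simp [partiteStages]) hv
    rw [h3]
    simp only [finalPriceE, eval, eval_eq, List.getD_cons_zero, h1 21 (by decide), h1 23 (by decide),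
      h1 14 (by decide), f21 v hv, f23 v hv, f14 v hv, ne_eq, not_not]
  refine exists_output (rep T low) (D := D) (hD.congr (low 8 (by decide)) (low 10 (by decide))
    (low 11 (by decide))) (by decide) fun Q hQ => ?_
  have hev : endVertex T = endVertex S := by
    funext h; simp only [endVertex, low 2 (by decide), low 3 (by decide)]
  rw [hev, low 0 (by decide), low 10 (by decide), keyRevenue_congr (fun h hh => (h12 h hh).symm) fun _ _ => rfl,
    keyRevenue_congr (q' := fun v => ((if side v = b0 then p v else 0 : ℕ) : ℝ))
      (fun h hh => (h12 h hh).symm) fun h hh => by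
        have := hkey h hh
        rw [f24 _ (by omega)]]
  exact keyRevenue_le_cut hQ hkey hqodd hr0q hcolq hcd hr0max f20 (fun _ => rfl) hbmax

end Program

end GVP

/-! ## The theorem -/

namespace GVP

open RAM Program

theorem PricingInstance.revenue_nonneg (I : PricingInstance) (p : Fin I.n → ℝ≥0) : 0 ≤ I.revenue p :=
  Finset.sum_nonneg fun e _ => val_nonneg (w := (I.budget e : ℝ)) (p (I.src e)).2 (p (I.tgt e)).2

/-- For even `k` there are `k - 1` rounds, for odd `k` there are `k`. -/
theorem partiteFactor_eq {k : ℕ} (hk : 1 ≤ k) :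
    partiteFactor k = 4 * (rounds k : ℝ) / ((rounds k : ℝ) + 1) := by
  unfold partiteFactor
  split_ifs with h
  · obtain ⟨j, rfl⟩ := h
    have e : rounds (j + j) + 1 = j + j := by unfold rounds; omega
    have e' : (rounds (j + j) : ℝ) + 1 = (j + j : ℕ) := by exact_mod_cast e
    have hj : ((j + j : ℕ) : ℝ) ≠ 0 := by exact_mod_cast (by omega : j + j ≠ 0)
    rw [e', eq_sub_of_add_eq e']
    field_simp
  · have e : rounds k = k := by
      rw [Nat.not_even_iff_odd] at h
      obtain ⟨j, rfl⟩ := h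
      unfold rounds; omega
    rw [e]

/-- The factor `4 * q / (q + 1)` increases with the number `q` of rounds, so replacing `k` by a
smaller number of classes does no harm. -/
theorem factor_le_partiteFactor {k n : ℕ} (hk : 1 ≤ k) :
    4 * (rounds (min k n) : ℝ) / (rounds (min k n) + 1) ≤ partiteFactor k := by
  have h : (rounds (min k n) : ℝ) ≤ rounds k := by
    have : rounds (min k n) ≤ rounds k := by unfold rounds; omega
    exact_mod_cast this
  rw [partiteFactor_eq hk, div_le_div_iff₀ (by positivity) (by positivity)]
  nlinarith

theorem PartiteInstance.load_encode (J : PartiteInstance) {a : ℕ} (ha : a < 6) :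
    load J.encode a = load J.toPricingInstance.encode a := by
  funext i
  have h : a < J.toPricingInstance.encode.length := ha
  rw [load, load, PartiteInstance.encode, List.getD_append _ _ _ _ h]

theorem PartiteInstance.inputSize_le (J : PartiteInstance) :
    inputSize J.toPricingInstance.encode ≤ inputSize J.encode := by
  simp only [inputSize, PartiteInstance.encode, List.map_append, List.sum_append]
  exact Nat.le_add_right _ _

/-- The programs for graphs of bounded degree run in polynomial time. -/
theorem polyTimeSolvable_of_spec {d : ℕ} {ρ : ℝ} (l : List (ℕ × Ex)) (hl : ∀ p ∈ l, p.1 ≠ 8)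
    (h : ∀ (M : Store) (I : PricingInstance), Represents M I → (∀ v, I.degree v ≤ d) →
      ∃ y : I.Fractions, Holds (staged l M) (I.encodePrices y) ∧ I.IsApprox ρ y.price) :
    PolyTimeSolvable (fun I : PricingInstance => ∀ v, I.degree v ≤ d) PricingInstance.encode
      PricingInstance.encodePrices (fun I y => I.IsApprox ρ y.price) :=
  polyTimeSolvable_of_stages l hl (fun _ => by simp [PricingInstance.encode])
    (fun I => I.inputSize_encode.1) (fun I => I.inputSize_encode.2.1) (fun I => I.inputSize_encode.2.2)
    (fun _ _ => by simp [PricingInstance.encodePrices])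
    fun I hI M hM => h M I (represents_of_prepared hM fun _ _ => rfl) hI

theorem partite_polyTimeSolvable : PolyTimeSolvable (fun J : PartiteInstance => 1 ≤ J.k)
    PartiteInstance.encode (fun J => J.toPricingInstance.encodePrices)
    (fun J y => J.toPricingInstance.IsApprox (partiteFactor J.k) y.price) := by
  refine polyTimeSolvable_of_stages partite ?_ (fun _ => by
    simp [PartiteInstance.encode, PricingInstance.encode]) (fun J => ?_) (fun J => ?_) (fun J => ?_)
    (fun _ _ => by simp [PricingInstance.encodePrices]) fun J hk M hM => ?_
  · simp [partite, scaleStages, partiteStages]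
  · exact J.inputSize_encode.1.trans J.inputSize_le
  · exact J.inputSize_encode.2.1.trans J.inputSize_le
  · rw [J.load_encode (by decide), J.load_encode (by decide), J.load_encode (by decide)]
    exact J.inputSize_encode.2.2.trans J.inputSize_le
  · have h6 : M 6 0 = J.k := by rw [hM.1 6 (by decide)]; rfl
    have h7 : ∀ v : Fin J.n, M 7 v = J.color v := fun v => by
      rw [hM.1 7 (by decide)]
      exact getD_ofFn (fun v => (J.color v : ℕ)) v
    obtain ⟨y, hy, hR⟩ := partite_spec (I := J.toPricingInstance)
      (represents_of_prepared hM fun a ha => J.load_encode ha)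
      (fun v hv => by rw [h6, h7 ⟨v, hv⟩]; exact (J.color _).2)
      (fun e h => J.proper e (Fin.ext (by rw [← h7, ← h7]; exact h)))
    refine ⟨y, hy, fun q => (hR q).trans ?_⟩
    rw [h6]
    exact mul_le_mul_of_nonneg_right (factor_le_partiteFactor hk) (J.revenue_nonneg _)

end GVP

theorem mainTheorem8 :
    -- exact polynomial-time solution for maximum degree at most two
    RAM.PolyTimeSolvable
      (fun I : GVP.PricingInstance => ∀ v, I.degree v ≤ 2)
      GVP.PricingInstance.encode
      GVP.PricingInstance.encodePrices
      (fun I y => I.IsOptimal y.price) ∧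
    -- polynomial-time 2-approximation for maximum degree at most four
    RAM.PolyTimeSolvable
      (fun I : GVP.PricingInstance => ∀ v, I.degree v ≤ 4)
      GVP.PricingInstance.encode
      GVP.PricingInstance.encodePrices
      (fun I y => I.IsApprox 2 y.price) ∧
    -- polynomial-time approximation for k-partite graphs, k and the partition being given
    RAM.PolyTimeSolvable
      (fun J : GVP.PartiteInstance => 1 ≤ J.k)
      GVP.PartiteInstance.encode
      (fun J => J.toPricingInstance.encodePrices)
      (fun J y => J.toPricingInstance.IsApprox (GVP.partiteFactor J.k) y.price) := by
  refine ⟨?_, ?_, GVP.partite_polyTimeSolvable⟩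
  · simpa only [GVP.PricingInstance.IsApprox, GVP.PricingInstance.IsOptimal, one_mul] using
      GVP.polyTimeSolvable_of_spec GVP.Program.degreeTwo
        (by simp [GVP.Program.degreeTwo, GVP.Program.scaleStages]) fun M I => GVP.Program.degreeTwo_spec
  · exact GVP.polyTimeSolvable_of_spec GVP.Program.degreeFour
      (by simp [GVP.Program.degreeFour, GVP.Program.scaleStages]) fun M I => GVP.Program.degreeFour_spec
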